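/- Let $m,n\ge 1$, write points of $\mathbb R^{m+n}$ as $(t,x)$ with $t\in\mathbb R^m$, $x\in\mathbb R^n$, and let $\square=-\Delta_t+\Delta_x$. Let $T>0$, $G=(-T,T)^m$, let $\Omega\subset\mathbb R^n$ be non-empty, open and bounded with smooth boundary and outward unit normal $\nu$, and put $\mathfrak U=G\times\Omega$, $\partial\mathfrak U:=G\times\partial\Omega$, with outward unit normal $\mathcal N=(0,\nu)$ on $\partial\mathfrak U$. Fix $p=(t(p),x(p))\in\mathbb R^{m+n}$ and put $$r_p=|x-x(p)|,\qquad f_p=\tfrac14\big(|x-x(p)|^2-|t-t(p)|^2\big),\qquad \mathfrak D_p=\{f_p>0\},\qquad R_+=\sup_{\mathfrak U\cap\mathfrak D_p}r_p .$$ Assume that $T>R_+$ and that the closure of $\mathfrak U\cap\mathfrak D_p$ does not meet the temporal part of the boundary of $\mathfrak U$, i.e. $\overline{\mathfrak U\cap\mathfrak D_p}\subset G\times\mathbb R^n$ (this follows from $T>R_+$ if $t(p)=0$). Let $\mathcal X\in C^\infty(\overline{\mathfrak U};\mathbb R^{m+n})$ vanish on $\mathfrak U\cap\partial\mathfrak D_p$,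 let $V,F\in C^\infty(\overline{\mathfrak U})$, and let $H$ be a real function on $\partial\mathfrak U$. Let $z_1,z_2$ be real functions that are $C^2$ in $\mathfrak U$ and $C^1$ on $G\times\overline\Omega$ (that is, up to $\partial\mathfrak U$), and that both satisfy $$\square z+\nabla_{\mathcal X}z+Vz=F\ \text{ in }\mathfrak U,\qquad z=H\ \text{ on }\partial\mathfrak U .$$ Let $\sigma>0$ and let $\varepsilon>0$ satisfy $\varepsilon R_+<1$. Put $$\Gamma_p^\varepsilon=\partial\mathfrak U\cap\mathfrak D_p\cap\{(1-\varepsilon r_p)\,\mathcal N f_p+\varepsilon f_p\,\mathcal N r_p>0\},\qquad W_p^\varepsilon=\Big(\bigcup_{(t,y)\in\Gamma_p^\varepsilon}\{t\}\times\{y_1\in\mathbb R^n:|y_1-y|<\sigma\}\Big)\cap\mathfrak U\cap\mathfrak D_p .$$ Then: 1. If $(z_1,\nabla_t z_1)=(z_2,\nabla_t z_2)$ on $W_p^\varepsilon$, then $z_1=z_2$ on $\mathfrak U\cap\mathfrak D_p$. 2. If $(z_1,\nabla_x z_1)=(z_2,\nabla_x z_2)$ on $W_p^\varepsilon$, then $z_1=z_2$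 on $\mathfrak U\cap\mathfrak D_p$. -/

import Mathlib

open Set
open scoped ContDiff Gradient Topology

noncomputable section

namespace Ultrahyperbolic

/-- Euclidean space `ℝᵏ`. -/
abbrev E (k : ℕ) : Type := EuclideanSpace ℝ (Fin k)

/-- Space-time `ℝᵐ × ℝⁿ`, with points `q = (t, x)`. -/
abbrev ST (m n : ℕ) : Type := E m × E n

/-- The open hypercube `G = (-T, T)ᵐ`. -/
def cube (m : ℕ) (T : ℝ) : Set (E m) := {t | ∀ i, -T < t i ∧ t i < T}

/-- The cylinder `𝔘 = G × Ω`. -/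
def cyl (m : ℕ) {n : ℕ} (T : ℝ) (Ω : Set (E n)) : Set (ST m n) := cube m T ×ˢ Ω

/-- The lateral boundary `∂𝔘 = G × ∂Ω`. -/
def lateral (m : ℕ) {n : ℕ} (T : ℝ) (Ω : Set (E n)) : Set (ST m n) :=
  cube m T ×ˢ frontier Ω

section Geometry

variable {m n : ℕ}

/-- `r_p = |x - x(p)|`. -/
def rp (p q : ST m n) : ℝ := ‖q.2 - p.2‖

/-- `f_p = (|x - x(p)|² - |t - t(p)|²) / 4`. -/
def fp (p q : ST m n) : ℝ := (‖q.2 - p.2‖ ^ 2 - ‖q.1 - p.1‖ ^ 2) / 4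

/-- The exterior `𝔇_p = {f_p > 0}` of the null cone with vertex `p`. -/
def Dp (p : ST m n) : Set (ST m n) := {q | 0 < fp p q}

/-- `R₊`, the supremum of `r_p` over `𝔘 ∩ 𝔇_p` (a bounded set of reals when `Ω` is bounded;
the value is `0` when `𝔘 ∩ 𝔇_p` is empty). -/
def Rplus (T : ℝ) (Ω : Set (E n)) (p : ST m n) : ℝ := sSup (rp p '' (cyl m T Ω ∩ Dp p))

/-- `φ` is a smooth function near `y` with nonzero gradient at `y`,
and `Ω = {φ < 0}` near `y`. -/
def IsDefiningAt (Ω : Set (E n)) (y : E n) (φ : E n → ℝ) : Prop :=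
  (∃ N ∈ 𝓝 y, ContDiffOn ℝ ∞ φ N ∧ ∀ x ∈ N, (x ∈ Ω ↔ φ x < 0)) ∧ ∇ φ y ≠ 0

/-- `Ω` has smooth boundary: near each boundary point it is a strict sublevel set of a
smooth function with nonzero gradient. -/
def HasSmoothBoundary (Ω : Set (E n)) : Prop := ∀ y ∈ frontier Ω, ∃ φ, IsDefiningAt Ω y φ

/-- `ν` is the outward unit normal of `Ω` at its boundary point `y`. -/
def IsOutwardUnitNormal (Ω : Set (E n)) (y ν : E n) : Prop :=
  ∃ φ, IsDefiningAt Ω y φ ∧ ν = ‖∇ φ y‖⁻¹ • ∇ φ y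

/-- `Γ_p^ε`: the points of `∂𝔘 ∩ 𝔇_p` where `(1 - ε r_p) 𝒩 f_p + ε f_p 𝒩 r_p > 0`.
The outward unit normal of the cylinder on `G × ∂Ω` is `𝒩 = (0, ν)`. -/
def Gam (T : ℝ) (Ω : Set (E n)) (p : ST m n) (ε : ℝ) : Set (ST m n) :=
  {q | q ∈ lateral m T Ω ∩ Dp p ∧ ∃ ν, IsOutwardUnitNormal Ω q.2 ν ∧
    0 < (1 - ε * rp p q) * fderiv ℝ (fp p) q (0, ν) + ε * fp p q * fderiv ℝ (rp p) q (0, ν)}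

/-- The spatial `σ`-neighbourhood of a set: the union over its points `(t, y)` of
`{t} × {y₁ : |y₁ - y| < σ}`. -/
def nbhd (σ : ℝ) (S : Set (ST m n)) : Set (ST m n) :=
  ⋃ s ∈ S, {s.1} ×ˢ Metric.ball s.2 σ

/-- The interior observation region `W_p^ε`. -/
def Wp (T : ℝ) (Ω : Set (E n)) (p : ST m n) (ε σ : ℝ) : Set (ST m n) :=
  nbhd σ (Gam T Ω p ε) ∩ (cyl m T Ω ∩ Dp p)

/-- The time gradient `∇_t z`. -/
def gradT (z : ST m n → ℝ) (q : ST m n) : E m := ∇ (fun t => z (t, q.2)) q.1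

/-- The space gradient `∇_x z`. -/
def gradX (z : ST m n → ℝ) (q : ST m n) : E n := ∇ (fun x => z (q.1, x)) q.2

/-- The ultrahyperbolic operator `□ = -Δ_t + Δ_x`. -/
def box (z : ST m n → ℝ) (q : ST m n) : ℝ :=
  -Laplacian.laplacian (fun t => z (t, q.2)) q.1 + Laplacian.laplacian (fun x => z (q.1, x)) q.2

/-- `z` is a classical solution of `□z + ∇_𝒳 z + V z = F` in `𝔘` with `z = H` on `∂𝔘`; it is
`C²` in `𝔘` and `C¹` up to the lateral boundary. -/
structure IsSolution (T : ℝ) (Ω : Set (E n)) (X : ST m n → ST m n) (V F H : ST m n → ℝ)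
    (z : ST m n → ℝ) : Prop where
  contDiffOn_two : ContDiffOn ℝ 2 z (cyl m T Ω)
  contDiffOn_one : ContDiffOn ℝ 1 z (cube m T ×ˢ closure Ω)
  equation : ∀ q ∈ cyl m T Ω, box z q + fderiv ℝ z q (X q) + V q * z q = F q
  dirichlet : ∀ q ∈ lateral m T Ω, z q = H q

end Geometry

end Ultrahyperbolic

end

/-! Put z = z₁ - z₂. It solves the homogeneous equation, vanishes on the lateral boundary, and
vanishes on the observation region as soon as the values of z₁ and z₂ agree there. Both items
therefore reduce to one unique continuation statement, `eq_zero_of_observation`, which rests on a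
Carleman inequality.

The weight. The Hessian of f_p is half the ultrahyperbolic metric g, so the level sets of f_p are
only borderline pseudoconvex. Dividing by 1 - ε r_p tips the balance: for k = f_p / (1 - ε r_p) the
Hessian minus a slightly larger multiple of g is positive on the tangent spaces of the level sets of
k (`hessQ_kp_pos`). The reason is that tangency bounds the radial part of a vector by its time part,
because |t - t(p)| < r_p on 𝔇_p. The gradient of k is spacelike (`gpair_kp`), and ψ = exp(τ k) with
τ large also has the positivity needed in the normal direction (`exists_weight`).

The multiplier. For w = e^{λψ} u, multiply the conjugated equation by g(∇ψ, ∇w) + κ w. The resulting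
identity (`divg_current`) writes the product as the divergence of a current J plus quadratic terms.
With κ = □ψ/2 - μ these terms are coercive, and for large λ (`carleman_pointwise`) div J ≥ e^{2λψ}
(c (|∇u|² + λ² u²) - |□u|² / λ).

The boundary. Take u = ζ z with a cutoff ζ that vanishes near the null cone. On the lateral boundary
w = 0, and the outward flux of J is half of (∂_ν w)² ∂_ν ψ. The set Γ is exactly where ∂_ν k > 0:
off Γ the flux is nonpositive, and at Γ it vanishes because z = 0 on nearby points of the region.
Since z is merely C¹ up to the boundary, J need not be differentiable there. The divergence theorem
is replaced by a one-sided inequality obtained by truncating near the boundary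
(`setIntegral_divg_nonpos`), and it gives ∫ div J ≤ 0 (`setIntegral_divg_current_nonpos`).

Conclusion. Where k > 2c, u = z and the equation absorbs |□u|²/λ. Where c ≤ k ≤ 2c, the weight is at
most its value at k = 2c. If z were nonzero at a point with k = 3c, dividing by that value and
letting λ → ∞ would bound λ² times a positive number by a constant. -/

namespace Ultrahyperbolic

open MeasureTheory Filter

/-! ### Divergence theorem as an inequality, for fields that are C¹ only in the interior -/

section Divergence

variable {E : Type*} [NormedAddCommGroup E] [NormedSpace ℝ E] {ι : Type*} [Fintype ι]

/-- The divergence of the field with components `J i` along the directions `e i`. -/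
noncomputable def divg (e : ι → E) (J : ι → E → ℝ) (x : E) : ℝ := ∑ i, fderiv ℝ (J i) x (e i)

/-- Extension by zero of the product of a `C¹` function with support inside `U` and a function
which is `C¹` on `U`. -/
theorem contDiff_mul_of_tsupport_subset {U : Set E} (hU : IsOpen U) {F g : E → ℝ}
    (hF : ContDiff ℝ 1 F) (hFU : tsupport F ⊆ U) (hg : ContDiffOn ℝ 1 g U) :
    ContDiff ℝ 1 fun x => F x * g x := by
  rw [contDiff_iff_contDiffAt]
  intro x
  by_cases hx : x ∈ tsupport F
  · exact hF.contDiffAt.mul (hg.contDiffAt (hU.mem_nhds (hFU hx)))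
  · have : (fun x => F x * g x) =ᶠ[𝓝 x] fun _ => 0 := by
      have h0 := notMem_tsupport_iff_eventuallyEq.1 hx
      filter_upwards [h0] with y hy
      simp [hy]
    exact contDiffAt_const.congr_of_eventuallyEq this

theorem continuousOn_divg {U : Set E} (hU : IsOpen U) (e : ι → E)
    {J : ι → E → ℝ} (hJ : ∀ i, ContDiffOn ℝ 1 (J i) U) : ContinuousOn (divg e J) U := by
  unfold divg
  refine continuousOn_finsetSum _ fun i _ => ?_
  exact ((hJ i).continuousOn_fderiv_of_isOpen hU le_rfl).clm_apply continuousOn_const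

variable [MeasurableSpace E] [BorelSpace E] {μ : Measure E}

theorem integrableOn_mul_divg_add [IsFiniteMeasureOnCompacts μ] {U : Set E} (hU : IsOpen U) (e : ι → E)
    {J : ι → E → ℝ} (hJ : ∀ i, ContDiffOn ℝ 1 (J i) U) {C : ℝ} (hJC : ∀ i, ∀ x ∈ U, |J i x| ≤ C)
    (hdC : ∀ x ∈ U, |divg e J x| ≤ C) {F : E → ℝ} (hF : ContDiff ℝ 1 F)
    (hc : HasCompactSupport F) :
    IntegrableOn (fun x => F x * divg e J x + ∑ i, fderiv ℝ F x (e i) * J i x) U μ := by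
  refine Integrable.add ?_ (integrable_finsetSum _ fun i _ => ?_)
  · refine Integrable.mul_bdd (c := C)
      (hF.continuous.integrable_of_hasCompactSupport hc).integrableOn ?_ ?_
    · exact (continuousOn_divg hU e hJ).aestronglyMeasurable hU.measurableSet
    · filter_upwards [ae_restrict_mem hU.measurableSet] with x hx
      simpa using hdC x hx
  · refine Integrable.mul_bdd (c := C)
      (((hF.continuous_fderiv one_ne_zero).clm_apply
        continuous_const).integrable_of_hasCompactSupport (hc.fderiv_apply ℝ _)).integrableOn ?_ ?_
    · exact (hJ i).continuousOn.aestronglyMeasurable hU.measurableSet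
    · filter_upwards [ae_restrict_mem hU.measurableSet] with x hx
      simpa using hJC i x hx

variable [FiniteDimensional ℝ E] [μ.IsAddHaarMeasure]

theorem integral_fderiv_eq_zero {f : E → ℝ} (hf : ContDiff ℝ 1 f) (hc : HasCompactSupport f)
    (v : E) : ∫ x, fderiv ℝ f x v ∂μ = 0 := by
  have hcont : Continuous fun x => fderiv ℝ f x v :=
    (hf.continuous_fderiv one_ne_zero).clm_apply continuous_const
  have hcs : HasCompactSupport fun x => fderiv ℝ f x v := hc.fderiv_apply ℝ v
  have h := integral_mul_fderiv_eq_neg_fderiv_mul_of_integrable (μ := μ) (f := fun _ : E => (1 : ℝ))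
    (g := f) (v := v) (by simp) (by simpa using hcont.integrable_of_hasCompactSupport hcs)
    (by simpa using hf.continuous.integrable_of_hasCompactSupport hc)
    (fun _ _ => differentiableAt_const _) (fun x _ => hf.differentiable one_ne_zero x)
  simpa using h

/-- The integrand is the divergence of F J, which extends by zero to a compactly supported C¹ field
on the whole space, so no boundary term arises. -/
theorem setIntegral_divg_of_tsupport_subset {U : Set E} (hU : IsOpen U) (e : ι → E)
    {J : ι → E → ℝ} (hJ : ∀ i, ContDiffOn ℝ 1 (J i) U) {F : E → ℝ} (hF : ContDiff ℝ 1 F)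
    (hc : HasCompactSupport F) (hFU : tsupport F ⊆ U) :
    ∫ x in U, (F x * divg e J x + ∑ i, fderiv ℝ F x (e i) * J i x) ∂μ = 0 := by
  have hcd := fun i => contDiff_mul_of_tsupport_subset hU hF hFU (hJ i)
  have hcs : ∀ i, HasCompactSupport fun x => F x * J i x := fun i => hc.mul_right
  have key : ∀ x, (F x * divg e J x + ∑ i, fderiv ℝ F x (e i) * J i x)
      = ∑ i, fderiv ℝ (fun x => F x * J i x) x (e i) := by
    intro x
    by_cases hx : x ∈ tsupport F
    · rw [divg, Finset.mul_sum, ← Finset.sum_add_distrib]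
      refine Finset.sum_congr rfl fun i _ => ?_
      have h1 : DifferentiableAt ℝ F x := hF.differentiable one_ne_zero x
      have h2 : DifferentiableAt ℝ (J i) x :=
        ((hJ i).contDiffAt (hU.mem_nhds (hFU hx))).differentiableAt one_ne_zero
      rw [fderiv_fun_mul h1 h2]
      simp
      ring
    · have h0 := notMem_tsupport_iff_eventuallyEq.1 hx
      have h1 : F x = 0 := h0.eq_of_nhds
      have h2 : fderiv ℝ F x = 0 := by rw [h0.fderiv_eq]; simp [Pi.zero_def]
      have h3 : ∀ i, fderiv ℝ (fun x => F x * J i x) x = 0 := by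
        intro i
        have : (fun x => F x * J i x) =ᶠ[𝓝 x] fun _ => 0 := by
          filter_upwards [h0] with y hy
          simp [hy]
        rw [this.fderiv_eq]
        simp
      simp [h1, h2, h3]
  rw [setIntegral_eq_integral_of_forall_compl_eq_zero]
  · simp_rw [key]
    rw [integral_finsetSum]
    · exact Finset.sum_eq_zero fun i _ => integral_fderiv_eq_zero (hcd i) (hcs i) _
    · intro i _
      exact (((hcd i).continuous_fderiv one_ne_zero).clm_apply
        continuous_const).integrable_of_hasCompactSupport ((hcs i).fderiv_apply ℝ _)
  · intro x hx
    have hx' : x ∉ tsupport F := fun h => hx (hFU h)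
    have h0 := notMem_tsupport_iff_eventuallyEq.1 hx'
    have h1 : F x = 0 := h0.eq_of_nhds
    have h2 : fderiv ℝ F x = 0 := by rw [h0.fderiv_eq]; simp [Pi.zero_def]
    simp [h1, h2]

/-- Localized divergence inequality at a boundary point: `U` is `{φ < 0}` near the support of `θ`,
and the field `J` does not point outward in the limit. -/
theorem setIntegral_divg_le_of_boundary {U N : Set E} (hU : IsOpen U) (hN : IsOpen N) (e : ι → E)
    {J : ι → E → ℝ} (hJ : ∀ i, ContDiffOn ℝ 1 (J i) U) {C : ℝ} (hJC : ∀ i, ∀ x ∈ U, |J i x| ≤ C)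
    (hdC : ∀ x ∈ U, |divg e J x| ≤ C) {θ φ : E → ℝ} (hθ : ContDiff ℝ 1 θ) (hθ0 : ∀ x, 0 ≤ θ x)
    (hc : HasCompactSupport θ) (hθN : tsupport θ ⊆ N) (hφ : ContDiffOn ℝ 1 φ N)
    (hφU : ∀ x ∈ N, (x ∈ U ↔ φ x < 0)) {v : E} {c : ℝ} (hc0 : 0 < c)
    (hv : ∀ x ∈ N, c ≤ fderiv ℝ φ x v)
    (hlim : ∀ η > 0, ∃ δ > 0, ∀ x ∈ tsupport θ, x ∈ U → -δ < φ x →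
      ∑ i, fderiv ℝ φ x (e i) * J i x ≤ η) :
    ∫ x in U, (θ x * divg e J x + ∑ i, fderiv ℝ θ x (e i) * J i x) ∂μ ≤ 0 := by
  set χ : ℝ → ℝ := fun y => Real.smoothTransition (y - 1) with hχdef
  have hχ : ContDiff ℝ 1 χ := Real.smoothTransition.contDiff.comp (contDiff_id.sub contDiff_const)
  have hχ0 : ∀ y ≤ 1, χ y = 0 := fun y hy =>
    Real.smoothTransition.zero_of_nonpos (by linarith)
  have hχ1 : ∀ y, 2 ≤ y → χ y = 1 := fun y hy =>
    Real.smoothTransition.one_of_one_le (by linarith)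
  have hχnn : ∀ y, 0 ≤ χ y := fun y => Real.smoothTransition.nonneg _
  have hχle : ∀ y, χ y ≤ 1 := fun y => Real.smoothTransition.le_one _
  have hχm : Monotone χ := fun a b hab => Real.smoothTransition.monotone (by linarith)
  have hχd : ∀ y, 0 ≤ deriv χ y := fun y => hχm.deriv_nonneg
  have hχd2 : ∀ y, 2 < y → deriv χ y = 0 := by
    intro y hy
    have : χ =ᶠ[𝓝 y] fun _ => 1 := by
      filter_upwards [lt_mem_nhds hy] with a ha using hχ1 a ha.le
    rw [this.deriv_eq]
    simp
  have hφd : ∀ x ∈ N, DifferentiableAt ℝ φ x := fun x hx =>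
    (hφ.contDiffAt (hN.mem_nhds hx)).differentiableAt one_ne_zero
  -- The truncation is supported in {φ ≤ -δ}, hence inside U, and tends to θ on U as δ → 0. Its
  -- gradient has an extra term concentrated in the layer -2δ ≤ φ ≤ -δ, which carries the boundary
  -- flux.
  set F : ℝ → E → ℝ := fun δ x => θ x * χ (-φ x / δ) with hFdef
  have hFcd : ∀ δ, ContDiff ℝ 1 (F δ) := by
    intro δ
    refine contDiff_mul_of_tsupport_subset hN hθ hθN ?_
    exact hχ.comp_contDiffOn (hφ.neg.div_const δ)
  have hFc : ∀ δ, HasCompactSupport (F δ) := fun δ => hc.mul_right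
  have hFθ : ∀ δ, tsupport (F δ) ⊆ tsupport θ := fun δ => tsupport_mul_subset_left
  have hFU : ∀ δ > 0, tsupport (F δ) ⊆ U := by
    intro δ hδ x hx
    have hcl : IsClosed {x | x ∈ tsupport θ ∧ φ x ≤ -δ} := by
      have := (hφ.continuousOn.mono hθN).preimage_isClosed_of_isClosed
        (isClosed_tsupport θ) (isClosed_Iic (a := -δ))
      exact this
    have hsub : tsupport (F δ) ⊆ {x | x ∈ tsupport θ ∧ φ x ≤ -δ} := by
      refine closure_minimal ?_ hcl
      intro y hy
      refine ⟨hFθ δ (subset_tsupport _ hy), ?_⟩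
      by_contra hlt
      push Not at hlt
      apply hy
      have : χ (-φ y / δ) = 0 := hχ0 _ (by rw [div_le_one hδ]; linarith)
      simp [hFdef, this]
    have h := hsub hx
    exact (hφU x (hθN h.1)).2 (by linarith [h.2])
  -- the derivative of the cutoff
  have hFd : ∀ δ > 0, ∀ x w, fderiv ℝ (F δ) x w
      = χ (-φ x / δ) * fderiv ℝ θ x w - θ x * (deriv χ (-φ x / δ) / δ) * fderiv ℝ φ x w := by
    intro δ hδ x w
    by_cases hx : x ∈ tsupport θ
    · have h1 : HasFDerivAt θ (fderiv ℝ θ x) x := (hθ.differentiable one_ne_zero x).hasFDerivAt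
      have h2 : HasFDerivAt φ (fderiv ℝ φ x) x := (hφd x (hθN hx)).hasFDerivAt
      have h3 : HasDerivAt χ (deriv χ (-φ x / δ)) (-φ x / δ) :=
        (hχ.differentiable one_ne_zero _).hasDerivAt
      have h4 : HasFDerivAt (fun x => -φ x / δ) (δ⁻¹ • -fderiv ℝ φ x) x := by
        have := h2.neg.const_mul δ⁻¹
        refine this.congr_of_eventuallyEq (Eventually.of_forall fun y => ?_)
        simp [div_eq_inv_mul]
      have h5 := h1.mul (h3.comp_hasFDerivAt x h4)
      have h6 : fderiv ℝ (F δ) x = _ := h5.fderiv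
      rw [h6]
      simp
      ring
    · have h0 := notMem_tsupport_iff_eventuallyEq.1 hx
      have h0' : F δ =ᶠ[𝓝 x] fun _ => 0 := by
        filter_upwards [h0] with y hy
        simp [hFdef, hy]
      have h1 : θ x = 0 := h0.eq_of_nhds
      rw [h0.fderiv_eq, h0'.fderiv_eq, h1]
      simp [Pi.zero_def]
  -- the layer estimate
  set Cθ : ℝ := ∫ x, |fderiv ℝ θ x v| ∂μ with hCθ
  have hCθ0 : 0 ≤ Cθ := integral_nonneg fun x => abs_nonneg _
  have hθi : ∀ w, Integrable (fun x => fderiv ℝ θ x w) μ := fun w =>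
    ((hθ.continuous_fderiv one_ne_zero).clm_apply
        continuous_const).integrable_of_hasCompactSupport (hc.fderiv_apply ℝ _)
  have hcθφ : ∀ δ, ContinuousOn (fun x => χ (-φ x / δ)) N := fun δ =>
    hχ.continuous.comp_continuousOn (hφ.continuousOn.neg.div_const δ)
  have hcont : ∀ δ > 0, Continuous fun x => θ x * (deriv χ (-φ x / δ) / δ) := by
    intro δ hδ
    rw [continuous_iff_continuousAt]
    intro x
    by_cases hx : x ∈ tsupport θ
    · refine hθ.continuous.continuousAt.mul ?_
      have : ContinuousOn (fun x => deriv χ (-φ x / δ) / δ) N :=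
        ((hχ.continuous_deriv le_rfl).comp_continuousOn
          (hφ.continuousOn.neg.div_const δ)).div_const δ
      exact this.continuousAt (hN.mem_nhds (hθN hx))
    · have h0 := notMem_tsupport_iff_eventuallyEq.1 hx
      refine continuousAt_const.congr (f := fun _ => (0 : ℝ)) ?_
      filter_upwards [h0] with y hy
      simp [hy]
  have hlayi : ∀ δ > 0, Integrable (fun x => θ x * (deriv χ (-φ x / δ) / δ)) μ := fun δ hδ =>
    (hcont δ hδ).integrable_of_hasCompactSupport hc.mul_right
  -- The mass of the layer is bounded uniformly in δ. The integral of the derivative of `F δ` along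
  -- v is zero, and ∂_v φ ≥ c turns the layer term of that derivative into an upper bound for the
  -- mass, with no need to measure level sets of φ.
  have hlay : ∀ δ > 0, ∫ x, θ x * (deriv χ (-φ x / δ) / δ) ∂μ ≤ Cθ / c := by
    intro δ hδ
    have h0 := integral_fderiv_eq_zero (μ := μ) (hFcd δ) (hFc δ) v
    have hFi : Integrable (fun x => fderiv ℝ (F δ) x v) μ :=
      (((hFcd δ).continuous_fderiv one_ne_zero).clm_apply
        continuous_const).integrable_of_hasCompactSupport ((hFc δ).fderiv_apply ℝ _)
    have h1 : ∫ x, c * (θ x * (deriv χ (-φ x / δ) / δ)) ∂μ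
        ≤ ∫ x, (|fderiv ℝ θ x v| - fderiv ℝ (F δ) x v) ∂μ := by
      refine integral_mono ((hlayi δ hδ).const_mul c) ((hθi v).abs.sub hFi) fun x => ?_
      simp only
      rw [hFd δ hδ]
      have h2 : 0 ≤ θ x * (deriv χ (-φ x / δ) / δ) :=
        mul_nonneg (hθ0 x) (div_nonneg (hχd _) hδ.le)
      have h3 : c * (θ x * (deriv χ (-φ x / δ) / δ)) ≤
          θ x * (deriv χ (-φ x / δ) / δ) * fderiv ℝ φ x v := by
        by_cases hx : x ∈ tsupport θ
        · rw [mul_comm c]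
          exact mul_le_mul_of_nonneg_left (hv x (hθN hx)) h2
        · have : θ x = 0 := image_eq_zero_of_notMem_tsupport hx
          simp [this]
      have h4 : χ (-φ x / δ) * fderiv ℝ θ x v ≤ |fderiv ℝ θ x v| := by
        calc _ ≤ |χ (-φ x / δ) * fderiv ℝ θ x v| := le_abs_self _
          _ = χ (-φ x / δ) * |fderiv ℝ θ x v| := by rw [abs_mul, abs_of_nonneg (hχnn _)]
          _ ≤ 1 * |fderiv ℝ θ x v| := mul_le_mul_of_nonneg_right (hχle _) (abs_nonneg _)
          _ = _ := one_mul _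
      linarith
    rw [integral_sub (hθi v).abs hFi, h0, sub_zero, integral_const_mul] at h1
    rwa [le_div_iff₀ hc0, mul_comm]
  -- the inequality for the truncated integrals
  set I : E → ℝ := fun x => θ x * divg e J x + ∑ i, fderiv ℝ θ x (e i) * J i x with hI
  have hIi : IntegrableOn I U μ := integrableOn_mul_divg_add hU e hJ hJC hdC hθ hc
  have hI0 : ∀ x, x ∉ tsupport θ → I x = 0 := by
    intro x hx
    have h0 := notMem_tsupport_iff_eventuallyEq.1 hx
    have h1 : θ x = 0 := h0.eq_of_nhds
    have h2 : fderiv ℝ θ x = 0 := by rw [h0.fderiv_eq]; simp [Pi.zero_def]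
    simp [hI, h1, h2]
  have hmeas : ∀ δ, AEStronglyMeasurable (fun x => χ (-φ x / δ) * I x) (μ.restrict U) := by
    intro δ
    have h1 : ContinuousOn I U := by
      refine (hθ.continuous.continuousOn.mul (continuousOn_divg hU e hJ)).add
        (continuousOn_finsetSum _ fun i _ => ?_)
      exact ((hθ.continuous_fderiv one_ne_zero).clm_apply
        continuous_const).continuousOn.mul (hJ i).continuousOn
    have h2 : ContinuousOn (fun x => χ (-φ x / δ) * I x) U := by
      intro x hx
      by_cases hxθ : x ∈ tsupport θ
      · exact ((hcθφ δ).continuousAt (hN.mem_nhds (hθN hxθ))).continuousWithinAt.mul (h1 x hx)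
      · refine (continuousAt_const.congr (f := fun _ => (0 : ℝ)) ?_).continuousWithinAt
        filter_upwards [(isClosed_tsupport θ).isOpen_compl.mem_nhds hxθ] with y hy
        rw [hI0 y hy, mul_zero]
    exact h2.aestronglyMeasurable hU.measurableSet
  have htr : ∀ η > 0, ∃ δ₀ > 0, ∀ δ, 0 < δ → δ < δ₀ →
      ∫ x in U, χ (-φ x / δ) * I x ∂μ ≤ η * (Cθ / c) := by
    intro η hη
    obtain ⟨δ₀, hδ₀, hJη⟩ := hlim η hη
    -- The layer reaches down to φ = -2δ, so δ < δ₀ / 2 keeps it where the flux is at most η.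
    refine ⟨δ₀ / 2, by positivity, fun δ hδ hδδ => ?_⟩
    have h0 := setIntegral_divg_of_tsupport_subset (μ := μ) hU e hJ (hFcd δ) (hFc δ) (hFU δ hδ)
    have hi0 := integrableOn_mul_divg_add (μ := μ) hU e hJ hJC hdC (hFcd δ) (hFc δ)
    have hle : ∫ x in U, χ (-φ x / δ) * I x ∂μ
        ≤ ∫ x in U, ((F δ x * divg e J x + ∑ i, fderiv ℝ (F δ) x (e i) * J i x)
          + η * (θ x * (deriv χ (-φ x / δ) / δ))) ∂μ := by
      refine setIntegral_mono_on ?_ (hi0.add ((hlayi δ hδ).integrableOn.const_mul η))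
        hU.measurableSet fun x hx => ?_
      · refine Integrable.mono hIi (hmeas δ) ?_
        refine Eventually.of_forall fun x => ?_
        rw [norm_mul, Real.norm_of_nonneg (hχnn _)]
        exact mul_le_of_le_one_left (norm_nonneg _) (hχle _)
      · have h2 : 0 ≤ θ x * (deriv χ (-φ x / δ) / δ) :=
          mul_nonneg (hθ0 x) (div_nonneg (hχd _) hδ.le)
        have h3 : θ x * (deriv χ (-φ x / δ) / δ) * ∑ i, fderiv ℝ φ x (e i) * J i x
            ≤ η * (θ x * (deriv χ (-φ x / δ) / δ)) := by
          by_cases hxθ : x ∈ tsupport θ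
          · by_cases hd : deriv χ (-φ x / δ) = 0
            · simp [hd]
            · rw [mul_comm η]
              refine mul_le_mul_of_nonneg_left (hJη x hxθ hx ?_) h2
              have : ¬ 2 < -φ x / δ := fun h => hd (hχd2 _ h)
              rw [lt_div_iff₀ hδ] at this
              linarith
          · have : θ x = 0 := image_eq_zero_of_notMem_tsupport hxθ
            simp [this]
        have h4 : F δ x * divg e J x + ∑ i, fderiv ℝ (F δ) x (e i) * J i x
            = χ (-φ x / δ) * I x
              - θ x * (deriv χ (-φ x / δ) / δ) * ∑ i, fderiv ℝ φ x (e i) * J i x := by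
          simp only [hFd δ hδ]
          simp only [hI, hFdef, mul_add, Finset.mul_sum, sub_mul, Finset.sum_sub_distrib, mul_assoc]
          rw [add_sub_assoc]
          congr 1
          ring
        rw [h4]
        linarith
    rw [integral_add hi0 ((hlayi δ hδ).integrableOn.const_mul η), h0, zero_add,
      integral_const_mul] at hle
    refine hle.trans (mul_le_mul_of_nonneg_left (le_trans ?_ (hlay δ hδ)) hη.le)
    exact setIntegral_le_integral (hlayi δ hδ) (Eventually.of_forall fun x =>
      mul_nonneg (hθ0 x) (div_nonneg (hχd _) hδ.le))
  have hT : Tendsto (fun δ : ℝ => ∫ x in U, χ (-φ x / δ) * I x ∂μ) (𝓝[>] 0)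
      (𝓝 (∫ x in U, I x ∂μ)) := by
    refine tendsto_integral_filter_of_dominated_convergence (fun x => ‖I x‖)
      (Eventually.of_forall hmeas) (Eventually.of_forall fun δ => Eventually.of_forall fun x => ?_)
      hIi.norm ?_
    · rw [norm_mul, Real.norm_of_nonneg (hχnn _)]
      exact mul_le_of_le_one_left (norm_nonneg _) (hχle _)
    · filter_upwards [ae_restrict_mem hU.measurableSet] with x hx
      by_cases hxθ : x ∈ tsupport θ
      · have hneg : φ x < 0 := (hφU x (hθN hxθ)).1 hx
        refine tendsto_const_nhds.congr' ?_
        have : ∀ᶠ δ : ℝ in 𝓝[>] 0, δ < -φ x / 2 :=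
          nhdsWithin_le_nhds (gt_mem_nhds (by linarith))
        filter_upwards [this, self_mem_nhdsWithin] with δ h1 h2
        rw [hχ1 _ (by rw [le_div_iff₀ h2]; linarith), one_mul]
      · simp [hI0 x hxθ]
  refine le_of_forall_pos_le_add fun η hη => ?_
  -- The added 1 keeps the divisor positive, since `Cθ` may be zero.
  have hK : 0 < Cθ / c + 1 := by positivity
  obtain ⟨δ₀, hδ₀, hle⟩ := htr (η / (Cθ / c + 1)) (by positivity)
  refine le_of_tendsto hT ?_
  filter_upwards [self_mem_nhdsWithin, nhdsWithin_le_nhds (gt_mem_nhds hδ₀)] with δ h1 h2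
  refine (hle δ h1 h2).trans ?_
  rw [zero_add, div_mul_eq_mul_div, div_le_iff₀ hK]
  nlinarith

/-- A field whose flux through the boundary of `U` is nonpositive in a limiting sense has
nonpositive total divergence. -/
theorem setIntegral_divg_nonpos {U K : Set E} (hU : IsOpen U) (hK : IsCompact K) (e : ι → E)
    {J : ι → E → ℝ} (hJ : ∀ i, ContDiffOn ℝ 1 (J i) U) {C : ℝ} (hJC : ∀ i, ∀ x ∈ U, |J i x| ≤ C)
    (hdC : ∀ x ∈ U, |divg e J x| ≤ C) (hJK : ∀ i, ∀ x ∈ U, x ∉ K → J i x = 0)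
    (hloc : ∀ x ∈ K, x ∈ U ∨ ∃ φ : E → ℝ, ∃ N ∈ 𝓝 x, ContDiffOn ℝ 1 φ N ∧
      (∀ y ∈ N, (y ∈ U ↔ φ y < 0)) ∧ fderiv ℝ φ x ≠ 0 ∧
      ∀ y ∈ N, y ∈ K → φ y = 0 → ∀ η > 0, ∀ᶠ z in 𝓝[U] y,
        ∑ i, fderiv ℝ φ z (e i) * J i z ≤ η) :
    ∫ x in U, divg e J x ∂μ ≤ 0 := by
  have hlocal : ∀ x ∈ K, ∃ N : Set E, IsOpen N ∧ x ∈ N ∧ ∀ θ : E → ℝ, ContDiff ℝ 1 θ →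
      (∀ x, 0 ≤ θ x) → HasCompactSupport θ → tsupport θ ⊆ N →
      ∫ x in U, (θ x * divg e J x + ∑ i, fderiv ℝ θ x (e i) * J i x) ∂μ ≤ 0 := by
    intro x hx
    rcases hloc x hx with hxU | ⟨φ, N, hN, hφ, hφU, hne, hlim⟩
    · exact ⟨U, hU, hxU, fun θ hθ _ hc hs =>
        (setIntegral_divg_of_tsupport_subset hU e hJ hθ hc hs).le⟩
    obtain ⟨v, hv⟩ : ∃ v, 0 < fderiv ℝ φ x v := by
      obtain ⟨v, hv⟩ := DFunLike.ne_iff.1 hne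
      simp only [zero_apply] at hv
      rcases lt_or_gt_of_ne hv with h | h
      · exact ⟨-v, by simpa using h⟩
      · exact ⟨v, h⟩
    obtain ⟨N₁, hN₁N, hN₁o, hxN₁⟩ := mem_nhds_iff.1 hN
    have hcont : ContinuousOn (fun y => fderiv ℝ φ y v) N₁ :=
      ((hφ.mono hN₁N).continuousOn_fderiv_of_isOpen hN₁o le_rfl).clm_apply continuousOn_const
    have hopen := hcont.isOpen_inter_preimage hN₁o (isOpen_Ioi (a := fderiv ℝ φ x v / 2))
    refine ⟨_, hopen, ⟨hxN₁, half_lt_self hv⟩, fun θ hθ hθ0 hc hs => ?_⟩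
    have hsN : tsupport θ ⊆ N := fun y hy => hN₁N (hs hy).1
    refine setIntegral_divg_le_of_boundary hU hopen e hJ hJC hdC hθ hθ0 hc hs
      (hφ.mono fun y hy => hN₁N hy.1) (fun y hy => hφU y (hN₁N hy.1)) (half_pos hv)
      (fun y hy => (show fderiv ℝ φ x v / 2 < fderiv ℝ φ y v from hy.2).le) ?_
    intro η hη
    have hcpt : IsCompact (tsupport θ) := hc
    -- Membership is stated twice because the compactness induction shrinks the first set, while the
    -- second occurrence must stay fixed.
    suffices h : ∃ δ > 0, ∀ y ∈ tsupport θ, y ∈ tsupport θ → y ∈ U → -δ < φ y →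
        ∑ i, fderiv ℝ φ y (e i) * J i y ≤ η by
      obtain ⟨δ, hδ, h⟩ := h
      exact ⟨δ, hδ, fun y hy => h y hy hy⟩
    refine hcpt.induction_on (p := fun S => ∃ δ > 0, ∀ y ∈ S, y ∈ tsupport θ → y ∈ U → -δ < φ y →
        ∑ i, fderiv ℝ φ y (e i) * J i y ≤ η) ⟨1, one_pos, by simp⟩ ?_ ?_ ?_
    · rintro S S' hSS ⟨δ, hδ, h⟩
      exact ⟨δ, hδ, fun y hy => h y (hSS hy)⟩
    · rintro S S' ⟨δ, hδ, h⟩ ⟨δ', hδ', h'⟩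
      refine ⟨min δ δ', lt_min hδ hδ', ?_⟩
      rintro y (hy | hy) h1 h2 h3
      · exact h y hy h1 h2 (by linarith [min_le_left δ δ'])
      · exact h' y hy h1 h2 (by linarith [min_le_right δ δ'])
    · intro y hy
      have hyN₁ : y ∈ N₁ := (hs hy).1
      have hφc : ContinuousAt φ y :=
        (hφ.mono hN₁N).continuousOn.continuousAt (hN₁o.mem_nhds hyN₁)
      -- At an interior point a small δ makes the claim vacuous nearby. At an exterior point no
      -- nearby point lies in U. On the boundary either the flux hypothesis applies or, off K, the
      -- field is zero.
      rcases lt_trichotomy (φ y) 0 with h | h | h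
      · refine ⟨{a | φ a < φ y / 2}, nhdsWithin_le_nhds (hφc.eventually_lt_const (by linarith)),
          -φ y / 2, by linarith, ?_⟩
        intro a ha _ _ h'
        simp only [mem_ofPred_eq] at ha
        linarith
      · by_cases hyK : y ∈ K
        · have h1 := hlim y (hsN hy) hyK h η hη
          rw [eventually_nhdsWithin_iff] at h1
          exact ⟨_, nhdsWithin_le_nhds h1, 1, one_pos, fun a ha _ haU _ => ha haU⟩
        · refine ⟨Kᶜ, nhdsWithin_le_nhds (hK.isClosed.isOpen_compl.mem_nhds hyK), 1, one_pos, ?_⟩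
          intro a ha _ haU _
          simp [fun i => hJK i a haU ha, hη.le]
      · refine ⟨{a | 0 < φ a} ∩ N₁, nhdsWithin_le_nhds (inter_mem (hφc.eventually_const_lt h)
          (hN₁o.mem_nhds hyN₁)), 1, one_pos, ?_⟩
        intro a ha _ haU _
        exact absurd ((hφU a (hN₁N ha.2)).1 haU) (not_lt.2 (le_of_lt ha.1))
  choose! N hNo hxN hNθ using hlocal
  -- Intersecting with unit balls gives the functions of the partition of unity compact support.
  have hcov : K ⊆ ⋃ x : K, N x ∩ Metric.ball (x : E) 1 := fun x hx =>
    mem_iUnion.2 ⟨⟨x, hx⟩, hxN x hx, Metric.mem_ball_self one_pos⟩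
  have hNo' : ∀ x : K, IsOpen (N x ∩ Metric.ball (x : E) 1) := fun x =>
    (hNo x x.2).inter Metric.isOpen_ball
  obtain ⟨t, ht⟩ := hK.elim_finite_subcover _ hNo' hcov
  obtain ⟨f, hf⟩ := SmoothPartitionOfUnity.exists_isSubordinate (modelWithCornersSelf ℝ E)
    hK.isClosed (fun x : t => N (x : K) ∩ Metric.ball ((x : K) : E) 1) (fun x => hNo' x)
    (fun x hx => by
      obtain ⟨i, hi, hxi⟩ := mem_iUnion₂.1 (ht hx)
      exact mem_iUnion.2 ⟨⟨i, hi⟩, hxi⟩)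
  have hfc : ∀ i, ContDiff ℝ 1 (f i) := fun i => (f i).contMDiff.contDiff.of_le (by simp)
  have hfcs : ∀ i, HasCompactSupport (f i) := fun i =>
    HasCompactSupport.of_support_subset_isCompact
      (isCompact_closedBall (((i : K) : E)) (1 : ℝ))
      ((subset_tsupport _).trans ((hf i).trans (inter_subset_right.trans
        Metric.ball_subset_closedBall)))
  have hle : ∀ i, ∫ x in U, (f i x * divg e J x + ∑ j, fderiv ℝ (f i) x (e j) * J j x) ∂μ ≤ 0 :=
    fun i => hNθ _ (i : K).2 _ (hfc i) (fun x => f.nonneg i x) (hfcs i)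
      ((hf i).trans inter_subset_left)
  have hsum : ∀ x ∈ K, ∑ i, f i x = 1 := by
    intro x hx
    rw [← finsum_eq_sum_of_fintype]
    exact f.sum_eq_one hx
  have hJloc : ∀ x ∈ U, x ∉ K → ∀ i, J i =ᶠ[𝓝 x] fun _ => 0 := by
    intro x hxU hxK i
    filter_upwards [hU.mem_nhds hxU, hK.isClosed.isOpen_compl.mem_nhds hxK] with y h1 h2
      using hJK i y h1 h2
  have heq : ∫ x in U, divg e J x ∂μ
      = ∫ x in U, ∑ i, (f i x * divg e J x + ∑ j, fderiv ℝ (f i) x (e j) * J j x) ∂μ := by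
    refine setIntegral_congr_fun hU.measurableSet fun x hx => ?_
    rw [Finset.sum_add_distrib, ← Finset.sum_mul, Finset.sum_comm]
    simp only [← Finset.sum_mul]
    have h1 : (∑ i, f i x) * divg e J x = divg e J x := by
      by_cases hxK : x ∈ K
      · rw [hsum x hxK, one_mul]
      · have : divg e J x = 0 := by
          refine Finset.sum_eq_zero fun i _ => ?_
          rw [(hJloc x hx hxK i).fderiv_eq]
          simp
        rw [this, mul_zero]
    -- The partition sums to 1 only on K. Where a component of J is nonzero, a whole neighbourhood
    -- lies in K, so the gradients of the partition sum to zero exactly where that is needed.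
    have h2 : ∀ j, (∑ i, fderiv ℝ (f i) x (e j)) * J j x = 0 := by
      intro j
      by_cases hj : J j x = 0
      · rw [hj, mul_zero]
      have hnear : ∀ᶠ y in 𝓝 x, y ∈ K := by
        have hc : ContinuousAt (J j) x := (hJ j).continuousOn.continuousAt (hU.mem_nhds hx)
        filter_upwards [hU.mem_nhds hx, hc.eventually_ne hj] with y hy hne
        by_contra hyK
        exact hne (hJK j y hy hyK)
      have h3 : (fun y => ∑ i, f i y) =ᶠ[𝓝 x] fun _ => 1 := by
        filter_upwards [hnear] with y hy using hsum y hy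
      have h4 := h3.fderiv_eq (𝕜 := ℝ)
      rw [fderiv_fun_sum fun i _ => (hfc i).differentiable one_ne_zero x] at h4
      have h5 := DFunLike.congr_fun h4 (e j)
      simp only [sum_apply, fderiv_fun_const, Pi.zero_apply,
        zero_apply] at h5
      rw [h5, zero_mul]
    rw [h1, Finset.sum_eq_zero fun j _ => h2 j, add_zero]
  rw [heq, integral_finsetSum]
  · exact Finset.sum_nonpos fun i _ => hle i
  · exact fun i _ => integrableOn_mul_divg_add hU e hJ hJC hdC (hfc i) (hfcs i)

end Divergence

/-! ### Multiplier current, conjugation by the weight, and the algebra of the Carleman estimate -/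

section Current

variable {V : Type*} [NormedAddCommGroup V] [NormedSpace ℝ V] {ι : Type*} [Fintype ι]

/-- The derivative of `f` along the fixed vector `v`. -/
noncomputable def pd (v : V) (f : V → ℝ) (q : V) : ℝ := fderiv ℝ f q v

/-- The pairing `g(∇a, ∇b)` for the diagonal metric with entries `s i` in the directions `e i`. -/
noncomputable def gpair (e : ι → V) (s : ι → ℝ) (a b : V → ℝ) (q : V) : ℝ :=
  ∑ i, s i * (pd (e i) a q * pd (e i) b q)

/-- The wave operator of the diagonal metric with entries `s i` in the directions `e i`. -/
noncomputable def waveOp (e : ι → V) (s : ι → ℝ) (a : V → ℝ) (q : V) : ℝ :=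
  ∑ i, s i * pd (e i) (pd (e i) a) q

/-- The Hessian of `a` evaluated on the vector with covariant components `y`. -/
noncomputable def hessQ (e : ι → V) (s : ι → ℝ) (a : V → ℝ) (q : V) (y : ι → ℝ) : ℝ :=
  ∑ i, s i * y i * ∑ j, s j * (pd (e i) (pd (e j) a) q * y j)

/-- The current of the multiplier `g(∇ψ, ∇w) + κ w` for the operator `□ + λ² g(∇ψ, ∇ψ)`. -/
noncomputable def current (e : ι → V) (s : ι → ℝ) (ψ κ : V → ℝ) (lam : ℝ) (w : V → ℝ)
    (i : ι) (q : V) : ℝ :=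
  s i * (pd (e i) w q * gpair e s ψ w q - pd (e i) ψ q * gpair e s w w q / 2
    + κ q * (w q * pd (e i) w q) - pd (e i) κ q * (w q * w q) / 2
    + lam ^ 2 / 2 * (gpair e s ψ ψ q * (pd (e i) ψ q * (w q * w q))))

theorem pd_mul {v : V} {a b : V → ℝ} {q : V} (ha : DifferentiableAt ℝ a q)
    (hb : DifferentiableAt ℝ b q) :
    pd v (fun x => a x * b x) q = pd v a q * b q + a q * pd v b q := by
  simp only [pd]
  rw [fderiv_fun_mul ha hb]
  simp
  ring

theorem pd_add {v : V} {a b : V → ℝ} {q : V} (ha : DifferentiableAt ℝ a q)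
    (hb : DifferentiableAt ℝ b q) :
    pd v (fun x => a x + b x) q = pd v a q + pd v b q := by
  simp only [pd]
  rw [fderiv_fun_add ha hb]
  simp

theorem pd_sub {v : V} {a b : V → ℝ} {q : V} (ha : DifferentiableAt ℝ a q)
    (hb : DifferentiableAt ℝ b q) :
    pd v (fun x => a x - b x) q = pd v a q - pd v b q := by
  simp only [pd]
  rw [fderiv_fun_sub ha hb]
  simp

theorem pd_const_mul {v : V} {a : V → ℝ} {q : V} (c : ℝ) (ha : DifferentiableAt ℝ a q) :
    pd v (fun x => c * a x) q = c * pd v a q := by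
  simp only [pd]
  rw [fderiv_const_mul ha]
  simp

theorem pd_div_const {v : V} {a : V → ℝ} {q : V} (c : ℝ) (ha : DifferentiableAt ℝ a q) :
    pd v (fun x => a x / c) q = pd v a q / c := by
  simp only [div_eq_inv_mul]
  exact pd_const_mul _ ha

theorem pd_congr {v : V} {a b : V → ℝ} {q : V} (h : a =ᶠ[𝓝 q] b) : pd v a q = pd v b q := by
  simp only [pd, h.fderiv_eq]

theorem eventuallyEq_pd {v : V} {a b : V → ℝ} {q : V} (h : a =ᶠ[𝓝 q] b) :
    pd v a =ᶠ[𝓝 q] pd v b := by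
  filter_upwards [h.eventuallyEq_nhds] with x hx using pd_congr hx

theorem pd_comp {v : V} {a : V → ℝ} {q : V} {h : ℝ → ℝ} {h' : ℝ} (hh : HasDerivAt h h' (a q))
    (ha : DifferentiableAt ℝ a q) : pd v (fun x => h (a x)) q = h' * pd v a q := by
  simp only [pd]
  have := (hh.comp_hasFDerivAt q ha.hasFDerivAt).fderiv
  simp only [Function.comp_def] at this
  rw [this]
  simp

theorem contDiffAt_pd {v : V} {a : V → ℝ} {q : V} {n : WithTop ℕ∞} (ha : ContDiffAt ℝ (n + 1) a q) :
    ContDiffAt ℝ n (pd v a) q :=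
  (ha.fderiv_right le_rfl).clm_apply contDiffAt_const

theorem differentiableAt_pd {v : V} {a : V → ℝ} {q : V} (ha : ContDiffAt ℝ 2 a q) :
    DifferentiableAt ℝ (pd v a) q :=
  (contDiffAt_pd (n := 1) ha).differentiableAt one_ne_zero

theorem pd_pd_eq_fderiv_fderiv {a : V → ℝ} {q : V} (ha : ContDiffAt ℝ 2 a q) (v v' : V) :
    pd v (pd v' a) q = fderiv ℝ (fderiv ℝ a) q v v' := by
  have hd : DifferentiableAt ℝ (fderiv ℝ a) q :=
    (ha.fderiv_right (m := 1) (by norm_num)).differentiableAt one_ne_zero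
  have h1 : pd v' a = fun x => fderiv ℝ a x v' := rfl
  rw [pd, h1, fderiv_clm_apply hd (differentiableAt_const _)]
  simp

theorem pd_pd_comm {v v' : V} {a : V → ℝ} {q : V} (ha : ContDiffAt ℝ 2 a q) :
    pd v (pd v' a) q = pd v' (pd v a) q := by
  rw [pd_pd_eq_fderiv_fderiv ha, pd_pd_eq_fderiv_fderiv ha]
  exact (ha.isSymmSndFDerivAt (by simp)).eq _ _

theorem differentiableAt_gpair {e : ι → V} {s : ι → ℝ} {a b : V → ℝ} {q : V}
    (ha : ContDiffAt ℝ 2 a q) (hb : ContDiffAt ℝ 2 b q) :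
    DifferentiableAt ℝ (gpair e s a b) q := by
  unfold gpair
  refine DifferentiableAt.fun_sum fun i _ => ?_
  exact ((differentiableAt_pd ha).mul (differentiableAt_pd hb)).const_mul _

theorem pd_gpair {e : ι → V} {s : ι → ℝ} {a b : V → ℝ} {q : V} (v : V)
    (ha : ContDiffAt ℝ 2 a q) (hb : ContDiffAt ℝ 2 b q) :
    pd v (gpair e s a b) q = ∑ j, s j * (pd v (pd (e j) a) q * pd (e j) b q)
      + ∑ j, s j * (pd v (pd (e j) b) q * pd (e j) a q) := by
  have h : gpair e s a b = fun x => ∑ i, s i * (pd (e i) a x * pd (e i) b x) := rfl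
  have hd : ∀ i, DifferentiableAt ℝ (fun x => pd (e i) a x * pd (e i) b x) q := fun i =>
    (differentiableAt_pd ha).mul (differentiableAt_pd hb)
  rw [pd, h, fderiv_fun_sum fun i _ => (hd i).const_mul _, sum_apply, ← Finset.sum_add_distrib]
  refine Finset.sum_congr rfl fun i _ => ?_
  rw [← pd, pd_const_mul _ (hd i), pd_mul (differentiableAt_pd ha) (differentiableAt_pd hb)]
  ring

/-- This is the Leibniz expansion of the divergence with derivatives replaced by numbers: `W` and
`P` stand for the Hessians of w and ψ, `k₂` for the diagonal second derivatives of κ. The one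
cancellation that is not termwise uses the symmetry of `W`: the Hessian of w on (∇ψ, ∇w) comes once
from g(∇ψ, ∇w) and once, with the opposite sign, from g(∇w, ∇w)/2. -/
theorem sum_current_identity (s w ψ κ k₂ : ι → ℝ) (W P : ι → ι → ℝ) (hW : ∀ i j, W i j = W j i)
    (lam w₀ κ₀ G B A : ℝ) (hG : G = ∑ i, s i * (ψ i * w i)) (hB : B = ∑ i, s i * (w i * w i)) :
    ∑ i, s i * ((W i i * G + w i * (∑ j, s j * (P i j * w j) + ∑ j, s j * (W i j * ψ j)))
        - (P i i * B + ψ i * (∑ j, s j * (W i j * w j) + ∑ j, s j * (W i j * w j))) / 2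
        + (κ i * (w₀ * w i) + κ₀ * (w i * w i + w₀ * W i i))
        - (k₂ i * (w₀ * w₀) + κ i * (w i * w₀ + w₀ * w i)) / 2
        + lam ^ 2 / 2 * ((∑ j, s j * (P i j * ψ j) + ∑ j, s j * (P i j * ψ j)) * (ψ i * (w₀ * w₀))
          + A * (P i i * (w₀ * w₀) + ψ i * (w i * w₀ + w₀ * w i))))
    = (∑ i, s i * W i i + lam ^ 2 * A * w₀) * (G + κ₀ * w₀)
      + ∑ i, s i * w i * ∑ j, s j * (P i j * w j)
      - ((∑ i, s i * P i i) / 2 - κ₀) * B - (∑ i, s i * k₂ i) / 2 * w₀ ^ 2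
      + lam ^ 2 * (∑ i, s i * ψ i * ∑ j, s j * (P i j * ψ j)
          + ((∑ i, s i * P i i) / 2 - κ₀) * A) * w₀ ^ 2 := by
  have hsymm : ∑ i, s i * w i * ∑ j, s j * (W i j * ψ j)
      = ∑ i, s i * ψ i * ∑ j, s j * (W i j * w j) := by
    simp only [Finset.mul_sum]
    rw [Finset.sum_comm]
    refine Finset.sum_congr rfl fun i _ => Finset.sum_congr rfl fun j _ => ?_
    rw [hW j i]
    ring
  generalize ha : (fun i => ∑ j, s j * (P i j * w j)) = a at *
  generalize hb : (fun i => ∑ j, s j * (W i j * ψ j)) = b at *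
  generalize hc : (fun i => ∑ j, s j * (W i j * w j)) = c at *
  generalize hd : (fun i => ∑ j, s j * (P i j * ψ j)) = d at *
  have ha' := fun i => congrFun ha i
  have hb' := fun i => congrFun hb i
  have hc' := fun i => congrFun hc i
  have hd' := fun i => congrFun hd i
  simp only [ha', hb', hc', hd'] at hsymm ⊢
  have hG' : lam ^ 2 * A * w₀ * G = ∑ i, lam ^ 2 * A * w₀ * (s i * (ψ i * w i)) := by
    rw [hG, Finset.mul_sum]
  have hB' : κ₀ * B = ∑ i, κ₀ * (s i * (w i * w i)) := by rw [hB, Finset.mul_sum]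
  have key : ∑ i, s i * ((W i i * G + w i * (a i + b i))
        - (P i i * B + ψ i * (c i + c i)) / 2
        + (κ i * (w₀ * w i) + κ₀ * (w i * w i + w₀ * W i i))
        - (k₂ i * (w₀ * w₀) + κ i * (w i * w₀ + w₀ * w i)) / 2
        + lam ^ 2 / 2 * ((d i + d i) * (ψ i * (w₀ * w₀))
          + A * (P i i * (w₀ * w₀) + ψ i * (w i * w₀ + w₀ * w i))))
      = (∑ i, s i * W i i) * G + ∑ i, s i * w i * a i + ∑ i, s i * w i * b i
        - (∑ i, s i * P i i) * (B / 2) - ∑ i, s i * ψ i * c i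
        + ∑ i, κ₀ * (s i * (w i * w i)) + (∑ i, s i * W i i) * (κ₀ * w₀)
        - (∑ i, s i * k₂ i) * (w₀ ^ 2 / 2) + (∑ i, s i * ψ i * d i) * (lam ^ 2 * w₀ ^ 2)
        + (∑ i, s i * P i i) * (lam ^ 2 / 2 * A * w₀ ^ 2)
        + ∑ i, lam ^ 2 * A * w₀ * (s i * (ψ i * w i)) := by
    simp only [Finset.sum_mul, ← Finset.sum_add_distrib, ← Finset.sum_sub_distrib]
    refine Finset.sum_congr rfl fun i _ => ?_
    ring
  rw [key, ← hG', ← hB', hsymm]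
  ring

/-- The identity behind the method: operator times multiplier, plus quadratic forms in ∇w and w, is
a divergence. Second derivatives of w survive only through □w, which matters because the other
second derivatives are not controlled at the boundary. -/
theorem divg_current {e : ι → V} {s : ι → ℝ} {ψ κ w : V → ℝ} {q : V} (lam : ℝ)
    (hψ : ContDiffAt ℝ 2 ψ q) (hκ : ContDiffAt ℝ 2 κ q) (hw : ContDiffAt ℝ 2 w q) :
    divg e (current e s ψ κ lam w) q
      = (waveOp e s w q + lam ^ 2 * gpair e s ψ ψ q * w q) * (gpair e s ψ w q + κ q * w q)
        + hessQ e s ψ q (fun i => pd (e i) w q)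
        - (waveOp e s ψ q / 2 - κ q) * gpair e s w w q - waveOp e s κ q / 2 * w q ^ 2
        + lam ^ 2 * (hessQ e s ψ q (fun i => pd (e i) ψ q)
          + (waveOp e s ψ q / 2 - κ q) * gpair e s ψ ψ q) * w q ^ 2 := by
  have dw : DifferentiableAt ℝ w q := hw.differentiableAt two_ne_zero
  have dκ : DifferentiableAt ℝ κ q := hκ.differentiableAt two_ne_zero
  have dw' : ∀ v, DifferentiableAt ℝ (pd v w) q := fun v => differentiableAt_pd hw
  have dψ' : ∀ v, DifferentiableAt ℝ (pd v ψ) q := fun v => differentiableAt_pd hψ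
  have dκ' : ∀ v, DifferentiableAt ℝ (pd v κ) q := fun v => differentiableAt_pd hκ
  have dg1 : DifferentiableAt ℝ (gpair e s ψ w) q := differentiableAt_gpair hψ hw
  have dg2 : DifferentiableAt ℝ (gpair e s w w) q := differentiableAt_gpair hw hw
  have dg3 : DifferentiableAt ℝ (gpair e s ψ ψ) q := differentiableAt_gpair hψ hψ
  have hid := sum_current_identity s (fun i => pd (e i) w q) (fun i => pd (e i) ψ q)
    (fun i => pd (e i) κ q) (fun i => pd (e i) (pd (e i) κ) q)
    (fun i j => pd (e i) (pd (e j) w) q) (fun i j => pd (e i) (pd (e j) ψ) q)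
    (fun i j => pd_pd_comm hw) lam (w q) (κ q) _ _ (gpair e s ψ ψ q) rfl rfl
  refine Eq.trans ?_ hid
  refine Finset.sum_congr rfl fun i _ => ?_
  have dww : DifferentiableAt ℝ (fun x => w x * w x) q := dw.mul dw
  have t1 : DifferentiableAt ℝ (fun x => pd (e i) w x * gpair e s ψ w x) q := (dw' _).mul dg1
  have t2' : DifferentiableAt ℝ (fun x => pd (e i) ψ x * gpair e s w w x) q := (dψ' _).mul dg2
  have t2 : DifferentiableAt ℝ (fun x => pd (e i) ψ x * gpair e s w w x / 2) q := by
    simpa only [div_eq_mul_inv] using t2'.mul_const _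
  have t3' : DifferentiableAt ℝ (fun x => w x * pd (e i) w x) q := dw.mul (dw' _)
  have t3 : DifferentiableAt ℝ (fun x => κ x * (w x * pd (e i) w x)) q := dκ.mul t3'
  have t4' : DifferentiableAt ℝ (fun x => pd (e i) κ x * (w x * w x)) q := (dκ' _).mul dww
  have t4 : DifferentiableAt ℝ (fun x => pd (e i) κ x * (w x * w x) / 2) q := by
    simpa only [div_eq_mul_inv] using t4'.mul_const _
  have t5'' : DifferentiableAt ℝ (fun x => pd (e i) ψ x * (w x * w x)) q := (dψ' _).mul dww
  have t5' : DifferentiableAt ℝ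
      (fun x => gpair e s ψ ψ x * (pd (e i) ψ x * (w x * w x))) q := dg3.mul t5''
  have t5 : DifferentiableAt ℝ
      (fun x => lam ^ 2 / 2 * (gpair e s ψ ψ x * (pd (e i) ψ x * (w x * w x)))) q :=
    t5'.const_mul _
  rw [← pd]
  unfold current
  rw [pd_const_mul _ ((((t1.fun_sub t2).fun_add t3).fun_sub t4).fun_add t5),
    pd_add (((t1.fun_sub t2).fun_add t3).fun_sub t4) t5, pd_sub ((t1.fun_sub t2).fun_add t3) t4,
    pd_add (t1.fun_sub t2) t3, pd_sub t1 t2, pd_mul (dw' _) dg1, pd_div_const _ t2',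
    pd_mul (dψ' _) dg2, pd_mul dκ t3', pd_mul dw (dw' _), pd_div_const _ t4',
    pd_mul (dκ' _) dww, pd_mul dw dw, pd_const_mul _ t5', pd_mul dg3 t5'', pd_mul (dψ' _) dww,
    pd_mul dw dw, pd_gpair _ hψ hw, pd_gpair _ hw hw, pd_gpair _ hψ hψ]
  rfl

theorem waveOp_congr {e : ι → V} {s : ι → ℝ} {a b : V → ℝ} {q : V} (h : a =ᶠ[𝓝 q] b) :
    waveOp e s a q = waveOp e s b q :=
  Finset.sum_congr rfl fun i _ => by rw [pd_congr (eventuallyEq_pd h)]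

theorem waveOp_mul {e : ι → V} {s : ι → ℝ} {a b : V → ℝ} {q : V}
    (ha : ContDiffAt ℝ 2 a q) (hb : ContDiffAt ℝ 2 b q) :
    waveOp e s (fun x => a x * b x) q
      = waveOp e s a q * b q + 2 * gpair e s a b q + a q * waveOp e s b q := by
  have h : ∀ v, pd v (fun x => a x * b x) =ᶠ[𝓝 q] fun x => pd v a x * b x + a x * pd v b x := by
    intro v
    filter_upwards [ha.eventually (by simp), hb.eventually (by simp)] with x h1 h2
    exact pd_mul (h1.differentiableAt two_ne_zero) (h2.differentiableAt two_ne_zero)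
  have da : DifferentiableAt ℝ a q := ha.differentiableAt two_ne_zero
  have db : DifferentiableAt ℝ b q := hb.differentiableAt two_ne_zero
  have da' : ∀ v, DifferentiableAt ℝ (pd v a) q := fun v => differentiableAt_pd ha
  have db' : ∀ v, DifferentiableAt ℝ (pd v b) q := fun v => differentiableAt_pd hb
  simp only [waveOp, gpair, Finset.sum_mul, Finset.mul_sum, ← Finset.sum_add_distrib]
  refine Finset.sum_congr rfl fun i _ => ?_
  rw [pd_congr (h _), pd_add ((da' _).fun_mul db) (da.fun_mul (db' _)), pd_mul (da' _) db,
    pd_mul da (db' _)]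
  ring

theorem pd_exp_mul {ψ : V → ℝ} {q v : V} (lam : ℝ) (hψ : DifferentiableAt ℝ ψ q) :
    pd v (fun x => Real.exp (lam * ψ x)) q = lam * Real.exp (lam * ψ q) * pd v ψ q := by
  have h : HasDerivAt (fun y => Real.exp (lam * y)) (Real.exp (lam * ψ q) * (lam * 1)) (ψ q) :=
    ((hasDerivAt_id _).const_mul lam).exp
  rw [pd_comp h hψ]
  ring

theorem pd_pd_exp_mul {ψ : V → ℝ} {q v v' : V} (lam : ℝ) (hψ : ContDiffAt ℝ 2 ψ q) :
    pd v (pd v' (fun x => Real.exp (lam * ψ x))) q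
      = lam * Real.exp (lam * ψ q) * (pd v (pd v' ψ) q + lam * (pd v ψ q * pd v' ψ q)) := by
  have dψ : DifferentiableAt ℝ ψ q := hψ.differentiableAt two_ne_zero
  have h : pd v' (fun x => Real.exp (lam * ψ x)) =ᶠ[𝓝 q]
      fun x => lam * (Real.exp (lam * ψ x) * pd v' ψ x) := by
    filter_upwards [hψ.eventually (by simp)] with x hx
    rw [pd_exp_mul _ (hx.differentiableAt two_ne_zero)]
    ring
  have d1 : DifferentiableAt ℝ (fun x => Real.exp (lam * ψ x)) q := (dψ.const_mul lam).exp
  rw [pd_congr h, pd_const_mul _ (d1.fun_mul (differentiableAt_pd hψ)),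
    pd_mul d1 (differentiableAt_pd hψ), pd_exp_mul _ dψ]
  ring

theorem waveOp_exp_mul {e : ι → V} {s : ι → ℝ} {ψ : V → ℝ} {q : V} (lam : ℝ)
    (hψ : ContDiffAt ℝ 2 ψ q) :
    waveOp e s (fun x => Real.exp (lam * ψ x)) q
      = lam * Real.exp (lam * ψ q) * (waveOp e s ψ q + lam * gpair e s ψ ψ q) := by
  simp only [waveOp, gpair, Finset.mul_sum, ← Finset.sum_add_distrib]
  refine Finset.sum_congr rfl fun i _ => ?_
  rw [pd_pd_exp_mul _ hψ]
  ring

theorem pd_exp_mul_mul {ψ u : V → ℝ} {q v : V} (lam : ℝ) (hψ : DifferentiableAt ℝ ψ q)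
    (hu : DifferentiableAt ℝ u q) :
    pd v (fun x => Real.exp (lam * ψ x) * u x) q
      = Real.exp (lam * ψ q) * pd v u q + lam * pd v ψ q * (Real.exp (lam * ψ q) * u q) := by
  rw [pd_mul (hψ.const_mul lam).exp hu, pd_exp_mul _ hψ]
  ring

/-- Conjugation of the wave operator by the weight `exp (λ ψ)`. -/
theorem waveOp_conj {e : ι → V} {s : ι → ℝ} {ψ u : V → ℝ} {q : V} (lam : ℝ)
    (hψ : ContDiffAt ℝ 2 ψ q) (hu : ContDiffAt ℝ 2 u q) :
    waveOp e s (fun x => Real.exp (lam * ψ x) * u x) q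
      = Real.exp (lam * ψ q) * waveOp e s u q
        + 2 * lam * gpair e s ψ (fun x => Real.exp (lam * ψ x) * u x) q
        + (lam * waveOp e s ψ q - lam ^ 2 * gpair e s ψ ψ q) * (Real.exp (lam * ψ q) * u q) := by
  have dψ : DifferentiableAt ℝ ψ q := hψ.differentiableAt two_ne_zero
  have du : DifferentiableAt ℝ u q := hu.differentiableAt two_ne_zero
  have hE : ContDiffAt ℝ 2 (fun x => Real.exp (lam * ψ x)) q := (contDiffAt_const.mul hψ).exp
  rw [waveOp_mul hE hu, waveOp_exp_mul _ hψ]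
  have h1 : gpair e s ψ (fun x => Real.exp (lam * ψ x) * u x) q
      = Real.exp (lam * ψ q) * gpair e s ψ u q
        + lam * gpair e s ψ ψ q * (Real.exp (lam * ψ q) * u q) := by
    simp only [gpair, Finset.mul_sum, Finset.sum_mul, ← Finset.sum_add_distrib]
    refine Finset.sum_congr rfl fun i _ => ?_
    rw [pd_exp_mul_mul _ dψ du]
    ring
  have h2 : gpair e s (fun x => Real.exp (lam * ψ x)) u q
      = lam * Real.exp (lam * ψ q) * gpair e s ψ u q := by
    simp only [gpair, Finset.mul_sum]
    refine Finset.sum_congr rfl fun i _ => ?_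
    rw [pd_exp_mul _ dψ]
    ring
  rw [h1, h2]
  ring

theorem exists_pos_le_of_isCompact {X : Type*} [TopologicalSpace X] {K : Set X} (hK : IsCompact K)
    {f : X → ℝ} (hf : ContinuousOn f K) (hpos : ∀ x ∈ K, 0 < f x) : ∃ c > 0, ∀ x ∈ K, c ≤ f x := by
  rcases K.eq_empty_or_nonempty with rfl | hne
  · exact ⟨1, one_pos, by simp⟩
  · obtain ⟨x, hx, hmin⟩ := hK.exists_isMinOn hne hf
    exact ⟨f x, hpos x hx, fun y hy => hmin hy⟩

theorem exists_abs_le_of_isCompact {X : Type*} [TopologicalSpace X] {K : Set X} (hK : IsCompact K)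
    {f : X → ℝ} (hf : ContinuousOn f K) : ∃ C, 0 ≤ C ∧ ∀ x ∈ K, |f x| ≤ C := by
  obtain ⟨C, hC⟩ := hK.exists_bound_of_continuousOn hf
  exact ⟨max C 0, le_max_right _ _, fun x hx => (hC x hx).trans (le_max_left _ _)⟩

/-- A continuous family of quadratic forms which is positive on the kernels of a continuous
family of linear forms becomes uniformly positive after adding a multiple of their squares. -/
theorem exists_quadratic_lower_bound {X : Type*} [TopologicalSpace X] {K : Set X}
    (hK : IsCompact K) {Q l : X → (ι → ℝ) → ℝ}
    (hQc : ContinuousOn (fun z : X × (ι → ℝ) => Q z.1 z.2) (K ×ˢ univ))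
    (hlc : ContinuousOn (fun z : X × (ι → ℝ) => l z.1 z.2) (K ×ˢ univ))
    (hQ : ∀ x t y, Q x (t • y) = t ^ 2 * Q x y) (hl : ∀ x t y, l x (t • y) = t * l x y)
    (hpos : ∀ x ∈ K, ∀ y, y ≠ 0 → l x y = 0 → 0 < Q x y) :
    ∃ c > 0, ∃ Λ ≥ 0, ∀ x ∈ K, ∀ y, c * ∑ i, y i ^ 2 ≤ Q x y + Λ * l x y ^ 2 := by
  set S : Set (ι → ℝ) := Metric.sphere 0 1 with hS
  have hKS : IsCompact (K ×ˢ S) := hK.prod (isCompact_sphere _ _)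
  have hsub : K ×ˢ S ⊆ K ×ˢ univ := prod_mono_right (subset_univ _)
  have hQc' := hQc.mono hsub
  have hlc' := hlc.mono hsub
  have hne : ∀ y ∈ S, y ≠ 0 := fun y hy h0 => by simp [hS, h0] at hy
  obtain ⟨B, hB0, hB⟩ := exists_abs_le_of_isCompact hKS hQc'
  obtain ⟨R, hRK, hR⟩ : ∃ R : Set (X × (ι → ℝ)), IsCompact R ∧
      R = {z ∈ K ×ˢ S | Q z.1 z.2 ≤ 0} := by
    refine ⟨_, ?_, rfl⟩
    obtain ⟨F, hF, hFe⟩ := continuousOn_iff_isClosed.1 hQc' (Iic 0) isClosed_Iic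
    have : {z ∈ K ×ˢ S | Q z.1 z.2 ≤ 0} = (K ×ˢ S) ∩ F := by
      ext z
      have := Set.ext_iff.1 hFe z
      simp only [mem_inter_iff, mem_preimage, mem_Iic] at this
      simp only [mem_sep_iff, mem_inter_iff]
      tauto
    rw [this]
    exact hKS.inter_right hF
  have hRsub : R ⊆ K ×ˢ S := by rw [hR]; exact sep_subset _ _
  obtain ⟨b, hb, hbR⟩ := exists_pos_le_of_isCompact hRK
    (f := fun z => l z.1 z.2 ^ 2) ((hlc'.mono hRsub).pow 2) (by
    intro z hz
    have hz' := hRsub hz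
    rw [hR] at hz
    have : l z.1 z.2 ≠ 0 := fun h => absurd (hpos z.1 hz'.1 z.2 (hne _ hz'.2) h) (not_lt.2 hz.2)
    positivity)
  -- Where Q ≤ 0 on the unit sphere, l² ≥ b and Q ≥ -B, so this multiple of l² lifts the sum to at
  -- least 1.
  have hΛ : 0 ≤ (B + 1) / b := by positivity
  obtain ⟨c, hc, hcK⟩ := exists_pos_le_of_isCompact hKS
    (f := fun z => Q z.1 z.2 + (B + 1) / b * l z.1 z.2 ^ 2)
    (hQc'.add (continuousOn_const.mul (hlc'.pow 2))) (by
    intro z hz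
    by_cases hzQ : Q z.1 z.2 ≤ 0
    · have h1 := hbR z (by rw [hR]; exact ⟨hz, hzQ⟩)
      have h2 := (abs_le.1 (hB z hz)).1
      have h3 : B + 1 ≤ (B + 1) / b * l z.1 z.2 ^ 2 := by
        rw [div_mul_eq_mul_div, le_div_iff₀ hb]
        exact mul_le_mul_of_nonneg_left h1 (by linarith)
      linarith
    · push Not at hzQ
      positivity)
  -- The sphere is that of the sup norm, and a sum of squares is at most the number of coordinates
  -- times the square of that norm. The added 1 covers an empty index type.
  refine ⟨c / (Fintype.card ι + 1), by positivity, (B + 1) / b, hΛ, fun x hx y => ?_⟩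
  by_cases hy : y = 0
  · subst hy
    have h1 : Q x 0 = 0 := by simpa using hQ x 0 0
    have h2 : l x 0 = 0 := by simpa using hl x 0 0
    simp [h1, h2]
  have hny : 0 < ‖y‖ := norm_pos_iff.2 hy
  have hmem : (x, ‖y‖⁻¹ • y) ∈ K ×ˢ S := by
    refine ⟨hx, ?_⟩
    simp [hS, norm_smul, hny.ne']
  have h1 := hcK _ hmem
  simp only [hQ, hl] at h1
  have h2 : c * ‖y‖ ^ 2 ≤ Q x y + (B + 1) / b * l x y ^ 2 := by
    have h3 := mul_le_mul_of_nonneg_right h1 (sq_nonneg ‖y‖)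
    have h4 : (‖y‖⁻¹ ^ 2 * Q x y + (B + 1) / b * (‖y‖⁻¹ * l x y) ^ 2) * ‖y‖ ^ 2
        = Q x y + (B + 1) / b * l x y ^ 2 := by
      field_simp
    rwa [h4] at h3
  refine le_trans ?_ h2
  have h5 : ∑ i, y i ^ 2 ≤ (Fintype.card ι + 1) * ‖y‖ ^ 2 := by
    calc ∑ i, y i ^ 2 ≤ ∑ _i : ι, ‖y‖ ^ 2 := by
          refine Finset.sum_le_sum fun i _ => ?_
          rw [← sq_abs]
          exact pow_le_pow_left₀ (abs_nonneg _) (norm_le_pi_norm y i) 2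
      _ = Fintype.card ι * ‖y‖ ^ 2 := by simp
      _ ≤ _ := by nlinarith [sq_nonneg ‖y‖]
  rw [div_mul_eq_mul_div, div_le_iff₀ (by positivity)]
  calc c * ∑ i, y i ^ 2 ≤ c * ((Fintype.card ι + 1) * ‖y‖ ^ 2) := mul_le_mul_of_nonneg_left h5 hc.le
    _ = _ := by ring

/-- The algebraic core of the Carleman inequality. -/
theorem carleman_algebra {c C Λ lam P M μ κ w S Q Z D g : ℝ} (hC : 0 ≤ C)
    (hΛ : 0 ≤ Λ) (hlam1 : 1 ≤ lam) (hlamΛ : 2 * Λ ≤ lam)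
    (hlamC : 4 * C ^ 2 + 2 * Λ * C ^ 2 + C ≤ lam * (c / 2)) (hμ : |μ| ≤ C) (hκ : |κ| ≤ C)
    (hD : |D| ≤ C) (hZ : c ≤ Z) (hg : M = g + κ * w) (hQ : c * S ≤ Q + Λ * g ^ 2) :
    c * S + lam ^ 2 * (c / 2) * w ^ 2 - P ^ 2 / lam
      ≤ (P + 2 * lam * (M + μ * w)) * M + Q - D * w ^ 2 + lam ^ 2 * Z * w ^ 2 := by
  have hl0 : 0 < lam := by linarith
  have hμ2 : μ ^ 2 ≤ C ^ 2 := by rw [← sq_abs]; exact pow_le_pow_left₀ (abs_nonneg _) hμ 2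
  have hκ2 : κ ^ 2 ≤ C ^ 2 := by rw [← sq_abs]; exact pow_le_pow_left₀ (abs_nonneg _) hκ 2
  have hw2 := sq_nonneg w
  -- The available positive term is 2λM². A quarter of λM² absorbs the source P M, another quarter
  -- absorbs the cross term with μ, and one full λM² pays for Λ g². What these estimates cost in w²
  -- is covered by half of λ² c w².
  have h1 : -(P ^ 2 / lam) - lam * M ^ 2 / 4 ≤ P * M := by
    have : 0 ≤ (P / lam + M / 2) ^ 2 * lam := by positivity
    have h' : (P / lam + M / 2) ^ 2 * lam = P ^ 2 / lam + P * M + lam * M ^ 2 / 4 := by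
      field_simp
      ring
    linarith
  have h2 : -(lam * M ^ 2 / 4) - 4 * lam * (C ^ 2 * w ^ 2) ≤ 2 * lam * (μ * w) * M := by
    have h3 : μ ^ 2 * w ^ 2 ≤ C ^ 2 * w ^ 2 := mul_le_mul_of_nonneg_right hμ2 hw2
    have h4 : 0 ≤ lam * (M / 2 + 2 * μ * w) ^ 2 := by positivity
    nlinarith
  have h3 : g ^ 2 ≤ 2 * M ^ 2 + 2 * (C ^ 2 * w ^ 2) := by
    have h3 : κ ^ 2 * w ^ 2 ≤ C ^ 2 * w ^ 2 := mul_le_mul_of_nonneg_right hκ2 hw2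
    have h4 : g = M - κ * w := by linarith
    rw [h4]
    nlinarith [sq_nonneg (M + κ * w)]
  have h4 : Λ * g ^ 2 ≤ 2 * Λ * M ^ 2 + 2 * Λ * (C ^ 2 * w ^ 2) := by
    nlinarith [mul_le_mul_of_nonneg_left h3 hΛ]
  have h5 : 2 * Λ * M ^ 2 ≤ lam * M ^ 2 := mul_le_mul_of_nonneg_right hlamΛ (sq_nonneg M)
  have h6 : D * w ^ 2 ≤ C * w ^ 2 := mul_le_mul_of_nonneg_right (le_of_abs_le hD) hw2
  have h7 : lam ^ 2 * c * w ^ 2 ≤ lam ^ 2 * Z * w ^ 2 :=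
    mul_le_mul_of_nonneg_right (mul_le_mul_of_nonneg_left hZ (sq_nonneg _)) hw2
  have h8 : (4 * lam * C ^ 2 + 2 * Λ * C ^ 2 + C) * w ^ 2 ≤ lam ^ 2 * (c / 2) * w ^ 2 := by
    refine mul_le_mul_of_nonneg_right ?_ hw2
    have h9 : 4 * lam * C ^ 2 + 2 * Λ * C ^ 2 + C ≤ lam * (4 * C ^ 2 + 2 * Λ * C ^ 2 + C) := by
      have : 0 ≤ (lam - 1) * (2 * Λ * C ^ 2 + C) := mul_nonneg (by linarith) (by positivity)
      linarith
    have := mul_le_mul_of_nonneg_left hlamC hl0.le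
    linarith
  have h10 : 0 ≤ lam * M ^ 2 := by positivity
  linarith

theorem contDiffOn_pd {O : Set V} (hO : IsOpen O) {a : V → ℝ} (ha : ContDiffOn ℝ ∞ a O) (v : V) :
    ContDiffOn ℝ ∞ (pd v a) O := fun _ hx =>
  (contDiffAt_pd (n := ∞) (ha.contDiffAt (hO.mem_nhds hx))).contDiffWithinAt

end Current

/-! ### Pointwise Carleman inequality for an abstract pseudoconvex weight -/

section Carleman

variable {V : Type*} [NormedAddCommGroup V] [NormedSpace ℝ V] {ι : Type*} [Fintype ι]

theorem contDiffOn_waveOp {e : ι → V} {s : ι → ℝ} {O : Set V} (hO : IsOpen O) {a : V → ℝ}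
    (ha : ContDiffOn ℝ ∞ a O) : ContDiffOn ℝ ∞ (waveOp e s a) O := by
  unfold waveOp
  exact ContDiffOn.sum fun i _ => contDiffOn_const.mul (contDiffOn_pd hO (contDiffOn_pd hO ha _) _)

theorem continuousOn_gpair {e : ι → V} {s : ι → ℝ} {O : Set V} {a b : V → ℝ}
    (ha : ∀ v, ContinuousOn (pd v a) O) (hb : ∀ v, ContinuousOn (pd v b) O) :
    ContinuousOn (gpair e s a b) O := by
  unfold gpair
  exact continuousOn_finsetSum _ fun i _ => continuousOn_const.mul ((ha _).mul (hb _))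

theorem continuousOn_hessQ {e : ι → V} {s : ι → ℝ} {O : Set V} (hO : IsOpen O) {a : V → ℝ}
    (ha : ContDiffOn ℝ ∞ a O) {X : Type*} [TopologicalSpace X] {A : Set X} {f : X → V}
    {y : X → ι → ℝ} (hf : ContinuousOn f A) (hfA : MapsTo f A O)
    (hy : ∀ i, ContinuousOn (fun x => y x i) A) :
    ContinuousOn (fun x => hessQ e s a (f x) (y x)) A := by
  unfold hessQ
  refine continuousOn_finsetSum _ fun i _ => (continuousOn_const.mul (hy i)).mul
    (continuousOn_finsetSum _ fun j _ => continuousOn_const.mul (ContinuousOn.mul ?_ (hy j)))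
  exact (contDiffOn_pd hO (contDiffOn_pd hO ha _) _).continuousOn.comp hf hfA

/-- With κ = □ψ/2 - μ and M = g(∇ψ, ∇w) + κ w, the conjugated operator with λ² g(∇ψ, ∇ψ) w added
equals e^{λψ} □u + 2λ (M + μ w). Its product with M contains 2λM², which controls the derivative of
w along the gradient of ψ. Hence positivity of the quadratic form is required only on vectors
annihilated by ∇ψ. Compactness of K makes all constants uniform, and in particular independent of λ
and u. -/
theorem carleman_pointwise {e : ι → V} {s : ι → ℝ} {O K : Set V} (hO : IsOpen O)
    (hK : IsCompact K) (hKO : K ⊆ O) {ψ μ : V → ℝ} (hψ : ContDiffOn ℝ ∞ ψ O)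
    (hμ : ContDiffOn ℝ ∞ μ O)
    (hZ : ∀ q ∈ K, 0 < hessQ e s ψ q (fun i => pd (e i) ψ q) + μ q * gpair e s ψ ψ q)
    (hQ : ∀ q ∈ K, ∀ y : ι → ℝ, y ≠ 0 → ∑ i, s i * (pd (e i) ψ q * y i) = 0 →
      0 < hessQ e s ψ q y - μ q * ∑ i, s i * (y i * y i)) :
    ∃ c > 0, ∃ lam₀ ≥ 1, ∀ lam ≥ lam₀, ∀ q ∈ K, ∀ u : V → ℝ, ContDiffAt ℝ 2 u q →
      Real.exp (lam * ψ q) ^ 2 *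
        (c * (∑ i, pd (e i) u q ^ 2 + lam ^ 2 * u q ^ 2) - waveOp e s u q ^ 2 / lam)
      ≤ divg e (current e s ψ (fun x => waveOp e s ψ x / 2 - μ x) lam
          (fun x => Real.exp (lam * ψ x) * u x)) q := by
  set κ : V → ℝ := fun x => waveOp e s ψ x / 2 - μ x with hκdef
  have hκ : ContDiffOn ℝ ∞ κ O := ((contDiffOn_waveOp hO hψ).div_const 2).sub hμ
  have hpdψ : ∀ v, ContinuousOn (pd v ψ) K := fun v =>
    (contDiffOn_pd hO hψ v).continuousOn.mono hKO
  have hgψψ : ContinuousOn (gpair e s ψ ψ) K := continuousOn_gpair hpdψ hpdψ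
  obtain ⟨c₁, hc₁, hcZ⟩ := exists_pos_le_of_isCompact hK
    (f := fun q => hessQ e s ψ q (fun i => pd (e i) ψ q) + μ q * gpair e s ψ ψ q)
    ((continuousOn_hessQ hO hψ continuousOn_id hKO fun i => hpdψ _).add
      ((hμ.continuousOn.mono hKO).mul hgψψ)) hZ
  have hfst : ContinuousOn (fun z : V × (ι → ℝ) => z.1) (K ×ˢ univ) := continuous_fst.continuousOn
  have hmaps : MapsTo (fun z : V × (ι → ℝ) => z.1) (K ×ˢ univ) O := fun z hz => hKO hz.1
  have hsnd : ∀ i, ContinuousOn (fun z : V × (ι → ℝ) => z.2 i) (K ×ˢ univ) := fun i =>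
    ((continuous_apply i).comp continuous_snd).continuousOn
  obtain ⟨c₂, hc₂, Λ, hΛ, hcQ⟩ := exists_quadratic_lower_bound hK
    (Q := fun q y => hessQ e s ψ q y - μ q * ∑ i, s i * (y i * y i))
    (l := fun q y => ∑ i, s i * (pd (e i) ψ q * y i))
    ((continuousOn_hessQ hO hψ hfst hmaps hsnd).sub ((hμ.continuousOn.comp hfst hmaps).mul
      (continuousOn_finsetSum _ fun i _ => continuousOn_const.mul ((hsnd i).mul (hsnd i)))))
    (continuousOn_finsetSum _ fun i _ => continuousOn_const.mul
      (((contDiffOn_pd hO hψ _).continuousOn.comp hfst hmaps).mul (hsnd i)))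
    (fun q t y => by
      simp only [hessQ, Pi.smul_apply, smul_eq_mul, mul_sub, Finset.mul_sum]
      congr 1
      · exact Finset.sum_congr rfl fun i _ => Finset.sum_congr rfl fun j _ => by ring
      · exact Finset.sum_congr rfl fun i _ => by ring)
    (fun q t y => by
      simp only [Pi.smul_apply, smul_eq_mul, Finset.mul_sum]
      exact Finset.sum_congr rfl fun i _ => by ring)
    hQ
  obtain ⟨C₁, hC₁, hμC⟩ := exists_abs_le_of_isCompact hK (hμ.continuousOn.mono hKO)
  obtain ⟨C₂, hC₂, hκC⟩ := exists_abs_le_of_isCompact hK (hκ.continuousOn.mono hKO)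
  obtain ⟨C₃, hC₃, hDC⟩ := exists_abs_le_of_isCompact hK (f := fun q => waveOp e s κ q / 2)
    (((contDiffOn_waveOp hO hκ).continuousOn.mono hKO).div_const 2)
  obtain ⟨C₄, hC₄, hPC⟩ := exists_abs_le_of_isCompact hK (f := fun q => ∑ i, pd (e i) ψ q ^ 2)
    (continuousOn_finsetSum _ fun i _ => (hpdψ _).pow 2)
  set C := C₁ + C₂ + C₃ + C₄ with hC
  have hC0 : 0 ≤ C := by positivity
  set c := min c₁ c₂ with hcdef
  have hc : 0 < c := lt_min hc₁ hc₂
  -- The factor 2C + 1 is the price of returning from w to u: e^{2λψ}|∇u|² ≤ 2|∇w|² + 2λ²C w². With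
  -- this constant the w² part is exactly λ² (c/2) w². The three lower bounds on λ are those
  -- required by `carleman_algebra`.
  refine ⟨c / (2 * (2 * C + 1)), by positivity,
    max 1 (max (2 * Λ) ((4 * C ^ 2 + 2 * Λ * C ^ 2 + C) / (c / 2))), le_max_left _ _, ?_⟩
  intro lam hlam q hq u hu
  have hlam1 : 1 ≤ lam := (le_max_left _ _).trans hlam
  have hlamΛ : 2 * Λ ≤ lam := ((le_max_left _ _).trans (le_max_right _ _)).trans hlam
  have hlamC : 4 * C ^ 2 + 2 * Λ * C ^ 2 + C ≤ lam * (c / 2) := by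
    rw [← div_le_iff₀ (by positivity)]
    exact ((le_max_right _ _).trans (le_max_right _ _)).trans hlam
  have hψq : ContDiffAt ℝ 2 ψ q := (hψ.contDiffAt (hO.mem_nhds (hKO hq))).of_le (by norm_cast)
  have hκq : ContDiffAt ℝ 2 κ q := (hκ.contDiffAt (hO.mem_nhds (hKO hq))).of_le (by norm_cast)
  have hwq : ContDiffAt ℝ 2 (fun x => Real.exp (lam * ψ x) * u x) q :=
    (contDiffAt_const.mul hψq).exp.mul hu
  have hconj := waveOp_conj (e := e) (s := s) lam hψq hu
  have hpdw : ∀ i, pd (e i) (fun x => Real.exp (lam * ψ x) * u x) q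
      = Real.exp (lam * ψ q) * pd (e i) u q + lam * pd (e i) ψ q * (Real.exp (lam * ψ q) * u q) :=
    fun i => pd_exp_mul_mul lam (hψq.differentiableAt two_ne_zero) (hu.differentiableAt two_ne_zero)
  rw [divg_current lam hψq hκq hwq, hconj]
  set w : V → ℝ := fun x => Real.exp (lam * ψ x) * u x with hw
  set E := Real.exp (lam * ψ q) with hE
  have hwE : w q = E * u q := rfl
  have hμκ : waveOp e s ψ q / 2 - κ q = μ q := by simp [hκdef]
  have halg := carleman_algebra (c := c) (C := C) (Λ := Λ) (lam := lam) (P := E * waveOp e s u q)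
    (M := gpair e s ψ w q + κ q * w q) (μ := μ q) (κ := κ q) (w := w q)
    (S := ∑ i, pd (e i) w q ^ 2)
    (Q := hessQ e s ψ q (fun i => pd (e i) w q) - μ q * gpair e s w w q)
    (Z := hessQ e s ψ q (fun i => pd (e i) ψ q) + μ q * gpair e s ψ ψ q)
    (D := waveOp e s κ q / 2) (g := gpair e s ψ w q) hC0 hΛ hlam1 hlamΛ hlamC
    ((hμC q hq).trans (by linarith)) ((hκC q hq).trans (by linarith))
    ((hDC q hq).trans (by linarith)) ((min_le_left _ _).trans (hcZ q hq)) rfl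
    (le_trans (mul_le_mul_of_nonneg_right (min_le_right _ _)
      (Finset.sum_nonneg fun i _ => sq_nonneg _)) (hcQ q hq fun i => pd (e i) w q))
  have hwave : waveOp e s ψ q = 2 * (κ q + μ q) := by linarith
  have hgrad : E ^ 2 * ∑ i, pd (e i) u q ^ 2
      ≤ 2 * ∑ i, pd (e i) w q ^ 2 + 2 * lam ^ 2 * C * w q ^ 2 := by
    have h1 : E ^ 2 * ∑ i, pd (e i) u q ^ 2
        ≤ 2 * ∑ i, pd (e i) w q ^ 2 + 2 * lam ^ 2 * w q ^ 2 * ∑ i, pd (e i) ψ q ^ 2 := by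
      simp only [Finset.mul_sum, ← Finset.sum_add_distrib]
      refine Finset.sum_le_sum fun i _ => ?_
      have : E * pd (e i) u q = pd (e i) w q - lam * pd (e i) ψ q * w q := by
        rw [hpdw i, hwE]
        ring
      calc E ^ 2 * pd (e i) u q ^ 2 = (E * pd (e i) u q) ^ 2 := by ring
        _ ≤ _ := by
          rw [this]
          nlinarith [sq_nonneg (pd (e i) w q + lam * pd (e i) ψ q * w q)]
    have h2 : ∑ i, pd (e i) ψ q ^ 2 ≤ C := (le_of_abs_le (hPC q hq)).trans (by linarith)
    have h3 := mul_le_mul_of_nonneg_left h2 (by positivity : 0 ≤ 2 * lam ^ 2 * w q ^ 2)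
    linarith
  have hS0 : 0 ≤ ∑ i, pd (e i) w q ^ 2 := Finset.sum_nonneg fun i _ => sq_nonneg _
  have hfin : E ^ 2 * (c / (2 * (2 * C + 1)) * (∑ i, pd (e i) u q ^ 2 + lam ^ 2 * u q ^ 2))
      ≤ c * ∑ i, pd (e i) w q ^ 2 + lam ^ 2 * (c / 2) * w q ^ 2 := by
    have h1 : E ^ 2 * (c / (2 * (2 * C + 1)) * (∑ i, pd (e i) u q ^ 2 + lam ^ 2 * u q ^ 2))
        = c / (2 * (2 * C + 1)) * (E ^ 2 * ∑ i, pd (e i) u q ^ 2 + lam ^ 2 * w q ^ 2) := by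
      rw [hwE]
      ring
    rw [h1, div_mul_eq_mul_div, div_le_iff₀ (by positivity)]
    have h2 := mul_le_mul_of_nonneg_left hgrad hc.le
    have h3 : 0 ≤ c * C * ∑ i, pd (e i) w q ^ 2 := by positivity
    linarith
  calc E ^ 2 * (c / (2 * (2 * C + 1)) * (∑ i, pd (e i) u q ^ 2 + lam ^ 2 * u q ^ 2)
        - waveOp e s u q ^ 2 / lam)
      = E ^ 2 * (c / (2 * (2 * C + 1)) * (∑ i, pd (e i) u q ^ 2 + lam ^ 2 * u q ^ 2))
        - (E * waveOp e s u q) ^ 2 / lam := by ring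
    _ ≤ c * ∑ i, pd (e i) w q ^ 2 + lam ^ 2 * (c / 2) * w q ^ 2
        - (E * waveOp e s u q) ^ 2 / lam := by linarith
    _ ≤ _ := halg
    _ = _ := by
      rw [hμκ, hwave, ← hwE]
      ring

end Carleman

/-! ### The function k = f_p / (1 - ε r_p) and its derivatives -/

section Weight

variable {m n : ℕ}

/-- The standard basis of space-time. -/
noncomputable def bv : Fin m ⊕ Fin n → ST m n :=
  Sum.elim (fun i => (EuclideanSpace.single i 1, 0)) (fun j => (0, EuclideanSpace.single j 1))

/-- The signature: `-1` in the time directions and `1` in the space directions. -/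
noncomputable def sg : Fin m ⊕ Fin n → ℝ := Sum.elim (fun _ => -1) (fun _ => 1)

/-- The coordinate functionals of space-time. -/
noncomputable def coord : Fin m ⊕ Fin n → ST m n →L[ℝ] ℝ :=
  Sum.elim (fun i => (EuclideanSpace.proj i).comp (ContinuousLinearMap.fst ℝ (E m) (E n)))
    (fun j => (EuclideanSpace.proj j).comp (ContinuousLinearMap.snd ℝ (E m) (E n)))

/-- `f_p / (1 - ε r_p)`, whose level sets are pseudoconvex. -/
noncomputable def kp (ε : ℝ) (p q : ST m n) : ℝ := fp p q / (1 - ε * rp p q)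

/-- The region on which `kp` is smooth. -/
def regular (ε : ℝ) (p : ST m n) : Set (ST m n) := {q | 0 < rp p q ∧ ε * rp p q < 1}

@[simp] theorem coord_inl (i : Fin m) (q : ST m n) : coord (Sum.inl i) q = q.1 i := rfl

@[simp] theorem coord_inr (j : Fin n) (q : ST m n) : coord (Sum.inr j) q = q.2 j := rfl

theorem coord_bv (i j : Fin m ⊕ Fin n) : coord i (bv j) = if i = j then 1 else 0 := by
  rcases i with i | i <;> rcases j with j | j <;> simp [bv]

theorem sg_mul_self (i : Fin m ⊕ Fin n) : sg i * sg i = 1 := by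
  rcases i with i | i <;> simp [sg]

theorem continuous_rp (p : ST m n) : Continuous (rp p) := by unfold rp; fun_prop

theorem contDiff_fp (p : ST m n) : ContDiff ℝ ∞ (fp p) := by
  unfold fp
  refine ContDiff.div_const (ContDiff.sub ?_ ?_) 4
  · exact (contDiff_snd.sub contDiff_const).norm_sq ℝ
  · exact (contDiff_fst.sub contDiff_const).norm_sq ℝ

theorem isOpen_regular (ε : ℝ) (p : ST m n) : IsOpen (regular ε p) :=
  (isOpen_lt continuous_const (continuous_rp p)).inter
    (isOpen_lt (continuous_const.mul (continuous_rp p)) continuous_const)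

theorem contDiffOn_rp (ε : ℝ) (p : ST m n) : ContDiffOn ℝ ∞ (rp p) (regular ε p) := by
  intro q hq
  have h0 : q.2 - p.2 ≠ 0 := norm_pos_iff.1 hq.1
  have h1 : ContDiffAt ℝ ∞ (fun q : ST m n => q.2 - p.2) q := contDiffAt_snd.sub contDiffAt_const
  exact (h1.norm ℝ h0).contDiffWithinAt

theorem contDiffOn_kp (ε : ℝ) (p : ST m n) : ContDiffOn ℝ ∞ (kp ε p) (regular ε p) := by
  refine (contDiff_fp p).contDiffOn.div
    (contDiffOn_const.sub (contDiffOn_const.mul (contDiffOn_rp ε p))) fun q hq => ?_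
  have := hq.2
  linarith

theorem pd_coord_sub (v p q : ST m n) (i : Fin m ⊕ Fin n) :
    pd v (fun q => coord i (q - p)) q = coord i v := by
  have h : HasFDerivAt (fun q => coord i (q - p)) (coord i) q := by
    have := (coord i).hasFDerivAt.comp q ((hasFDerivAt_id q).sub_const p)
    rwa [ContinuousLinearMap.comp_id] at this
  rw [pd, h.fderiv]

theorem pd_fp (p q v : ST m n) :
    pd v (fp p) q = (inner ℝ (q.2 - p.2) v.2 - inner ℝ (q.1 - p.1) v.1) / 2 := by
  have h1 : HasFDerivAt (fun q : ST m n => q.2 - p.2) (ContinuousLinearMap.snd ℝ (E m) (E n)) q :=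
    hasFDerivAt_snd.sub_const _
  have h2 : HasFDerivAt (fun q : ST m n => q.1 - p.1) (ContinuousLinearMap.fst ℝ (E m) (E n)) q :=
    hasFDerivAt_fst.sub_const _
  have h := ((h1.norm_sq.sub h2.norm_sq).const_mul (1 / 4 : ℝ))
  have h' : HasFDerivAt (fp p) _ q := h.congr_of_eventuallyEq (Eventually.of_forall fun x => by
    simp [fp]; ring)
  rw [pd, h'.fderiv]
  simp [inner_sub_left]
  ring

theorem pd_bv_fp (p q : ST m n) (i : Fin m ⊕ Fin n) :
    pd (bv i) (fp p) q = sg i / 2 * coord i (q - p) := by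
  rw [pd_fp]
  rcases i with i | i
  · simp [bv, sg, EuclideanSpace.inner_single_right]
    ring
  · simp [bv, sg, EuclideanSpace.inner_single_right]
    ring

theorem pd_pd_bv_fp (p q : ST m n) (i j : Fin m ⊕ Fin n) :
    pd (bv i) (pd (bv j) (fp p)) q = if i = j then sg i / 2 else 0 := by
  have h : pd (bv j) (fp p) = fun q => sg j / 2 * coord j (q - p) := funext fun q => pd_bv_fp p q j
  have hd : DifferentiableAt ℝ (fun q => coord j (q - p)) q := by fun_prop
  rw [h, pd_const_mul _ hd, pd_coord_sub, coord_bv]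
  by_cases hij : i = j
  · simp [hij]
  · simp [hij, Ne.symm hij]

/-- Obtained by differentiating r², a polynomial, rather than the norm. -/
theorem rp_mul_pd_rp {ε : ℝ} {p q : ST m n} (hq : q ∈ regular ε p) (v : ST m n) :
    rp p q * pd v (rp p) q = inner ℝ (q.2 - p.2) v.2 := by
  have hd : DifferentiableAt ℝ (rp p) q :=
    ((contDiffOn_rp ε p).contDiffAt ((isOpen_regular ε p).mem_nhds hq)).differentiableAt (by simp)
  have h1 : HasFDerivAt (fun q : ST m n => q.2 - p.2) (ContinuousLinearMap.snd ℝ (E m) (E n)) q :=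
    hasFDerivAt_snd.sub_const _
  have h2 : HasFDerivAt (fun q => rp p q * rp p q) _ q :=
    h1.norm_sq.congr_of_eventuallyEq (Eventually.of_forall fun x => by simp [rp]; ring)
  have h3 : pd v (fun q => rp p q * rp p q) q = 2 * inner ℝ (q.2 - p.2) v.2 := by
    rw [pd, h2.fderiv]
    simp [inner_sub_left]
  rw [pd_mul hd hd] at h3
  linarith

/-- The indicator of the space directions. -/
noncomputable def sp : Fin m ⊕ Fin n → ℝ := Sum.elim (fun _ => 0) (fun _ => 1)

theorem rp_mul_pd_bv_rp {ε : ℝ} {p q : ST m n} (hq : q ∈ regular ε p) (i : Fin m ⊕ Fin n) :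
    rp p q * pd (bv i) (rp p) q = sp i * coord i (q - p) := by
  rw [rp_mul_pd_rp hq]
  rcases i with i | i <;> simp [bv, sp, EuclideanSpace.inner_single_right]

/-- Differentiate r ∂_j r, which is the j-th spatial coordinate of q - p or zero. The result says
that the Hessian of r is the spatial projection orthogonal to ∇r, divided by r. -/
theorem rp_mul_pd_pd_bv_rp {ε : ℝ} {p q : ST m n} (hq : q ∈ regular ε p) (i j : Fin m ⊕ Fin n) :
    rp p q * pd (bv i) (pd (bv j) (rp p)) q
      = (if i = j then sp i else 0) - pd (bv i) (rp p) q * pd (bv j) (rp p) q := by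
  have hnh := (isOpen_regular ε p).mem_nhds hq
  have hC : ContDiffAt ℝ 2 (rp p) q := ((contDiffOn_rp ε p).contDiffAt hnh).of_le (by norm_cast)
  have hd : DifferentiableAt ℝ (rp p) q := hC.differentiableAt two_ne_zero
  have h : (fun q => rp p q * pd (bv j) (rp p) q) =ᶠ[𝓝 q] fun q => sp j * coord j (q - p) := by
    filter_upwards [hnh] with x hx using rp_mul_pd_bv_rp hx j
  have h1 := pd_congr (v := bv i) h
  have hd' : DifferentiableAt ℝ (fun q => coord j (q - p)) q := by fun_prop
  rw [pd_mul hd (differentiableAt_pd hC), pd_const_mul _ hd', pd_coord_sub, coord_bv] at h1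
  by_cases hij : i = j
  · subst hij
    simp only [if_true] at h1 ⊢
    linarith
  · simp only [hij, Ne.symm hij, if_false] at h1 ⊢
    linarith

theorem kp_mul {ε : ℝ} {p q : ST m n} (hq : q ∈ regular ε p) :
    (1 - ε * rp p q) * kp ε p q = fp p q := by
  have := hq.2
  unfold kp
  field_simp [show (1 - ε * rp p q) ≠ 0 by linarith]

/-- Differentiating the product (1 - ε r) k = f instead of the quotient keeps denominators out; a
second differentiation then gives `pd_pd_kp`. -/
theorem pd_kp {ε : ℝ} {p q : ST m n} (hq : q ∈ regular ε p) (v : ST m n) :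
    (1 - ε * rp p q) * pd v (kp ε p) q = pd v (fp p) q + ε * kp ε p q * pd v (rp p) q := by
  have hnh := (isOpen_regular ε p).mem_nhds hq
  have dr : DifferentiableAt ℝ (rp p) q :=
    ((contDiffOn_rp ε p).contDiffAt hnh).differentiableAt (by simp)
  have dk : DifferentiableAt ℝ (kp ε p) q :=
    ((contDiffOn_kp ε p).contDiffAt hnh).differentiableAt (by simp)
  have h : (fun q => (1 - ε * rp p q) * kp ε p q) =ᶠ[𝓝 q] fp p := by
    filter_upwards [hnh] with x hx using kp_mul hx
  have h1 := pd_congr (v := v) h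
  have da : DifferentiableAt ℝ (fun q => 1 - ε * rp p q) q := by fun_prop
  have h0 : pd v (fun _ : ST m n => (1 : ℝ)) q = 0 := by simp [pd]
  rw [pd_mul da dk, pd_sub (differentiableAt_const _) (dr.const_mul ε), pd_const_mul _ dr, h0] at h1
  linarith

theorem pd_pd_kp {ε : ℝ} {p q : ST m n} (hq : q ∈ regular ε p) (v v' : ST m n) :
    (1 - ε * rp p q) * pd v (pd v' (kp ε p)) q
      = pd v (pd v' (fp p)) q + ε * kp ε p q * pd v (pd v' (rp p)) q
        + ε * (pd v (kp ε p) q * pd v' (rp p) q + pd v (rp p) q * pd v' (kp ε p) q) := by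
  have hnh := (isOpen_regular ε p).mem_nhds hq
  have hCr : ContDiffAt ℝ 2 (rp p) q := ((contDiffOn_rp ε p).contDiffAt hnh).of_le (by norm_cast)
  have hCk : ContDiffAt ℝ 2 (kp ε p) q := ((contDiffOn_kp ε p).contDiffAt hnh).of_le (by norm_cast)
  have hCf : ContDiffAt ℝ 2 (fp p) q := (contDiff_fp p).contDiffAt.of_le (by norm_cast)
  have dr : DifferentiableAt ℝ (rp p) q := hCr.differentiableAt two_ne_zero
  have dk : DifferentiableAt ℝ (kp ε p) q := hCk.differentiableAt two_ne_zero
  have dr' := differentiableAt_pd (v := v') hCr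
  have dk' := differentiableAt_pd (v := v') hCk
  have df' := differentiableAt_pd (v := v') hCf
  have h : (fun q => (1 - ε * rp p q) * pd v' (kp ε p) q) =ᶠ[𝓝 q]
      fun q => pd v' (fp p) q + ε * (kp ε p q * pd v' (rp p) q) := by
    filter_upwards [hnh] with x hx
    rw [pd_kp hx v']
    ring
  have h1 := pd_congr (v := v) h
  have da : DifferentiableAt ℝ (fun q => 1 - ε * rp p q) q := by fun_prop
  have h0 : pd v (fun _ : ST m n => (1 : ℝ)) q = 0 := by simp [pd]
  rw [pd_mul da dk', pd_sub (differentiableAt_const _) (dr.const_mul ε), pd_const_mul _ dr, h0,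
    pd_add df' ((dk.fun_mul dr').const_mul ε), pd_const_mul _ (dk.fun_mul dr'), pd_mul dk dr'] at h1
  linarith

end Weight

/-! ### Pseudoconvexity of the level sets of k and construction of the weight -/

section Pseudoconvexity

variable {m n : ℕ}

theorem sg_mul_sp (i : Fin m ⊕ Fin n) : sg i * sp i = sp i := by
  rcases i with i | i <;> simp [sg, sp]

theorem sg_mul_pd_rp {ε : ℝ} {p q : ST m n} (hq : q ∈ regular ε p) (i : Fin m ⊕ Fin n) :
    sg i * pd (bv i) (rp p) q = pd (bv i) (rp p) q := by
  have h := rp_mul_pd_bv_rp hq i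
  have h0 : rp p q ≠ 0 := hq.1.ne'
  apply mul_left_cancel₀ h0
  rw [mul_left_comm, h, ← mul_assoc, sg_mul_sp]

theorem sum_sp_coord_sq (p q : ST m n) :
    ∑ i, sp i * coord i (q - p) ^ 2 = rp p q ^ 2 := by
  simp [sp, rp, EuclideanSpace.norm_sq_eq, Fintype.sum_sum_type]

theorem sum_sg_coord_sq (p q : ST m n) :
    ∑ i, sg i * coord i (q - p) ^ 2 = 4 * fp p q := by
  simp [sg, fp, EuclideanSpace.norm_sq_eq, Fintype.sum_sum_type]
  ring

theorem sum_pd_rp_sq {ε : ℝ} {p q : ST m n} (hq : q ∈ regular ε p) :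
    ∑ i, pd (bv i) (rp p) q ^ 2 = 1 := by
  have h0 : rp p q ^ 2 ≠ 0 := pow_ne_zero 2 hq.1.ne'
  apply mul_left_cancel₀ h0
  rw [mul_one, Finset.mul_sum]
  conv_rhs => rw [← sum_sp_coord_sq]
  refine Finset.sum_congr rfl fun i _ => ?_
  rw [← mul_pow, rp_mul_pd_bv_rp hq i]
  rcases i with i | i <;> simp [sp]

theorem sum_coord_mul_pd_rp {ε : ℝ} {p q : ST m n} (hq : q ∈ regular ε p) :
    ∑ i, coord i (q - p) * pd (bv i) (rp p) q = rp p q := by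
  apply mul_left_cancel₀ hq.1.ne'
  rw [Finset.mul_sum, ← sq, ← sum_sp_coord_sq]
  refine Finset.sum_congr rfl fun i _ => ?_
  rw [mul_left_comm, rp_mul_pd_bv_rp hq i]
  ring

/-- The gradient of `kp` is spacelike. -/
theorem gpair_kp {ε : ℝ} {p q : ST m n} (hq : q ∈ regular ε p) :
    (1 - ε * rp p q) ^ 2 * gpair bv sg (kp ε p) (kp ε p) q
      = fp p q + ε * kp ε p q * rp p q + ε ^ 2 * kp ε p q ^ 2 := by
  have h : ∀ i : Fin m ⊕ Fin n, (1 - ε * rp p q) ^ 2 * (sg i * (pd (bv i) (kp ε p) q *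
      pd (bv i) (kp ε p) q)) = 1 / 4 * (sg i * coord i (q - p) ^ 2)
        + ε * kp ε p q * (coord i (q - p) * pd (bv i) (rp p) q)
        + ε ^ 2 * kp ε p q ^ 2 * pd (bv i) (rp p) q ^ 2 := by
    intro i
    have h1 := pd_kp hq (bv i)
    rw [pd_bv_fp] at h1
    have h2 := sg_mul_pd_rp hq i
    have h3 := sg_mul_self i
    calc _ = sg i * ((1 - ε * rp p q) * pd (bv i) (kp ε p) q) ^ 2 := by ring
      _ = (sg i * sg i) * (sg i * coord i (q - p) ^ 2) / 4
          + ε * kp ε p q * (coord i (q - p) * pd (bv i) (rp p) q) * (sg i * sg i)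
          + ε ^ 2 * kp ε p q ^ 2 * (sg i * pd (bv i) (rp p) q) * pd (bv i) (rp p) q := by
        rw [h1]
        ring
      _ = _ := by
        rw [h2, h3]
        ring
  rw [gpair, Finset.mul_sum, Finset.sum_congr rfl fun i _ => h i, Finset.sum_add_distrib,
    Finset.sum_add_distrib, ← Finset.mul_sum, ← Finset.mul_sum, ← Finset.mul_sum, sum_sg_coord_sq,
    sum_coord_mul_pd_rp hq, sum_pd_rp_sq hq]
  ring

/-- The first term is the Hessian of f, half the metric, and changes sign. The second comes from the
Hessian of r; it is nonnegative and is the gain produced by ε. The third carries the factor g(∇k, y)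
and so disappears on tangent vectors. -/
theorem hessQ_kp {ε : ℝ} {p q : ST m n} (hq : q ∈ regular ε p) (y : Fin m ⊕ Fin n → ℝ) :
    (1 - ε * rp p q) * hessQ bv sg (kp ε p) q y
      = 1 / 2 * ∑ i, sg i * (y i * y i)
        + ε * kp ε p q / rp p q * (∑ i, sp i * (y i * y i) - (∑ i, pd (bv i) (rp p) q * y i) ^ 2)
        + 2 * ε * (∑ i, pd (bv i) (rp p) q * y i) * ∑ i, sg i * (pd (bv i) (kp ε p) q * y i) := by
  set vr := ∑ i, pd (bv i) (rp p) q * y i with hvr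
  set L := ∑ i, sg i * (pd (bv i) (kp ε p) q * y i) with hL
  have hr0 : rp p q ≠ 0 := hq.1.ne'
  have hin : ∀ i, (1 - ε * rp p q) * ∑ j, sg j * (pd (bv i) (pd (bv j) (kp ε p)) q * y j)
      = 1 / 2 * y i + ε * kp ε p q / rp p q * (sp i * y i - pd (bv i) (rp p) q * vr)
        + ε * (pd (bv i) (kp ε p) q * vr + pd (bv i) (rp p) q * L) := by
    intro i
    have hj : ∀ j, (1 - ε * rp p q) * (sg j * (pd (bv i) (pd (bv j) (kp ε p)) q * y j))
        = (if i = j then 1 / 2 * y j + ε * kp ε p q / rp p q * (sp j * y j) else 0)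
          - ε * kp ε p q / rp p q * pd (bv i) (rp p) q * (pd (bv j) (rp p) q * y j)
          + ε * pd (bv i) (kp ε p) q * (pd (bv j) (rp p) q * y j)
          + ε * pd (bv i) (rp p) q * (sg j * (pd (bv j) (kp ε p) q * y j)) := by
      intro j
      have h1 := pd_pd_kp hq (bv i) (bv j)
      have h2 := rp_mul_pd_pd_bv_rp hq i j
      have h2' : pd (bv i) (pd (bv j) (rp p)) q = ((if i = j then sp i else 0)
          - pd (bv i) (rp p) q * pd (bv j) (rp p) q) / rp p q := by
        rw [← h2]
        field_simp
      have h3 := sg_mul_pd_rp hq j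
      rw [pd_pd_bv_fp, h2'] at h1
      calc _ = sg j * y j * ((1 - ε * rp p q) * pd (bv i) (pd (bv j) (kp ε p)) q) := by ring
        _ = sg j * y j * ((if i = j then sg i / 2 else 0)
            + ε * kp ε p q * ((if i = j then sp i else 0) / rp p q))
            - ε * kp ε p q / rp p q * pd (bv i) (rp p) q * (sg j * pd (bv j) (rp p) q) * y j
            + ε * pd (bv i) (kp ε p) q * (sg j * pd (bv j) (rp p) q) * y j
            + ε * pd (bv i) (rp p) q * (sg j * (pd (bv j) (kp ε p) q * y j)) := by
          rw [h1]
          ring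
        _ = _ := by
          rw [h3]
          by_cases hij : i = j
          · subst hij
            simp only [if_true]
            have h4 := sg_mul_self i
            have h5 := sg_mul_sp i
            have h6 : sg i * y i * (sg i / 2 + ε * kp ε p q * (sp i / rp p q))
                = (sg i * sg i) * y i / 2 + ε * kp ε p q / rp p q * ((sg i * sp i) * y i) := by
              ring
            rw [h6, h4, h5]
            ring
          · simp only [hij, if_false]
            ring
    rw [Finset.mul_sum, Finset.sum_congr rfl fun j _ => hj j, Finset.sum_add_distrib,
      Finset.sum_add_distrib, Finset.sum_sub_distrib, ← Finset.mul_sum, ← Finset.mul_sum,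
      ← Finset.mul_sum, Finset.sum_ite_eq, ← hvr, ← hL]
    simp only [Finset.mem_univ, if_true]
    ring
  have hout : ∀ i, (1 - ε * rp p q) * (sg i * y i *
      ∑ j, sg j * (pd (bv i) (pd (bv j) (kp ε p)) q * y j))
      = 1 / 2 * (sg i * (y i * y i)) + ε * kp ε p q / rp p q * (sp i * (y i * y i))
        - ε * kp ε p q / rp p q * vr * (pd (bv i) (rp p) q * y i)
        + ε * vr * (sg i * (pd (bv i) (kp ε p) q * y i))
        + ε * L * (pd (bv i) (rp p) q * y i) := by
    intro i
    have h3 := sg_mul_pd_rp hq i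
    have h5 := sg_mul_sp i
    rw [mul_left_comm, hin i]
    calc _ = 1 / 2 * (sg i * (y i * y i)) + ε * kp ε p q / rp p q * ((sg i * sp i) * (y i * y i))
        - ε * kp ε p q / rp p q * vr * ((sg i * pd (bv i) (rp p) q) * y i)
        + ε * vr * (sg i * (pd (bv i) (kp ε p) q * y i))
        + ε * L * ((sg i * pd (bv i) (rp p) q) * y i) := by ring
      _ = _ := by rw [h3, h5]
  rw [hessQ, Finset.mul_sum, Finset.sum_congr rfl fun i _ => hout i, Finset.sum_add_distrib,
    Finset.sum_add_distrib, Finset.sum_sub_distrib, Finset.sum_add_distrib, ← Finset.mul_sum,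
    ← Finset.mul_sum, ← Finset.mul_sum, ← Finset.mul_sum, ← Finset.mul_sum, ← hvr, ← hL]
  ring

/-- Convexification: exponentiating adds a square that vanishes on tangent vectors and, for large τ,
dominates in the normal direction. -/
theorem hessQ_exp {V : Type*} [NormedAddCommGroup V] [NormedSpace ℝ V] {ι : Type*} [Fintype ι]
    {e : ι → V} {s : ι → ℝ} {k : V → ℝ} {q : V} (τ : ℝ) (hk : ContDiffAt ℝ 2 k q) (y : ι → ℝ) :
    hessQ e s (fun x => Real.exp (τ * k x)) q y
      = τ * Real.exp (τ * k q) * (hessQ e s k q y + τ * (∑ i, s i * (pd (e i) k q * y i)) ^ 2) := by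
  set L := ∑ i, s i * (pd (e i) k q * y i) with hL
  have h : ∀ i, s i * y i * ∑ j, s j * (pd (e i) (pd (e j) (fun x => Real.exp (τ * k x))) q * y j)
      = τ * Real.exp (τ * k q) * (s i * y i * ∑ j, s j * (pd (e i) (pd (e j) k) q * y j))
        + τ * Real.exp (τ * k q) * τ * L * (s i * (pd (e i) k q * y i)) := by
    intro i
    have h1 : ∑ j, s j * (pd (e i) (pd (e j) (fun x => Real.exp (τ * k x))) q * y j)
        = τ * Real.exp (τ * k q) * ∑ j, s j * (pd (e i) (pd (e j) k) q * y j)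
          + τ * Real.exp (τ * k q) * τ * pd (e i) k q * L := by
      rw [hL, Finset.mul_sum, Finset.mul_sum, ← Finset.sum_add_distrib]
      refine Finset.sum_congr rfl fun j _ => ?_
      rw [pd_pd_exp_mul _ hk]
      ring
    rw [h1]
    ring
  rw [hessQ, Finset.sum_congr rfl fun i _ => h i, Finset.sum_add_distrib, ← Finset.mul_sum,
    ← Finset.mul_sum, ← hL, hessQ]
  ring

/-- Positivity of the Hessian of `kp`, corrected by a multiple of the metric, on the tangent
spaces of the level sets of `kp`. -/
theorem hessQ_kp_pos {ε δ : ℝ} {p q : ST m n} (hε : 0 < ε) (hq : q ∈ regular ε p)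
    (hf : 0 < fp p q) (hδ : 0 < δ) (hδk : δ < ε * kp ε p q / rp p q) {y : Fin m ⊕ Fin n → ℝ}
    (hy : y ≠ 0) (hL : ∑ i, sg i * (pd (bv i) (kp ε p) q * y i) = 0) :
    0 < hessQ bv sg (kp ε p) q y - (1 / 2 + δ) / (1 - ε * rp p q) * ∑ i, sg i * (y i * y i) := by
  have ha : 0 < 1 - ε * rp p q := by linarith [hq.2]
  have hr : 0 < rp p q := hq.1
  have hk : 0 < kp ε p q := div_pos hf ha
  have hH := hessQ_kp hq y
  rw [hL, mul_zero, add_zero] at hH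
  set vr := ∑ i, pd (bv i) (rp p) q * y i with hvr
  set Yt := ∑ i : Fin m, y (Sum.inl i) ^ 2 with hYt
  set Yx := ∑ j : Fin n, y (Sum.inr j) ^ 2 with hYx
  have hYt0 : 0 ≤ Yt := Finset.sum_nonneg fun i _ => sq_nonneg _
  have hYx0 : 0 ≤ Yx := Finset.sum_nonneg fun i _ => sq_nonneg _
  have hsg : ∑ i, sg i * (y i * y i) = Yx - Yt := by
    simp [Fintype.sum_sum_type, sg, hYt, hYx, sq]
    ring
  have hsp : ∑ i, sp i * (y i * y i) = Yx := by
    simp [Fintype.sum_sum_type, sp, hYx, sq]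
  have hrt : ∀ i : Fin m, pd (bv (n := n) (Sum.inl i)) (rp p) q = 0 := by
    intro i
    have := rp_mul_pd_bv_rp hq (Sum.inl i)
    simpa [sp, hr.ne'] using this
  have hvr' : vr = ∑ j : Fin n, pd (bv (m := m) (Sum.inr j)) (rp p) q * y (Sum.inr j) := by
    rw [hvr, Fintype.sum_sum_type]
    simp [hrt]
  have hr1 : ∑ j : Fin n, pd (bv (m := m) (Sum.inr j)) (rp p) q ^ 2 = 1 := by
    have := sum_pd_rp_sq hq
    rw [Fintype.sum_sum_type] at this
    simpa [hrt] using this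
  have hcs : vr ^ 2 ≤ Yx := by
    have := Finset.sum_mul_sq_le_sq_mul_sq Finset.univ
      (fun j : Fin n => pd (bv (m := m) (Sum.inr j)) (rp p) q) (fun j => y (Sum.inr j))
    rw [hr1, one_mul] at this
    rw [hvr']
    exact this
  set ty := ∑ i : Fin m, (q.1 i - p.1 i) * y (Sum.inl i) with hty
  -- Tangency to the level set of k ties the time part of y to its radial part `vr`. With
  -- Cauchy–Schwarz and |t - t(p)| < r this gives vr² < Yt unless Yt = 0.
  have hrel : ty = -((rp p q + 2 * (ε * kp ε p q)) * vr) := by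
    have h1 : (1 - ε * rp p q) * ∑ i, sg i * (pd (bv i) (kp ε p) q * y i)
        = 1 / 2 * ∑ i, coord i (q - p) * y i + ε * kp ε p q * vr := by
      rw [hvr, Finset.mul_sum, Finset.mul_sum, Finset.mul_sum, ← Finset.sum_add_distrib]
      refine Finset.sum_congr rfl fun i _ => ?_
      have h2 := pd_kp hq (bv i)
      rw [pd_bv_fp] at h2
      calc _ = sg i * y i * ((1 - ε * rp p q) * pd (bv i) (kp ε p) q) := by ring
        _ = (sg i * sg i) / 2 * coord i (q - p) * y i
            + ε * kp ε p q * ((sg i * pd (bv i) (rp p) q) * y i) := by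
          rw [h2]
          ring
        _ = _ := by
          rw [sg_mul_self, sg_mul_pd_rp hq]
          ring
    rw [hL, mul_zero, Fintype.sum_sum_type] at h1
    have h3 : ∑ j : Fin n, coord (Sum.inr j) (q - p) * y (Sum.inr j) = rp p q * vr := by
      rw [hvr', Finset.mul_sum]
      refine Finset.sum_congr rfl fun j _ => ?_
      have := rp_mul_pd_bv_rp hq (Sum.inr j)
      rw [← mul_assoc, this]
      simp [sp]
    have h4 : ∑ i : Fin m, coord (n := n) (Sum.inl i) (q - p) * y (Sum.inl i) = ty := by
      simp [hty]
    rw [h3, h4] at h1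
    linarith
  have hct : ty ^ 2 ≤ ‖q.1 - p.1‖ ^ 2 * Yt := by
    have := Finset.sum_mul_sq_le_sq_mul_sq Finset.univ
      (fun i : Fin m => q.1 i - p.1 i) (fun i => y (Sum.inl i))
    rw [EuclideanSpace.norm_sq_eq]
    simpa [hty, hYt] using this
  have hTr : ‖q.1 - p.1‖ ^ 2 < rp p q ^ 2 := by
    have : fp p q = (rp p q ^ 2 - ‖q.1 - p.1‖ ^ 2) / 4 := rfl
    linarith
  have hrk : rp p q ^ 2 ≤ (rp p q + 2 * (ε * kp ε p q)) ^ 2 :=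
    pow_le_pow_left₀ hr.le (by nlinarith [mul_pos hε hk]) 2
  have hrk0 : 0 < (rp p q + 2 * (ε * kp ε p q)) ^ 2 := lt_of_lt_of_le (by positivity) hrk
  have hvt : (rp p q + 2 * (ε * kp ε p q)) ^ 2 * vr ^ 2 ≤ ‖q.1 - p.1‖ ^ 2 * Yt := by
    rw [hrel] at hct
    linarith
  have hmain : 0 < (1 - ε * rp p q) * (hessQ bv sg (kp ε p) q y
      - (1 / 2 + δ) / (1 - ε * rp p q) * ∑ i, sg i * (y i * y i)) := by
    rw [mul_sub, hH, hsg, hsp]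
    have h1 : (1 - ε * rp p q) * ((1 / 2 + δ) / (1 - ε * rp p q) * (Yx - Yt))
        = (1 / 2 + δ) * (Yx - Yt) := by
      field_simp
    rw [h1]
    -- Trading δ of the angular gain for time directions: the first term is nonnegative by
    -- Cauchy–Schwarz, the second by tangency, and they cannot both vanish for y ≠ 0.
    have h2 : 1 / 2 * (Yx - Yt) + ε * kp ε p q / rp p q * (Yx - vr ^ 2) - (1 / 2 + δ) * (Yx - Yt)
        = (ε * kp ε p q / rp p q - δ) * (Yx - vr ^ 2) + δ * (Yt - vr ^ 2) := by ring
    rw [h2]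
    have h3 : 0 ≤ (ε * kp ε p q / rp p q - δ) * (Yx - vr ^ 2) :=
      mul_nonneg (by linarith) (by linarith)
    rcases hYt0.eq_or_lt with h0 | h0
    · rw [← h0, mul_zero] at hvt
      have hv0 : vr ^ 2 = 0 := by
        have := nonpos_of_mul_nonpos_right hvt hrk0
        exact le_antisymm this (sq_nonneg _)
      have hYxpos : 0 < Yx := by
        refine hYx0.lt_of_ne fun hx => hy ?_
        have ht := (Finset.sum_eq_zero_iff_of_nonneg fun i _ => sq_nonneg _).1 h0.symm
        have hx' := (Finset.sum_eq_zero_iff_of_nonneg fun i _ => sq_nonneg _).1 hx.symm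
        ext i
        rcases i with i | i
        · simpa using ht i (Finset.mem_univ _)
        · simpa using hx' i (Finset.mem_univ _)
      rw [hv0, ← h0]
      have : 0 < (ε * kp ε p q / rp p q - δ) * Yx := mul_pos (by linarith) hYxpos
      linarith
    · have h4 : ‖q.1 - p.1‖ ^ 2 * Yt < (rp p q + 2 * (ε * kp ε p q)) ^ 2 * Yt :=
        mul_lt_mul_of_pos_right (by linarith) h0
      have h5 : vr ^ 2 < Yt := lt_of_mul_lt_mul_left (lt_of_le_of_lt hvt h4) hrk0.le
      have := mul_pos hδ (sub_pos.2 h5)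
      linarith
  exact pos_of_mul_pos_right hmain ha.le

/-- Existence of a Carleman weight, a convex function of `kp`. -/
theorem exists_weight {ε : ℝ} {p : ST m n} {K : Set (ST m n)} (hε : 0 < ε) (hK : IsCompact K)
    (hKr : K ⊆ regular ε p) (hKf : ∀ q ∈ K, 0 < fp p q) :
    ∃ τ > 0, ∃ μ : ST m n → ℝ, ContDiffOn ℝ ∞ μ (regular ε p) ∧
      (∀ q ∈ K, 0 < hessQ bv sg (fun x => Real.exp (τ * kp ε p x)) q
        (fun i => pd (bv i) (fun x => Real.exp (τ * kp ε p x)) q)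
        + μ q * gpair bv sg (fun x => Real.exp (τ * kp ε p x))
          (fun x => Real.exp (τ * kp ε p x)) q) ∧
      ∀ q ∈ K, ∀ y : Fin m ⊕ Fin n → ℝ, y ≠ 0 →
        ∑ i, sg i * (pd (bv i) (fun x => Real.exp (τ * kp ε p x)) q * y i) = 0 →
        0 < hessQ bv sg (fun x => Real.exp (τ * kp ε p x)) q y
          - μ q * ∑ i, sg i * (y i * y i) := by
  have hO := isOpen_regular ε p
  have hkc := contDiffOn_kp ε p
  have hapos : ∀ q ∈ regular ε p, 0 < 1 - ε * rp p q := fun q hq => by linarith [hq.2]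
  have hkpos : ∀ q ∈ K, 0 < kp ε p q := fun q hq => div_pos (hKf q hq) (hapos q (hKr hq))
  have hBpos : ∀ q ∈ K, 0 < gpair bv sg (kp ε p) (kp ε p) q := by
    intro q hq
    have h := gpair_kp (hKr hq)
    have h1 := hKf q hq
    have h2 := hkpos q hq
    have h3 := (hKr hq).1
    have h4 : 0 < (1 - ε * rp p q) ^ 2 * gpair bv sg (kp ε p) (kp ε p) q := by
      rw [h]
      positivity
    exact pos_of_mul_pos_right h4 (sq_nonneg _)
  have hpdk : ∀ v, ContinuousOn (pd v (kp ε p)) K := fun v =>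
    (contDiffOn_pd hO hkc v).continuousOn.mono hKr
  obtain ⟨b, hb, hbK⟩ := exists_pos_le_of_isCompact hK
    (continuousOn_gpair (e := bv) (s := sg) hpdk hpdk) hBpos
  obtain ⟨d, hd, hdK⟩ := exists_pos_le_of_isCompact hK (f := fun q => ε * kp ε p q / rp p q)
    ((continuousOn_const.mul (hkc.continuousOn.mono hKr)).div (continuous_rp p).continuousOn
      fun q hq => (hKr hq).1.ne')
    (fun q hq => div_pos (mul_pos hε (hkpos q hq)) (hKr hq).1)
  obtain ⟨C, hC, hCK⟩ := exists_abs_le_of_isCompact hK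
    (continuousOn_hessQ (e := bv) (s := sg) hO hkc continuousOn_id hKr
      (y := fun q i => pd (bv i) (kp ε p) q) fun i => hpdk _)
  -- Chosen so that τ g(∇k, ∇k)² exceeds the possibly negative Hessian of k on its own gradient,
  -- which is at least -C, while g(∇k, ∇k) ≥ b.
  set τ := (C + 1) / b ^ 2 with hτ
  have hτ0 : 0 < τ := by positivity
  have hd2 : 0 < d / 2 := by positivity
  have hk2 : ∀ q ∈ K, ContDiffAt ℝ 2 (kp ε p) q := fun q hq =>
    (hkc.contDiffAt (hO.mem_nhds (hKr hq))).of_le (by norm_cast)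
  have hpdψ : ∀ q ∈ K, ∀ v, pd v (fun x => Real.exp (τ * kp ε p x)) q
      = τ * Real.exp (τ * kp ε p q) * pd v (kp ε p) q := fun q hq v =>
    pd_exp_mul τ ((hk2 q hq).differentiableAt two_ne_zero)
  -- On tangent vectors the Hessian of exp(τ k) is τ exp(τ k) times that of k, so μ is the
  -- multiplier of `hessQ_kp_pos` scaled by this factor. There δ = d / 2 lies strictly below the
  -- minimum of ε k / r on K.
  refine ⟨τ, hτ0, fun q => τ * Real.exp (τ * kp ε p q) * ((1 / 2 + d / 2) / (1 - ε * rp p q)),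
    ?_, ?_, ?_⟩
  · refine (contDiffOn_const.mul (contDiffOn_const.mul hkc).exp).mul (contDiffOn_const.div
      (contDiffOn_const.sub (contDiffOn_const.mul (contDiffOn_rp ε p))) fun q hq => ?_)
    exact (hapos q hq).ne'
  · intro q hq
    simp only [hpdψ q hq, gpair]
    rw [hessQ_exp τ (hk2 q hq)]
    set Es := τ * Real.exp (τ * kp ε p q) with hEs
    have hEs0 : 0 < Es := by positivity
    have h1 : hessQ bv sg (kp ε p) q (fun i => Es * pd (bv i) (kp ε p) q)
        = Es ^ 2 * hessQ bv sg (kp ε p) q (fun i => pd (bv i) (kp ε p) q) := by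
      simp only [hessQ, Finset.mul_sum]
      exact Finset.sum_congr rfl fun i _ => Finset.sum_congr rfl fun j _ => by ring
    have h2 : ∑ i, sg i * (pd (bv i) (kp ε p) q * (Es * pd (bv i) (kp ε p) q))
        = Es * gpair bv sg (kp ε p) (kp ε p) q := by
      simp only [gpair, Finset.mul_sum]
      exact Finset.sum_congr rfl fun i _ => by ring
    have h3 : ∑ i, sg i * (Es * pd (bv i) (kp ε p) q * (Es * pd (bv i) (kp ε p) q))
        = Es ^ 2 * gpair bv sg (kp ε p) (kp ε p) q := by
      simp only [gpair, Finset.mul_sum]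
      exact Finset.sum_congr rfl fun i _ => by ring
    rw [h1, h2, h3]
    set B := gpair bv sg (kp ε p) (kp ε p) q with hB
    set H := hessQ bv sg (kp ε p) q (fun i => pd (bv i) (kp ε p) q) with hH
    have hHC : -C ≤ H := (abs_le.1 (hCK q hq)).1
    have hBb : b ≤ B := hbK q hq
    have hτB : C + 1 ≤ τ * B ^ 2 := by
      rw [hτ, div_mul_eq_mul_div, le_div_iff₀ (by positivity)]
      exact mul_le_mul_of_nonneg_left (pow_le_pow_left₀ hb.le hBb 2) (by linarith)
    have hma : 0 < (1 / 2 + d / 2) / (1 - ε * rp p q) :=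
      div_pos (by linarith) (hapos q (hKr hq))
    have hB0 : 0 < B := lt_of_lt_of_le hb hBb
    have h4 : 0 < H + τ * B ^ 2 + (1 / 2 + d / 2) / (1 - ε * rp p q) * B := by
      have := mul_pos hma hB0
      linarith
    calc 0 < Es ^ 3 * (H + τ * B ^ 2 + (1 / 2 + d / 2) / (1 - ε * rp p q) * B) := by positivity
      _ = _ := by ring
  · intro q hq y hy hL
    have hEs0 : 0 < τ * Real.exp (τ * kp ε p q) := by positivity
    simp only [hpdψ q hq] at hL
    have hL' : ∑ i, sg i * (pd (bv i) (kp ε p) q * y i) = 0 := by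
      apply (mul_eq_zero.1 _).resolve_left hEs0.ne'
      rw [Finset.mul_sum, ← hL]
      exact Finset.sum_congr rfl fun i _ => by ring
    have hpos := hessQ_kp_pos hε (hKr hq) (hKf q hq) hd2
      (lt_of_lt_of_le (by linarith) (hdK q hq)) hy hL'
    rw [hessQ_exp τ (hk2 q hq), hL']
    have := mul_pos hEs0 hpos
    linarith

end Pseudoconvexity

/-! ### The operator □ in coordinates -/

section Box

variable {m n : ℕ}

theorem laplacian_eq_sum_pd {k : ℕ} {g : E k → ℝ} {x : E k} (hg : ContDiffAt ℝ 2 g x) :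
    Laplacian.laplacian g x
      = ∑ i, pd (EuclideanSpace.single i 1) (pd (EuclideanSpace.single i 1) g) x := by
  rw [InnerProductSpace.laplacian_eq_iteratedFDeriv_orthonormalBasis g
    (EuclideanSpace.basisFun (Fin k) ℝ)]
  refine Finset.sum_congr rfl fun i _ => ?_
  rw [iteratedFDeriv_two_apply, pd_pd_eq_fderiv_fderiv hg]
  simp

/-- Differentiation along a slice. -/
theorem pd_comp_affine {F V : Type*} [NormedAddCommGroup F] [NormedSpace ℝ F]
    [NormedAddCommGroup V] [NormedSpace ℝ V] {A : F →L[ℝ] V} {h : F → V} {x : F} {a : V → ℝ}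
    (hh : HasFDerivAt h A x) (ha : DifferentiableAt ℝ a (h x)) (v : F) :
    pd v (fun t => a (h t)) x = pd (A v) a (h x) := by
  have := (ha.hasFDerivAt.comp x hh).fderiv
  simp only [Function.comp_def] at this
  rw [pd, this]
  rfl

/-- The derivative of h is the constant A, so the chain rule for second derivatives has no term from
the second derivative of h. -/
theorem pd_pd_comp_affine {F V : Type*} [NormedAddCommGroup F] [NormedSpace ℝ F]
    [NormedAddCommGroup V] [NormedSpace ℝ V] {A : F →L[ℝ] V} {h : F → V} {x : F} {a : V → ℝ}
    (hh : ∀ x, HasFDerivAt h A x) (ha : ContDiffAt ℝ 2 a (h x)) (v : F) :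
    pd v (pd v (fun t => a (h t))) x = pd (A v) (pd (A v) a) (h x) := by
  have h1 : pd v (fun t => a (h t)) =ᶠ[𝓝 x] fun t => pd (A v) a (h t) := by
    filter_upwards [(hh x).continuousAt.eventually (ha.eventually (by simp))] with y hy
    exact pd_comp_affine (hh y) (hy.differentiableAt two_ne_zero) v
  rw [pd_congr h1, pd_comp_affine (hh x) (differentiableAt_pd ha)]

theorem box_eq_waveOp {z : ST m n → ℝ} {q : ST m n} (hz : ContDiffAt ℝ 2 z q) :
    box z q = waveOp bv sg z q := by
  have ht : ∀ t, HasFDerivAt (fun t : E m => (t, q.2)) (ContinuousLinearMap.inl ℝ (E m) (E n)) t :=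
    fun t => hasFDerivAt_prodMk_left t q.2
  have hx : ∀ x, HasFDerivAt (fun x : E n => (q.1, x)) (ContinuousLinearMap.inr ℝ (E m) (E n)) x :=
    fun x => hasFDerivAt_prodMk_right q.1 x
  have h1 : ContDiffAt ℝ 2 (fun t : E m => z (t, q.2)) q.1 :=
    ContDiffAt.comp q.1 (g := z) hz (contDiffAt_id.prodMk contDiffAt_const)
  have h2 : ContDiffAt ℝ 2 (fun x : E n => z (q.1, x)) q.2 :=
    ContDiffAt.comp q.2 (g := z) hz (contDiffAt_const.prodMk contDiffAt_id)
  rw [box, laplacian_eq_sum_pd h1, laplacian_eq_sum_pd h2, waveOp, Fintype.sum_sum_type,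
    ← Finset.sum_neg_distrib]
  congr 1
  · refine Finset.sum_congr rfl fun i _ => ?_
    rw [pd_pd_comp_affine ht hz]
    simp [sg, bv]
  · refine Finset.sum_congr rfl fun i _ => ?_
    rw [pd_pd_comp_affine hx hz]
    simp [sg, bv]

theorem sum_coord_smul_bv (v : ST m n) : ∑ i, coord i v • bv i = v := by
  rw [Fintype.sum_sum_type]
  refine Prod.ext ?_ ?_
  · ext i
    simp [bv, Prod.fst_sum, Pi.single_apply]
  · ext i
    simp [bv, Prod.snd_sum, Pi.single_apply]

theorem pd_eq_sum (v : ST m n) (a : ST m n → ℝ) (q : ST m n) :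
    pd v a q = ∑ i, coord i v * pd (bv i) a q := by
  conv_lhs => rw [pd, ← sum_coord_smul_bv v, map_sum]
  simp [pd]

end Box

/-! ### Traces at the lateral boundary and the sign of the flux -/

section Boundary

variable {m n : ℕ} {T : ℝ} {Ω : Set (E n)}

theorem isOpen_cube (m : ℕ) (T : ℝ) : IsOpen (cube m T) := by
  have : cube m T = ⋂ i : Fin m, {t : E m | -T < t i ∧ t i < T} := by
    ext t
    simp [cube]
  rw [this]
  refine isOpen_iInter_of_finite fun i => ?_
  have hc : Continuous fun t : E m => t i := by fun_prop
  exact (isOpen_lt continuous_const hc).inter (isOpen_lt hc continuous_const)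

theorem isOpen_cyl (m : ℕ) (T : ℝ) (hΩ : IsOpen Ω) : IsOpen (cyl m T Ω) := (isOpen_cube m T).prod hΩ

/-- The derivative of a function that is `C¹` up to the lateral boundary has limits there. -/
theorem exists_tendsto_fderiv {z : ST m n → ℝ} (hΩ : IsOpen Ω)
    (hz : ContDiffOn ℝ 1 z (cube m T ×ˢ closure Ω)) {q : ST m n} (hq : q ∈ cube m T ×ˢ closure Ω) :
    ∃ L : ST m n →L[ℝ] ℝ, HasFDerivWithinAt z L (cube m T ×ˢ closure Ω) q ∧
      Tendsto (fderiv ℝ z) (𝓝[cyl m T Ω] q) (𝓝 L) := by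
  have h := hz q hq
  -- Being C¹ within the set supplies a family of derivatives continuous at q; at interior points
  -- these coincide with `fderiv`.
  rw [← zero_add (1 : WithTop ℕ∞), contDiffWithinAt_succ_iff_hasFDerivWithinAt' (by simp)] at h
  obtain ⟨u, hu, -, -, f', hf', hcont⟩ := h
  rw [insert_eq_of_mem hq] at hu
  have hsub : cyl m T Ω ⊆ cube m T ×ˢ closure Ω := prod_mono_right subset_closure
  refine ⟨f' q, hf' q (mem_of_mem_nhdsWithin hq hu), ?_⟩
  have h1 : Tendsto f' (𝓝[cyl m T Ω] q) (𝓝 (f' q)) :=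
    hcont.continuousWithinAt.mono hsub
  refine h1.congr' ?_
  have hu' : u ∈ 𝓝[cyl m T Ω] q := nhdsWithin_mono _ hsub hu
  filter_upwards [hu', self_mem_nhdsWithin] with x hx hxU
  have h2 : cube m T ×ˢ closure Ω ∈ 𝓝 x :=
    mem_of_superset ((isOpen_cyl m T hΩ).mem_nhds hxU) hsub
  exact (((hf' x hx).hasFDerivAt h2).fderiv).symm

theorem IsDefiningAt.apply_eq_zero {φ : E n → ℝ} {y : E n} (hΩ : IsOpen Ω) (hy : y ∈ frontier Ω)
    (hφ : IsDefiningAt Ω y φ) : φ y = 0 := by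
  obtain ⟨⟨N, hN, hcd, hiff⟩, -⟩ := hφ
  have hyN := mem_of_mem_nhds hN
  have hyΩ : y ∉ Ω := by
    rw [hΩ.frontier_eq] at hy
    exact hy.2
  refine le_antisymm ?_ (not_lt.1 fun h => hyΩ ((hiff y hyN).2 h))
  by_contra hpos
  push Not at hpos
  have hc : ContinuousAt φ y := (hcd.contDiffAt hN).continuousAt
  obtain ⟨x, ⟨hx1, hx2⟩, hxΩ⟩ := mem_closure_iff_nhds.1 (frontier_subset_closure hy) _
    (inter_mem hN (hc.eventually_const_lt hpos))
  exact absurd ((hiff x hx1).1 hxΩ) (not_lt.2 (le_of_lt hx2))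

/-- If S missed the frontier, A and the complement of its closure would disconnect S. This produces
boundary points of Ω on segments without the implicit function theorem. -/
theorem inter_frontier_nonempty_of_isPreconnected {X : Type*} [TopologicalSpace X] {S A : Set X}
    (hS : IsPreconnected S) (hA : IsOpen A) (h1 : (S ∩ A).Nonempty) (h2 : (S ∩ Aᶜ).Nonempty) :
    (S ∩ frontier A).Nonempty := by
  by_contra hne
  rw [not_nonempty_iff_eq_empty] at hne
  have hfr : ∀ x ∈ S, x ∉ A → x ∉ closure A := fun x hx hxA hcl => by
    have : x ∈ S ∩ frontier A := ⟨hx, by rw [hA.frontier_eq]; exact ⟨hcl, hxA⟩⟩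
    rw [hne] at this
    exact this
  obtain ⟨x, hx, hxA⟩ := h2
  obtain ⟨y, -, hyA, hyc⟩ := hS A (closure A)ᶜ hA isClosed_closure.isOpen_compl
    (fun y hy => by
      by_cases h : y ∈ A
      · exact Or.inl h
      · exact Or.inr (hfr y hy h)) h1 ⟨x, hx, hfr x hx hxA⟩
  exact hyc (subset_closure hyA)

/-- A function vanishing on the lateral boundary has no tangential derivative there. -/
theorem fderivWithin_tangential_eq_zero {z : ST m n → ℝ} (hΩ : IsOpen Ω) {q : ST m n}
    (hq : q ∈ lateral m T Ω) (hz0 : ∀ x ∈ lateral m T Ω, z x = 0) {L : ST m n →L[ℝ] ℝ}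
    (hL : HasFDerivWithinAt z L (cube m T ×ˢ closure Ω) q) {φ : E n → ℝ}
    (hφ : IsDefiningAt Ω q.2 φ) {e₂ : E n} (he : fderiv ℝ φ q.2 e₂ = 1) {v : ST m n}
    (hv : fderiv ℝ φ q.2 v.2 = 0) : L v = 0 := by
  have hφ0 := hφ.apply_eq_zero hΩ hq.2
  obtain ⟨⟨N, hN, hcd, hiff⟩, -⟩ := hφ
  have hφd : HasFDerivAt φ (fderiv ℝ φ q.2) q.2 :=
    ((hcd.contDiffAt hN).differentiableAt (by simp)).hasFDerivAt
  set e : ST m n := (0, e₂) with hedef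
  -- For small s, φ at q + s(v ± η e) is ± sη up to an error sη/2, so the two points lie on opposite
  -- sides of the boundary. Between them is a boundary point q + s(v + r e) with |r| ≤ η. There z =
  -- 0, so L(v + r e) is small; letting η → 0 gives L v = 0.
  have key : ∀ η > 0, |L v| ≤ η * (|L e| + ‖v‖ + η * ‖e‖) := by
    intro η hη
    have hline : ∀ w : E n, ∀ᶠ s : ℝ in 𝓝[>] 0,
        |φ (q.2 + s • w) - s * fderiv ℝ φ q.2 w| ≤ s * (η / 2) := by
      intro w
      have hd : HasDerivAt (fun s : ℝ => φ (q.2 + s • w)) (fderiv ℝ φ q.2 w) 0 := by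
        have h1 : HasDerivAt (fun s : ℝ => q.2 + s • w) w 0 := by
          simpa using ((hasDerivAt_id (0 : ℝ)).smul_const w).const_add q.2
        have h2 : HasFDerivAt φ (fderiv ℝ φ q.2) (q.2 + (0 : ℝ) • w) := by simpa using hφd
        exact h2.comp_hasDerivAt (0 : ℝ) h1
      have h3 := hd.isLittleO
      rw [Asymptotics.isLittleO_iff] at h3
      have h4 := h3 (half_pos hη)
      filter_upwards [nhdsWithin_le_nhds h4, self_mem_nhdsWithin] with s hs hs0
      simp only [zero_smul, add_zero, hφ0, sub_zero, smul_eq_mul, Real.norm_eq_abs] at hs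
      rw [abs_of_pos (a := s) hs0] at hs
      linarith
    have hcont : ∀ w : E n, Tendsto (fun s : ℝ => q.2 + s • w) (𝓝[>] 0) (𝓝 q.2) := by
      intro w
      have : Continuous fun s : ℝ => q.2 + s • w := by fun_prop
      have h1 := this.tendsto 0
      simp only [zero_smul, add_zero] at h1
      exact h1.mono_left nhdsWithin_le_nhds
    have hcube : ∀ᶠ s : ℝ in 𝓝[>] 0, q.1 + s • v.1 ∈ cube m T := by
      have : Continuous fun s : ℝ => q.1 + s • v.1 := by fun_prop
      have h1 := this.tendsto 0
      simp only [zero_smul, add_zero] at h1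
      exact (h1.mono_left nhdsWithin_le_nhds).eventually ((isOpen_cube m T).mem_nhds hq.1)
    have hLo := hL.isLittleO
    rw [Asymptotics.isLittleO_iff] at hLo
    have hLη := hLo hη
    rw [eventually_nhdsWithin_iff, Metric.eventually_nhds_iff] at hLη
    obtain ⟨ρ, hρ, hball⟩ := hLη
    have hsmall : ∀ᶠ s : ℝ in 𝓝[>] 0, s * (‖v‖ + η * ‖e‖) < ρ := by
      have : Continuous fun s : ℝ => s * (‖v‖ + η * ‖e‖) := by fun_prop
      have h1 := this.tendsto 0
      simp only [zero_mul] at h1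
      exact (h1.mono_left nhdsWithin_le_nhds).eventually (gt_mem_nhds hρ)
    obtain ⟨s, hs1, hs2, hs3, hs4, hs5, hs6, hs0⟩ :=
      ((hline (v.2 + η • e₂)).and ((hline (v.2 - η • e₂)).and
        (((hcont (v.2 + η • e₂)).eventually hN).and (((hcont (v.2 - η • e₂)).eventually hN).and
          (hcube.and (hsmall.and self_mem_nhdsWithin)))))).exists
    have hs0' : 0 < s := hs0
    simp only [map_add, map_sub, map_smul, hv, he, smul_eq_mul, mul_one, zero_add, zero_sub]
      at hs1 hs2
    have hplus : q.2 + s • (v.2 + η • e₂) ∉ Ω := by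
      intro h
      have h1 := (hiff _ hs3).1 h
      have h2 := (abs_le.1 hs1).1
      nlinarith [mul_pos hs0' hη]
    have hminus : q.2 + s • (v.2 - η • e₂) ∈ Ω := by
      rw [hiff _ hs4]
      have h2 := (abs_le.1 hs2).2
      nlinarith [mul_pos hs0' hη]
    -- a boundary point on the segment between the two
    have hconn : IsPreconnected ((fun r : ℝ => q.2 + s • (v.2 + r • e₂)) '' Icc (-η) η) :=
      isPreconnected_Icc.image _ (by fun_prop)
    obtain ⟨y, ⟨r, hr, rfl⟩, hyf⟩ := inter_frontier_nonempty_of_isPreconnected hconn hΩ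
      ⟨_, ⟨-η, ⟨le_rfl, by linarith⟩, rfl⟩, by simpa [sub_eq_add_neg] using hminus⟩
      ⟨_, ⟨η, ⟨by linarith, le_rfl⟩, rfl⟩, hplus⟩
    have hrη : |r| ≤ η := abs_le.2 hr
    set x : ST m n := (q.1 + s • v.1, q.2 + s • (v.2 + r • e₂)) with hx
    have hxq : x - q = s • (v + r • e) := by
      refine Prod.ext ?_ ?_
      · simp [hx, hedef]
      · simp [hx, hedef]
    have hnorm : ‖x - q‖ ≤ s * (‖v‖ + η * ‖e‖) := by
      rw [hxq, norm_smul, Real.norm_of_nonneg hs0'.le]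
      refine mul_le_mul_of_nonneg_left ((norm_add_le _ _).trans ?_) hs0'.le
      rw [norm_smul, Real.norm_eq_abs]
      gcongr
    have hxlat : x ∈ lateral m T Ω := ⟨hs5, hyf⟩
    have h1 := hball (y := x) (by rw [dist_eq_norm]; exact lt_of_le_of_lt hnorm hs6)
      ⟨hs5, frontier_subset_closure hyf⟩
    rw [hz0 x hxlat, hz0 q hq, sub_zero, zero_sub, norm_neg, Real.norm_eq_abs] at h1
    have h2 : |L (x - q)| ≤ η * (s * (‖v‖ + η * ‖e‖)) :=
      h1.trans (mul_le_mul_of_nonneg_left hnorm hη.le)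
    rw [hxq, map_smul, smul_eq_mul, abs_mul, abs_of_pos hs0', map_add, map_smul, smul_eq_mul] at h2
    have h3 : |L v + r * L e| ≤ η * (‖v‖ + η * ‖e‖) := by
      have : s * |L v + r * L e| ≤ s * (η * (‖v‖ + η * ‖e‖)) := by linarith
      exact le_of_mul_le_mul_left this hs0'
    have h4 : |L v| ≤ |L v + r * L e| + |r| * |L e| := by
      rw [← abs_mul]
      have := abs_sub (L v + r * L e) (r * L e)
      simpa using this
    have h5 : |r| * |L e| ≤ η * |L e| := mul_le_mul_of_nonneg_right hrη (abs_nonneg _)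
    linarith
  have hlim : Tendsto (fun η : ℝ => η * (|L e| + ‖v‖ + η * ‖e‖)) (𝓝[>] 0) (𝓝 0) := by
    have : Continuous fun η : ℝ => η * (|L e| + ‖v‖ + η * ‖e‖) := by fun_prop
    have h1 := this.tendsto 0
    simp only [zero_mul] at h1
    exact h1.mono_left nhdsWithin_le_nhds
  have h0 : |L v| ≤ 0 := ge_of_tendsto hlim (by
    filter_upwards [self_mem_nhdsWithin] with η hη using key η hη)
  exact abs_eq_zero.1 (le_antisymm h0 (abs_nonneg _))

/-- The limiting flux of the current of a function vanishing at the boundary. -/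
theorem eventually_flux_le {ψ κ w φ : ST m n → ℝ} {q : ST m n} {l : Filter (ST m n)}
    (hl : l ≤ 𝓝 q) (hψ : ContDiffAt ℝ ∞ ψ q) (hκ : ContDiffAt ℝ ∞ κ q) (hφ : ContDiffAt ℝ ∞ φ q)
    (lam wn : ℝ) (hw : Tendsto w l (𝓝 0))
    (hdw : ∀ i, Tendsto (pd (bv i) w) l (𝓝 (wn * pd (bv i) φ q)))
    (hsp : ∀ i, sg i * pd (bv i) φ q = pd (bv i) φ q)
    (hsign : ∑ i, pd (bv i) ψ q * pd (bv i) φ q ≤ 0) {η : ℝ} (hη : 0 < η) :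
    ∀ᶠ x in l, ∑ i, fderiv ℝ φ x (bv i) * current bv sg ψ κ lam w i x ≤ η := by
  have hpd : ∀ {a : ST m n → ℝ}, ContDiffAt ℝ ∞ a q → ∀ v, Tendsto (pd v a) l (𝓝 (pd v a q)) :=
    fun ha v => ((contDiffAt_pd (n := ∞) ha).continuousAt.tendsto).mono_left hl
  have hψt := hpd hψ
  have hκt := hpd hκ
  have hφt := hpd hφ
  have hκ0 : Tendsto κ l (𝓝 (κ q)) := hκ.continuousAt.tendsto.mono_left hl
  set d : Fin m ⊕ Fin n → ℝ := fun i => pd (bv i) φ q with hd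
  have hg1 : Tendsto (gpair bv sg ψ w) l (𝓝 (∑ i, sg i * (pd (bv i) ψ q * (wn * d i)))) :=
    tendsto_finsetSum _ fun i _ => tendsto_const_nhds.mul ((hψt _).mul (hdw i))
  have hg2 : Tendsto (gpair bv sg w w) l (𝓝 (∑ i, sg i * ((wn * d i) * (wn * d i)))) :=
    tendsto_finsetSum _ fun i _ => tendsto_const_nhds.mul ((hdw i).mul (hdw i))
  have hg3 : Tendsto (gpair bv sg ψ ψ) l (𝓝 (gpair bv sg ψ ψ q)) :=
    tendsto_finsetSum _ fun i _ => tendsto_const_nhds.mul ((hψt _).mul (hψt _))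
  -- Terms with an undifferentiated w drop out in the limit. What remains has flux wn² P D - wn² D P
  -- / 2 = wn² D P / 2, with D = |∇φ|² and P the pairing of ∇ψ with ∇φ, so its sign is that of P.
  have hJ : ∀ i, Tendsto (current bv sg ψ κ lam w i) l (𝓝 (sg i *
      ((wn * d i) * (∑ i, sg i * (pd (bv i) ψ q * (wn * d i)))
        - pd (bv i) ψ q * (∑ i, sg i * ((wn * d i) * (wn * d i))) / 2
        + κ q * (0 * (wn * d i)) - pd (bv i) κ q * (0 * 0) / 2
        + lam ^ 2 / 2 * (gpair bv sg ψ ψ q * (pd (bv i) ψ q * (0 * 0)))))) := fun i =>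
    tendsto_const_nhds.mul ((((((hdw i).mul hg1).sub (((hψt _).mul hg2).div_const 2)).add
      (hκ0.mul (hw.mul (hdw i)))).sub (((hκt _).mul (hw.mul hw)).div_const 2)).add
      (tendsto_const_nhds.mul (hg3.mul ((hψt _).mul (hw.mul hw)))))
  have hsum : Tendsto (fun x => ∑ i, fderiv ℝ φ x (bv i) * current bv sg ψ κ lam w i x) l _ :=
    tendsto_finsetSum _ fun i _ => (hφt (bv i)).mul (hJ i)
  refine hsum.eventually_le_const (lt_of_le_of_lt ?_ hη)
  have h1 : ∑ i, sg i * (pd (bv i) ψ q * (wn * d i)) = wn * ∑ i, pd (bv i) ψ q * d i := by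
    rw [Finset.mul_sum]
    refine Finset.sum_congr rfl fun i _ => ?_
    have := hsp i
    calc _ = pd (bv i) ψ q * wn * (sg i * d i) := by ring
      _ = _ := by rw [hd]; simp only; rw [this]; ring
  have h2 : ∑ i, sg i * ((wn * d i) * (wn * d i)) = wn ^ 2 * ∑ i, d i ^ 2 := by
    rw [Finset.mul_sum]
    refine Finset.sum_congr rfl fun i _ => ?_
    have := hsp i
    calc _ = wn ^ 2 * d i * (sg i * d i) := by ring
      _ = _ := by rw [hd]; simp only; rw [this]; ring
  rw [h1, h2]
  set P := ∑ i, pd (bv i) ψ q * d i with hP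
  set D := ∑ i, d i ^ 2 with hD
  have hD0 : 0 ≤ D := Finset.sum_nonneg fun i _ => sq_nonneg _
  have h3 : ∑ i, pd (bv i) φ q * (sg i * ((wn * d i) * (wn * P)
        - pd (bv i) ψ q * (wn ^ 2 * D) / 2
        + κ q * (0 * (wn * d i)) - pd (bv i) κ q * (0 * 0) / 2
        + lam ^ 2 / 2 * (gpair bv sg ψ ψ q * (pd (bv i) ψ q * (0 * 0)))))
      = wn ^ 2 * P * D - wn ^ 2 * D / 2 * P := by
    have h4 : wn ^ 2 * P * D - wn ^ 2 * D / 2 * P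
        = ∑ i, (wn ^ 2 * P * d i ^ 2 - wn ^ 2 * D / 2 * (pd (bv i) ψ q * d i)) := by
      rw [Finset.sum_sub_distrib, ← Finset.mul_sum, ← Finset.mul_sum]
    rw [h4]
    refine Finset.sum_congr rfl fun i _ => ?_
    have := hsp i
    calc _ = (sg i * pd (bv i) φ q) * ((wn * d i) * (wn * P) - pd (bv i) ψ q * (wn ^ 2 * D) / 2) := by
          ring
      _ = _ := by rw [this]; simp only [hd]; ring
  rw [h3]
  have h4 : wn ^ 2 * P * D - wn ^ 2 * D / 2 * P = (wn ^ 2 * D / 2) * P := by ring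
  rw [h4]
  exact mul_nonpos_of_nonneg_of_nonpos (by positivity) hsign

end Boundary

/-! ### Bounds for the current and its divergence -/

section Bounded

/-- `f` is bounded on `A`. -/
def BddOn {X : Type*} (f : X → ℝ) (A : Set X) : Prop := ∃ C, ∀ x ∈ A, |f x| ≤ C

variable {X : Type*} {f g : X → ℝ} {A : Set X}

theorem BddOn.const (c : ℝ) : BddOn (fun _ : X => c) A := ⟨|c|, fun _ _ => le_rfl⟩

theorem BddOn.add (hf : BddOn f A) (hg : BddOn g A) : BddOn (fun x => f x + g x) A := by
  obtain ⟨C, hC⟩ := hf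
  obtain ⟨D, hD⟩ := hg
  exact ⟨C + D, fun x hx => (abs_add_le _ _).trans (add_le_add (hC x hx) (hD x hx))⟩

theorem BddOn.mul (hf : BddOn f A) (hg : BddOn g A) : BddOn (fun x => f x * g x) A := by
  obtain ⟨C, hC⟩ := hf
  obtain ⟨D, hD⟩ := hg
  refine ⟨C * D, fun x hx => ?_⟩
  rw [abs_mul]
  exact mul_le_mul (hC x hx) (hD x hx) (abs_nonneg _) ((abs_nonneg _).trans (hC x hx))

theorem BddOn.const_mul (c : ℝ) (hf : BddOn f A) : BddOn (fun x => c * f x) A :=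
  (BddOn.const c).mul hf

theorem BddOn.sub (hf : BddOn f A) (hg : BddOn g A) : BddOn (fun x => f x - g x) A := by
  simpa [sub_eq_add_neg] using hf.add (hg.const_mul (-1))

theorem BddOn.half (hf : BddOn f A) : BddOn (fun x => f x / 2) A := by
  simpa [div_eq_inv_mul] using hf.const_mul (2⁻¹)

theorem BddOn.sq (hf : BddOn f A) : BddOn (fun x => f x ^ 2) A := by
  simpa [pow_two] using hf.mul hf

theorem BddOn.sum {ι : Type*} (s : Finset ι) {F : ι → X → ℝ} (hF : ∀ i, BddOn (F i) A) :
    BddOn (fun x => ∑ i ∈ s, F i x) A := by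
  choose C hC using hF
  exact ⟨∑ i ∈ s, C i, fun x hx => (Finset.abs_sum_le_sum_abs _ _).trans
    (Finset.sum_le_sum fun i _ => hC i x hx)⟩

theorem BddOn.congr (hf : BddOn f A) (h : ∀ x ∈ A, g x = f x) : BddOn g A := by
  obtain ⟨C, hC⟩ := hf
  exact ⟨C, fun x hx => by rw [h x hx]; exact hC x hx⟩

theorem BddOn.of_continuousOn [TopologicalSpace X] {K : Set X} (hK : IsCompact K)
    (hf : ContinuousOn f K) (hA : A ⊆ K) : BddOn f A := by
  obtain ⟨C, -, hC⟩ := exists_abs_le_of_isCompact hK hf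
  exact ⟨C, fun x hx => hC x (hA hx)⟩

variable {V : Type*} [NormedAddCommGroup V] [NormedSpace ℝ V] {ι : Type*} [Fintype ι]
  {e : ι → V} {s : ι → ℝ} {S : Set V}

theorem bddOn_gpair {a b : V → ℝ} (ha : ∀ i, BddOn (pd (e i) a) S)
    (hb : ∀ i, BddOn (pd (e i) b) S) : BddOn (gpair e s a b) S :=
  BddOn.sum _ fun i => ((ha i).mul (hb i)).const_mul _

theorem bddOn_current {ψ κ w : V → ℝ} (hψ : ∀ i, BddOn (pd (e i) ψ) S) (hκ : BddOn κ S)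
    (hκ' : ∀ i, BddOn (pd (e i) κ) S) (hw : BddOn w S) (hw' : ∀ i, BddOn (pd (e i) w) S)
    (lam : ℝ) (i : ι) : BddOn (current e s ψ κ lam w i) S :=
  BddOn.const_mul _ ((((((hw' i).mul (bddOn_gpair hψ hw')).sub
    ((hψ i).mul (bddOn_gpair hw' hw')).half).add (hκ.mul (hw.mul (hw' i)))).sub
      ((hκ' i).mul (hw.mul hw)).half).add
      (((bddOn_gpair hψ hψ).mul ((hψ i).mul (hw.mul hw))).const_mul _))

theorem bddOn_hessQ {ψ : V → ℝ} {y : ι → V → ℝ}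
    (hψ : ∀ i j, BddOn (pd (e i) (pd (e j) ψ)) S) (hy : ∀ i, BddOn (y i) S) :
    BddOn (fun q => hessQ e s ψ q (fun i => y i q)) S :=
  BddOn.sum _ fun i => ((hy i).const_mul _).mul
    (BddOn.sum _ fun j => ((hψ i j).mul (hy j)).const_mul _)

theorem bddOn_waveOp {ψ : V → ℝ} (hψ : ∀ i j, BddOn (pd (e i) (pd (e j) ψ)) S) :
    BddOn (waveOp e s ψ) S :=
  BddOn.sum _ fun i => (hψ i i).const_mul _

/-- By `divg_current` the only second-order information on w that enters is □w. It is therefore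
enough to bound w, its gradient and □w, although individual second derivatives may blow up at the
boundary. -/
theorem bddOn_divg_current {ψ κ w : V → ℝ} (hψ : ∀ i, BddOn (pd (e i) ψ) S)
    (hψ' : ∀ i j, BddOn (pd (e i) (pd (e j) ψ)) S) (hκ : BddOn κ S)
    (hκ' : ∀ i j, BddOn (pd (e i) (pd (e j) κ)) S)
    (hw : BddOn w S) (hw' : ∀ i, BddOn (pd (e i) w) S) (hw'' : BddOn (waveOp e s w) S)
    (hψc : ∀ q ∈ S, ContDiffAt ℝ 2 ψ q) (hκc : ∀ q ∈ S, ContDiffAt ℝ 2 κ q)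
    (hwc : ∀ q ∈ S, ContDiffAt ℝ 2 w q) (lam : ℝ) :
    BddOn (divg e (current e s ψ κ lam w)) S := by
  refine BddOn.congr ?_ fun q hq => divg_current lam (hψc q hq) (hκc q hq) (hwc q hq)
  have hμ : BddOn (fun q => waveOp e s ψ q / 2 - κ q) S := (bddOn_waveOp hψ').half.sub hκ
  have hg := bddOn_gpair (s := s) hψ hψ
  exact ((((((hw''.add ((hg.const_mul _).mul hw)).mul ((bddOn_gpair hψ hw').add (hκ.mul hw))).add
    (bddOn_hessQ hψ' hw')).sub (hμ.mul (bddOn_gpair hw' hw'))).sub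
      ((bddOn_waveOp hκ').half.mul hw.sq)).add
      ((((bddOn_hessQ hψ' hψ).add (hμ.mul hg)).const_mul _).mul hw.sq))

theorem contDiffOn_current {ψ κ w : V → ℝ} (hS : IsOpen S) (hψ : ContDiffOn ℝ ∞ ψ S)
    (hκ : ContDiffOn ℝ ∞ κ S) (hw : ContDiffOn ℝ 2 w S) (lam : ℝ) (i : ι) :
    ContDiffOn ℝ 1 (current e s ψ κ lam w i) S := by
  have hψ' : ∀ v, ContDiffOn ℝ 1 (pd v ψ) S := fun v => (contDiffOn_pd hS hψ v).of_le (by norm_cast)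
  have hκ' : ∀ v, ContDiffOn ℝ 1 (pd v κ) S := fun v => (contDiffOn_pd hS hκ v).of_le (by norm_cast)
  have hw' : ∀ v, ContDiffOn ℝ 1 (pd v w) S := fun v x hx =>
    (contDiffAt_pd (n := 1) (hw.contDiffAt (hS.mem_nhds hx))).contDiffWithinAt
  have hw1 : ContDiffOn ℝ 1 w S := hw.of_le (by norm_num)
  have hκ1 : ContDiffOn ℝ 1 κ S := hκ.of_le (by norm_cast)
  have hg : ∀ {a b : V → ℝ}, (∀ v, ContDiffOn ℝ 1 (pd v a) S) → (∀ v, ContDiffOn ℝ 1 (pd v b) S) →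
      ContDiffOn ℝ 1 (gpair e s a b) S := fun ha hb =>
    ContDiffOn.sum fun i _ => contDiffOn_const.mul ((ha _).mul (hb _))
  exact contDiffOn_const.mul ((((((hw' _).mul (hg hψ' hw')).sub
    (((hψ' _).mul (hg hw' hw')).div_const 2)).add (hκ1.mul (hw1.mul (hw' _)))).sub
      (((hκ' _).mul (hw1.mul hw1)).div_const 2)).add
      (contDiffOn_const.mul ((hg hψ' hψ').mul ((hψ' _).mul (hw1.mul hw1)))))

theorem current_eq_zero {ψ κ w : V → ℝ} {q : V} (hw : w =ᶠ[𝓝 q] fun _ => 0) (lam : ℝ) (i : ι) :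
    current e s ψ κ lam w i q = 0 := by
  have h0 : w q = 0 := hw.eq_of_nhds
  have h1 : ∀ v, pd v w q = 0 := fun v => by rw [pd_congr hw]; simp [pd]
  simp [current, gpair, h0, h1]

end Bounded

/-! ### Geometry of the region and of the observed boundary -/

section Region

variable {m n : ℕ} {T : ℝ} {Ω : Set (E n)} {p : ST m n} {ε : ℝ}

theorem isBounded_cyl (m : ℕ) (T : ℝ) (hΩb : Bornology.IsBounded Ω) :
    Bornology.IsBounded (cyl m T Ω) := by
  refine Bornology.IsBounded.prod ?_ hΩb
  rw [isBounded_iff_forall_norm_le]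
  refine ⟨Real.sqrt (m * T ^ 2), fun t ht => ?_⟩
  apply Real.le_sqrt_of_sq_le
  rw [EuclideanSpace.norm_sq_eq]
  calc ∑ i, ‖t i‖ ^ 2 ≤ ∑ _i : Fin m, T ^ 2 := by
        refine Finset.sum_le_sum fun i _ => ?_
        have := ht i
        rw [Real.norm_eq_abs, sq_abs]
        nlinarith
    _ = m * T ^ 2 := by simp

theorem isOpen_Dp (p : ST m n) : IsOpen (Dp p) :=
  isOpen_lt continuous_const (contDiff_fp p).continuous

theorem rp_le_Rplus (hΩb : Bornology.IsBounded Ω) {q : ST m n}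
    (hq : q ∈ closure (cyl m T Ω ∩ Dp p)) : rp p q ≤ Rplus T Ω p := by
  have hbdd : BddAbove (rp p '' (cyl m T Ω ∩ Dp p)) := by
    have hc : IsCompact (closure (cyl m T Ω)) := (isBounded_cyl m T hΩb).isCompact_closure
    exact (hc.bddAbove_image (continuous_rp p).continuousOn).mono
      (image_mono (inter_subset_left.trans subset_closure))
  exact closure_minimal (fun x hx => le_csSup hbdd ⟨x, hx, rfl⟩)
    (isClosed_le (continuous_rp p) continuous_const) hq

theorem rp_pos_of_fp_pos {q : ST m n} (h : 0 < fp p q) : 0 < rp p q := by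
  have h1 : fp p q = (rp p q ^ 2 - ‖q.1 - p.1‖ ^ 2) / 4 := rfl
  have h2 : 0 ≤ rp p q := norm_nonneg _
  refine h2.lt_of_ne fun h0 => ?_
  rw [← h0] at h1
  nlinarith [sq_nonneg ‖q.1 - p.1‖]

/-- Positivity of f forces r > 0. The bound r ≤ R₊ passes to the closure by continuity, so ε R₊ < 1
keeps the denominator of k positive up to the boundary. -/
theorem mem_regular_of_mem_closure (hΩb : Bornology.IsBounded Ω) (hε : 0 < ε)
    (hεR : ε * Rplus T Ω p < 1) {q : ST m n} (hq : q ∈ closure (cyl m T Ω ∩ Dp p))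
    (hf : 0 < fp p q) : q ∈ regular ε p :=
  ⟨rp_pos_of_fp_pos hf,
    lt_of_le_of_lt (mul_le_mul_of_nonneg_left (rp_le_Rplus hΩb hq) hε.le) hεR⟩

/-- The part of the closure of the region on which `kp` is at least `c`. -/
def superlevel (T : ℝ) (Ω : Set (E n)) (p : ST m n) (ε c : ℝ) : Set (ST m n) :=
  closure (cyl m T Ω ∩ Dp p) ∩ {q | c * (1 - ε * rp p q) ≤ fp p q}

theorem isCompact_superlevel (hΩb : Bornology.IsBounded Ω) (c : ℝ) :
    IsCompact (superlevel T Ω p ε c) := by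
  refine IsCompact.inter_right ((isBounded_cyl m T hΩb).subset inter_subset_left).isCompact_closure
    (isClosed_le ?_ (contDiff_fp p).continuous)
  exact continuous_const.mul (continuous_const.sub (continuous_const.mul (continuous_rp p)))

/-- Here f ≥ c (1 - ε r) ≥ c (1 - ε R₊) > 0, so the superlevel set avoids the null cone although it
is taken in the closure of the region. -/
theorem fp_pos_of_mem_superlevel (hΩb : Bornology.IsBounded Ω) (hε : 0 < ε)
    (hεR : ε * Rplus T Ω p < 1) {c : ℝ} (hc : 0 < c) {q : ST m n}
    (hq : q ∈ superlevel T Ω p ε c) : 0 < fp p q := by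
  refine lt_of_lt_of_le (mul_pos hc ?_) hq.2
  have := mul_le_mul_of_nonneg_left (rp_le_Rplus hΩb hq.1) hε.le
  linarith

/-- A function which is `C¹` up to the lateral boundary is bounded together with its derivative
near compact sets. -/
theorem exists_bound_of_contDiffOn {z : ST m n → ℝ} (hΩ : IsOpen Ω)
    (hz : ContDiffOn ℝ 1 z (cube m T ×ˢ closure Ω)) {K : Set (ST m n)} (hK : IsCompact K)
    (hKs : K ⊆ cube m T ×ˢ closure Ω) :
    ∃ C, ∀ q ∈ K ∩ cyl m T Ω, |z q| ≤ C ∧ ‖fderiv ℝ z q‖ ≤ C := by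
  have hsub : cyl m T Ω ⊆ cube m T ×ˢ closure Ω := prod_mono_right subset_closure
  suffices h : ∃ C, ∀ q ∈ K, q ∈ cyl m T Ω → |z q| ≤ C ∧ ‖fderiv ℝ z q‖ ≤ C by
    obtain ⟨C, hC⟩ := h
    exact ⟨C, fun q hq => hC q hq.1 hq.2⟩
  refine hK.induction_on (p := fun S => ∃ C, ∀ q ∈ S, q ∈ cyl m T Ω → |z q| ≤ C ∧
    ‖fderiv ℝ z q‖ ≤ C) ⟨0, by simp⟩ ?_ ?_ ?_
  · rintro S S' hSS ⟨C, hC⟩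
    exact ⟨C, fun q hq => hC q (hSS hq)⟩
  · rintro S S' ⟨C, hC⟩ ⟨C', hC'⟩
    refine ⟨max C C', ?_⟩
    rintro q (hq | hq) hqU
    · exact ⟨(hC q hq hqU).1.trans (le_max_left _ _), (hC q hq hqU).2.trans (le_max_left _ _)⟩
    · exact ⟨(hC' q hq hqU).1.trans (le_max_right _ _), (hC' q hq hqU).2.trans (le_max_right _ _)⟩
  · intro q hq
    obtain ⟨L, -, hL⟩ := exists_tendsto_fderiv hΩ hz (hKs hq)
    have hzc : Tendsto z (𝓝[cyl m T Ω] q) (𝓝 (z q)) := (hz.continuousOn q (hKs hq)).mono hsub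
    have h1 := hL.norm.eventually_le_const (lt_add_one ‖L‖)
    have h2 := hzc.abs.eventually_le_const (lt_add_one |z q|)
    have h3 := h1.and h2
    rw [eventually_nhdsWithin_iff] at h3
    refine ⟨_, nhdsWithin_le_nhds h3, max (‖L‖ + 1) (|z q| + 1), fun x hx hxU => ?_⟩
    exact ⟨(hx hxU).2.trans (le_max_right _ _), (hx hxU).1.trans (le_max_left _ _)⟩

/-- The solution vanishes near the points of the observed part of the boundary. -/
theorem eventually_eq_zero_of_mem_Gam {z : ST m n → ℝ} {σ : ℝ} (hσ : 0 < σ)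
    (hW : ∀ q ∈ Wp T Ω p ε σ, z q = 0) {y : ST m n} (hy : y ∈ Gam T Ω p ε)
    (hreg : y ∈ regular ε p) :
    ∀ᶠ q in 𝓝[cyl m T Ω ∩ Dp p] y, z q = 0 := by
  obtain ⟨⟨hlat, hD⟩, ν, hν, hpos⟩ := hy
  -- The observation region thickens Γ only in space, so a point q near y has to be matched with a
  -- point of Γ at its own time. Sliding y to (q.1, y.2) keeps the normal ν, and the strict
  -- inequalities persist by continuity.
  have hslice : Continuous fun q : ST m n => ((q.1, y.2) : ST m n) := by fun_prop
  have hcont : ContinuousAt (fun q => (1 - ε * rp p q) * pd (0, ν) (fp p) q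
      + ε * fp p q * pd (0, ν) (rp p) q) y := by
    have h1 : ContinuousAt (rp p) y := (continuous_rp p).continuousAt
    have h2 : ContinuousAt (fp p) y := (contDiff_fp p).continuous.continuousAt
    have h3 : ContinuousAt (pd (0, ν) (fp p)) y :=
      (contDiffAt_pd (n := ∞) (contDiff_fp p).contDiffAt).continuousAt
    have h4 : ContinuousAt (pd (0, ν) (rp p)) y := (contDiffAt_pd (n := ∞)
      ((contDiffOn_rp ε p).contDiffAt ((isOpen_regular ε p).mem_nhds hreg))).continuousAt
    exact ((continuousAt_const.sub (continuousAt_const.mul h1)).mul h3).add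
      ((continuousAt_const.mul h2).mul h4)
  have hpos' : ∀ᶠ q : ST m n in 𝓝 y, 0 < (1 - ε * rp p (q.1, y.2)) * pd (0, ν) (fp p) (q.1, y.2)
      + ε * fp p (q.1, y.2) * pd (0, ν) (rp p) (q.1, y.2) :=
    (hslice.continuousAt (x := y)).eventually
      (hcont.eventually_const_lt (u := 0) hpos)
  have hD' : ∀ᶠ q : ST m n in 𝓝 y, ((q.1, y.2) : ST m n) ∈ Dp p :=
    (hslice.continuousAt (x := y)).eventually ((isOpen_Dp p).mem_nhds hD)
  have hball : ∀ᶠ q : ST m n in 𝓝 y, q.2 ∈ Metric.ball y.2 σ :=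
    continuous_snd.continuousAt.eventually (Metric.ball_mem_nhds _ hσ)
  filter_upwards [nhdsWithin_le_nhds hpos', nhdsWithin_le_nhds hD', nhdsWithin_le_nhds hball,
    self_mem_nhdsWithin] with q h1 h2 h3 hq
  refine hW q ⟨?_, hq⟩
  refine mem_iUnion₂.2 ⟨(q.1, y.2), ⟨⟨⟨hq.1.1, hlat.2⟩, h2⟩, ν, hν, h1⟩, rfl, h3⟩

/-- Off the observed part of the boundary, `kp` does not increase in the outward direction. -/
theorem sum_pd_kp_nonpos {y : ST m n} (hreg : y ∈ regular ε p) (hlat : y ∈ lateral m T Ω)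
    (hf : 0 < fp p y) (hy : y ∉ Gam T Ω p ε) {φ : E n → ℝ} (hφ : IsDefiningAt Ω y.2 φ) :
    ∑ i, pd (bv i) (kp ε p) y * pd (bv i) (fun q => φ q.2) y ≤ 0 := by
  have ha : 0 < 1 - ε * rp p y := by linarith [hreg.2]
  obtain ⟨⟨N, hN, hcd, -⟩, hne⟩ := id hφ
  have hφd : DifferentiableAt ℝ φ y.2 := (hcd.contDiffAt hN).differentiableAt (by simp)
  have hgn : 0 < ‖∇ φ y.2‖ := norm_pos_iff.2 hne
  have hcoord : ∀ i, pd (bv i) (fun q : ST m n => φ q.2) y = coord i ((0, ∇ φ y.2) : ST m n) := by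
    intro i
    have h1 : HasFDerivAt (fun q : ST m n => q.2) (ContinuousLinearMap.snd ℝ (E m) (E n)) y :=
      hasFDerivAt_snd
    have h2 := pd_comp_affine h1 hφd (bv i)
    rw [h2, pd]
    rcases i with i | i
    · simp [bv]
    · have h3 : fderiv ℝ φ y.2 (EuclideanSpace.single i 1)
          = inner ℝ (∇ φ y.2) (EuclideanSpace.single i 1) := by
        simp [gradient]
      simp only [bv, Sum.elim_inr, ContinuousLinearMap.coe_snd', coord_inr]
      rw [h3, EuclideanSpace.inner_single_right]
      simp
  have hsum : ∑ i, pd (bv i) (kp ε p) y * pd (bv i) (fun q : ST m n => φ q.2) y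
      = pd (0, ∇ φ y.2) (kp ε p) y := by
    rw [pd_eq_sum]
    exact Finset.sum_congr rfl fun i _ => by rw [hcoord i, mul_comm]
  rw [hsum]
  set ν := ‖∇ φ y.2‖⁻¹ • ∇ φ y.2 with hν
  have hnot : ¬ 0 < (1 - ε * rp p y) * pd (0, ν) (fp p) y + ε * fp p y * pd (0, ν) (rp p) y :=
    fun h => hy ⟨⟨hlat, hf⟩, ν, ⟨φ, hφ, rfl⟩, h⟩
  have h1 := pd_kp hreg (0, ν)
  have h2 := kp_mul hreg
  -- The expression defining Γ equals (1 - ε r)² ∂_ν k, so failing to be in Γ means precisely ∂_ν k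
  -- ≤ 0 for this normal.
  have h3 : (1 - ε * rp p y) ^ 2 * pd (0, ν) (kp ε p) y ≤ 0 := by
    calc _ = (1 - ε * rp p y) * ((1 - ε * rp p y) * pd (0, ν) (kp ε p) y) := by ring
      _ = (1 - ε * rp p y) * pd (0, ν) (fp p) y
          + ε * ((1 - ε * rp p y) * kp ε p y) * pd (0, ν) (rp p) y := by rw [h1]; ring
      _ ≤ 0 := by rw [h2]; exact not_lt.1 hnot
  have h4 : pd (0, ν) (kp ε p) y ≤ 0 := nonpos_of_mul_nonpos_right h3 (by positivity)
  have h5 : ((0, ∇ φ y.2) : ST m n) = ‖∇ φ y.2‖ • ((0, ν) : ST m n) := by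
    rw [hν]
    simp [smul_smul, hgn.ne']
  rw [h5, pd, map_smul, smul_eq_mul]
  exact mul_nonpos_of_nonneg_of_nonpos hgn.le h4

end Region

/-! ### Integral inequality for the cut-off solution -/

section Uniqueness

variable {m n : ℕ} {T : ℝ} {Ω : Set (E n)} {p : ST m n} {ε : ℝ}

instance : (volume : Measure (ST m n)).IsAddHaarMeasure := by
  rw [Measure.volume_eq_prod]
  infer_instance

/-- A cutoff supported in `{kp ≥ c}` and equal to `1` on `{kp ≥ 2c}`. -/
noncomputable def cutoff (ε : ℝ) (p : ST m n) (c : ℝ) (q : ST m n) : ℝ :=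
  Real.smoothTransition ((kp ε p q - c) / c)

theorem contDiffOn_cutoff (ε : ℝ) (p : ST m n) (c : ℝ) :
    ContDiffOn ℝ ∞ (cutoff ε p c) (regular ε p) :=
  Real.smoothTransition.contDiff.comp_contDiffOn
    (((contDiffOn_kp ε p).sub contDiffOn_const).div_const c)

theorem cutoff_eventuallyEq_zero {c : ℝ} (hc : 0 < c) {q : ST m n} (hq : q ∈ regular ε p)
    (hk : kp ε p q < c) : cutoff ε p c =ᶠ[𝓝 q] fun _ => 0 := by
  have hcont : ContinuousAt (kp ε p) q :=
    (contDiffOn_kp ε p).continuousOn.continuousAt ((isOpen_regular ε p).mem_nhds hq)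
  filter_upwards [hcont.eventually_lt_const hk] with x hx
  exact Real.smoothTransition.zero_of_nonpos
    (div_nonpos_of_nonpos_of_nonneg (by linarith) hc.le)

theorem cutoff_eventuallyEq_one {c : ℝ} (hc : 0 < c) {q : ST m n} (hq : q ∈ regular ε p)
    (hk : 2 * c < kp ε p q) : cutoff ε p c =ᶠ[𝓝 q] fun _ => 1 := by
  have hcont : ContinuousAt (kp ε p) q :=
    (contDiffOn_kp ε p).continuousOn.continuousAt ((isOpen_regular ε p).mem_nhds hq)
  filter_upwards [hcont.eventually_const_lt hk] with x hx
  refine Real.smoothTransition.one_of_one_le ?_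
  rw [le_div_iff₀ hc]
  linarith

/-- The flux of the current through the lateral boundary is nonpositive. -/
theorem eventually_flux_le_of_lateral {z ψ κ Θ : ST m n → ℝ} {σ τ lam : ℝ} (hΩo : IsOpen Ω)
    (hτ : 0 < τ) (hψ : ψ = fun q => Real.exp (τ * kp ε p q))
    (hκ : ContDiffOn ℝ ∞ κ (regular ε p)) (hΘ : ContDiffOn ℝ ∞ Θ (regular ε p)) (hσ : 0 < σ)
    (hz2 : ContDiffOn ℝ 2 z (cyl m T Ω)) (hz1 : ContDiffOn ℝ 1 z (cube m T ×ˢ closure Ω))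
    (hz0 : ∀ q ∈ lateral m T Ω, z q = 0) (hW : ∀ q ∈ Wp T Ω p ε σ, z q = 0) {y : ST m n}
    (hreg : y ∈ regular ε p) (hlat : y ∈ lateral m T Ω) (hf : 0 < fp p y) {φ : E n → ℝ}
    (hφ : IsDefiningAt Ω y.2 φ) {η : ℝ} (hη : 0 < η) :
    ∀ᶠ q in 𝓝[cyl m T Ω ∩ Dp p] y, ∑ i, fderiv ℝ (fun q : ST m n => φ q.2) q (bv i) *
      current bv sg ψ κ lam (fun x => Θ x * z x) i q ≤ η := by
  have hUo : IsOpen (cyl m T Ω ∩ Dp p) := (isOpen_cyl m T hΩo).inter (isOpen_Dp p)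
  -- Near an observed point z vanishes identically in the region, hence so does the current.
  -- Elsewhere the limiting flux has the sign of ∂_ν k.
  by_cases hy : y ∈ Gam T Ω p ε
  · have h := eventually_eq_zero_of_mem_Gam hσ hW hy hreg
    have h' : ∀ᶠ q in 𝓝[cyl m T Ω ∩ Dp p] y, z =ᶠ[𝓝 q] fun _ => 0 := by
      rw [← eventually_eventually_nhdsWithin] at h
      filter_upwards [h, self_mem_nhdsWithin] with q hq hqU
      rwa [hUo.nhdsWithin_eq hqU] at hq
    filter_upwards [h'] with q hq
    have h0 : (fun x => Θ x * z x) =ᶠ[𝓝 q] fun _ => 0 := by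
      filter_upwards [hq] with x hx
      rw [hx, mul_zero]
    rw [Finset.sum_eq_zero fun i _ => by rw [current_eq_zero h0, mul_zero]]
    exact hη.le
  have hRo := isOpen_regular ε p
  have hnh := hRo.mem_nhds hreg
  have hkc := contDiffOn_kp ε p
  have hψc : ContDiffOn ℝ ∞ ψ (regular ε p) := by
    rw [hψ]
    exact (contDiffOn_const.mul hkc).exp
  have hyS : y ∈ cube m T ×ˢ closure Ω := ⟨hlat.1, frontier_subset_closure hlat.2⟩
  have hsub : cyl m T Ω ∩ Dp p ⊆ cyl m T Ω := inter_subset_left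
  have hsub' : cyl m T Ω ⊆ cube m T ×ˢ closure Ω := prod_mono_right subset_closure
  obtain ⟨L, hL, hLt⟩ := exists_tendsto_fderiv hΩo hz1 hyS
  obtain ⟨⟨N, hN, hcd, -⟩, hne⟩ := id hφ
  have hφc : ContDiffAt ℝ ∞ φ y.2 := hcd.contDiffAt hN
  have hφs : ContDiffAt ℝ ∞ (fun q : ST m n => φ q.2) y :=
    ContDiffAt.comp y (g := φ) hφc contDiffAt_snd
  have hfφ : fderiv ℝ φ y.2 ≠ 0 := by
    intro h0
    apply hne
    simp [gradient, h0]
  obtain ⟨e₂, he⟩ : ∃ e₂, fderiv ℝ φ y.2 e₂ = 1 := by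
    obtain ⟨v, hv⟩ := DFunLike.ne_iff.1 hfφ
    exact ⟨(fderiv ℝ φ y.2 v)⁻¹ • v, by rw [map_smul, smul_eq_mul, inv_mul_cancel₀ hv]⟩
  have hpdφ : ∀ v : ST m n, pd v (fun q : ST m n => φ q.2) y = fderiv ℝ φ y.2 v.2 := by
    intro v
    have h1 : HasFDerivAt (fun q : ST m n => q.2) (ContinuousLinearMap.snd ℝ (E m) (E n)) y :=
      hasFDerivAt_snd
    rw [pd_comp_affine h1 (hφc.differentiableAt (by simp)), pd]
    rfl
  -- Since z vanishes along the boundary its differential there is proportional to dφ. Subtracting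
  -- from v the right multiple of (0, e₂) leaves a tangential vector.
  have hLv : ∀ v : ST m n, L v = L (0, e₂) * pd v (fun q : ST m n => φ q.2) y := by
    intro v
    have h1 : L (v - fderiv ℝ φ y.2 v.2 • (0, e₂)) = 0 :=
      fderivWithin_tangential_eq_zero hΩo hlat hz0 hL hφ he (by simp [he])
    rw [map_sub, map_smul, smul_eq_mul, sub_eq_zero] at h1
    rw [h1, hpdφ]
    ring
  have hzt : Tendsto z (𝓝[cyl m T Ω ∩ Dp p] y) (𝓝 0) := by
    rw [← hz0 y hlat]
    exact (hz1.continuousOn y hyS).mono (hsub.trans hsub')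
  have hΘt : Tendsto Θ (𝓝[cyl m T Ω ∩ Dp p] y) (𝓝 (Θ y)) :=
    (hΘ.continuousOn.continuousAt hnh).tendsto.mono_left nhdsWithin_le_nhds
  have hΘd : ∀ v, Tendsto (pd v Θ) (𝓝[cyl m T Ω ∩ Dp p] y) (𝓝 (pd v Θ y)) := fun v =>
    ((contDiffOn_pd hRo hΘ v).continuousOn.continuousAt hnh).tendsto.mono_left nhdsWithin_le_nhds
  refine eventually_flux_le nhdsWithin_le_nhds (hψc.contDiffAt hnh) (hκ.contDiffAt hnh) hφs lam
    (Θ y * L (0, e₂)) (by simpa using hΘt.mul hzt) ?_ ?_ ?_ hη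
  · intro i
    have h1 : Tendsto (fun q => pd (bv i) Θ q * z q + Θ q * pd (bv i) z q)
        (𝓝[cyl m T Ω ∩ Dp p] y) (𝓝 (pd (bv i) Θ y * 0 + Θ y * L (bv i))) :=
      ((hΘd _).mul hzt).add (hΘt.mul
        (((ContinuousLinearMap.apply ℝ ℝ (bv i)).continuous.tendsto L).comp
          (hLt.mono_left (nhdsWithin_mono _ hsub))))
    have h2 : pd (bv i) Θ y * 0 + Θ y * L (bv i)
        = Θ y * L (0, e₂) * pd (bv i) (fun q : ST m n => φ q.2) y := by
      rw [hLv (bv i)]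
      ring
    rw [h2] at h1
    refine h1.congr' ?_
    filter_upwards [nhdsWithin_le_nhds hnh, self_mem_nhdsWithin] with q hq hqU
    have d1 : DifferentiableAt ℝ Θ q :=
      (hΘ.contDiffAt (hRo.mem_nhds hq)).differentiableAt (by simp)
    have d2 : DifferentiableAt ℝ z q :=
      (hz2.contDiffAt ((isOpen_cyl m T hΩo).mem_nhds hqU.1)).differentiableAt two_ne_zero
    exact (pd_mul d1 d2).symm
  · intro i
    rw [hpdφ]
    rcases i with i | i <;> simp [sg, bv]
  · have h := sum_pd_kp_nonpos hreg hlat hf hy hφ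
    have h1 : ∀ i, pd (bv i) ψ y = τ * Real.exp (τ * kp ε p y) * pd (bv i) (kp ε p) y := by
      intro i
      rw [hψ]
      exact pd_exp_mul τ ((hkc.contDiffAt hnh).differentiableAt (by simp))
    have h2 : ∑ i, pd (bv i) ψ y * pd (bv i) (fun q : ST m n => φ q.2) y
        = τ * Real.exp (τ * kp ε p y)
          * ∑ i, pd (bv i) (kp ε p) y * pd (bv i) (fun q : ST m n => φ q.2) y := by
      rw [Finset.mul_sum]
      exact Finset.sum_congr rfl fun i _ => by rw [h1 i]; ring
    rw [h2]
    exact mul_nonpos_of_nonneg_of_nonpos (by positivity) h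

theorem kp_lt_of_notMem_superlevel {c : ℝ} {q : ST m n} (hreg : q ∈ regular ε p)
    (hq : q ∈ cyl m T Ω ∩ Dp p) (hqK : q ∉ superlevel T Ω p ε c) : kp ε p q < c := by
  have ha : 0 < 1 - ε * rp p q := by linarith [hreg.2]
  rw [kp, div_lt_iff₀ ha]
  by_contra h
  exact hqK ⟨subset_closure hq, not_lt.1 h⟩

/-- The cutoff makes the current vanish off the compact superlevel set K, which stays away from the
null cone and from the temporal boundary. Only the lateral flux is left, and it is nonpositive. The
bound on □z is a separate hypothesis because z is only C¹ up to the boundary. -/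
theorem setIntegral_divg_current_nonpos {z ψ κ : ST m n → ℝ} {σ τ lam c : ℝ} (hΩo : IsOpen Ω)
    (hΩb : Bornology.IsBounded Ω) (hΩs : HasSmoothBoundary Ω)
    (hG : closure (cyl m T Ω ∩ Dp p) ⊆ cube m T ×ˢ univ) (hε : 0 < ε)
    (hεR : ε * Rplus T Ω p < 1) (hc : 0 < c)
    (hτ : 0 < τ) (hψ : ψ = fun q => Real.exp (τ * kp ε p q))
    (hκ : ContDiffOn ℝ ∞ κ (regular ε p)) (hσ : 0 < σ)
    (hz2 : ContDiffOn ℝ 2 z (cyl m T Ω)) (hz1 : ContDiffOn ℝ 1 z (cube m T ×ˢ closure Ω))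
    (hzw : BddOn (waveOp bv sg z) (superlevel T Ω p ε c ∩ (cyl m T Ω ∩ Dp p)))
    (hz0 : ∀ q ∈ lateral m T Ω, z q = 0) (hW : ∀ q ∈ Wp T Ω p ε σ, z q = 0) :
    (∃ C, ∀ q ∈ cyl m T Ω ∩ Dp p, |divg bv (current bv sg ψ κ lam
      (fun x => Real.exp (lam * ψ x) * (cutoff ε p c x * z x))) q| ≤ C) ∧
    (∀ i, ContDiffOn ℝ 1 (current bv sg ψ κ lam
      (fun x => Real.exp (lam * ψ x) * (cutoff ε p c x * z x)) i) (cyl m T Ω ∩ Dp p)) ∧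
    ∫ q in cyl m T Ω ∩ Dp p, divg bv (current bv sg ψ κ lam
      (fun x => Real.exp (lam * ψ x) * (cutoff ε p c x * z x))) q ≤ 0 := by
  have hRo := isOpen_regular ε p
  have hkc := contDiffOn_kp ε p
  have hψc : ContDiffOn ℝ ∞ ψ (regular ε p) := by
    rw [hψ]
    exact (contDiffOn_const.mul hkc).exp
  set K := superlevel T Ω p ε c with hKdef
  set U := cyl m T Ω ∩ Dp p with hUdef
  have hK : IsCompact K := isCompact_superlevel hΩb c
  have hUo : IsOpen U := (isOpen_cyl m T hΩo).inter (isOpen_Dp p)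
  have hKf : ∀ q ∈ K, 0 < fp p q := fun q hq => fp_pos_of_mem_superlevel hΩb hε hεR hc hq
  have hKr : K ⊆ regular ε p := fun q hq =>
    mem_regular_of_mem_closure hΩb hε hεR hq.1 (hKf q hq)
  have hUr : U ⊆ regular ε p := fun q hq =>
    mem_regular_of_mem_closure hΩb hε hεR (subset_closure hq) hq.2
  have hKs : K ⊆ cube m T ×ˢ closure Ω := by
    intro q hq
    refine ⟨(hG hq.1).1, ?_⟩
    have h1 : q ∈ closure (cyl m T Ω) := closure_mono inter_subset_left hq.1
    rw [cyl, closure_prod_eq] at h1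
    exact h1.2
  set Θ : ST m n → ℝ := fun x => Real.exp (lam * ψ x) * cutoff ε p c x with hΘdef
  have hΘ : ContDiffOn ℝ ∞ Θ (regular ε p) :=
    (contDiffOn_const.mul hψc).exp.mul (contDiffOn_cutoff ε p c)
  have hwΘ : (fun x => Real.exp (lam * ψ x) * (cutoff ε p c x * z x)) = fun x => Θ x * z x := by
    funext x
    rw [hΘdef]
    ring
  rw [hwΘ]
  set w : ST m n → ℝ := fun x => Θ x * z x with hw
  have hzU : ContDiffOn ℝ 2 z U := hz2.mono inter_subset_left
  have hwU : ContDiffOn ℝ 2 w U := ((hΘ.mono hUr).of_le (by norm_cast)).mul hzU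
  have hJ : ∀ i, ContDiffOn ℝ 1 (current bv sg ψ κ lam w i) U := fun i =>
    contDiffOn_current hUo (hψc.mono hUr) (hκ.mono hUr) hwU lam i
  have hw0 : ∀ q ∈ U, q ∉ K → w =ᶠ[𝓝 q] fun _ => 0 := by
    intro q hq hqK
    filter_upwards [cutoff_eventuallyEq_zero hc (hUr hq)
      (kp_lt_of_notMem_superlevel (hUr hq) hq hqK)] with x hx
    simp [hw, hΘdef, hx]
  have hJK : ∀ i, ∀ q ∈ U, q ∉ K → current bv sg ψ κ lam w i q = 0 := fun i q hq hqK =>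
    current_eq_zero (hw0 q hq hqK) lam i
  have hdK : ∀ q ∈ U, q ∉ K → divg bv (current bv sg ψ κ lam w) q = 0 := by
    intro q hq hqK
    refine Finset.sum_eq_zero fun i _ => ?_
    have h : current bv sg ψ κ lam w i =ᶠ[𝓝 q] fun _ => 0 := by
      filter_upwards [hUo.mem_nhds hq, hK.isClosed.isOpen_compl.mem_nhds hqK] with x h1 h2
        using hJK i x h1 h2
    rw [h.fderiv_eq]
    simp
  -- bounds
  have hsm : ∀ {a : ST m n → ℝ}, ContDiffOn ℝ ∞ a (regular ε p) → BddOn a (K ∩ U) := fun ha =>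
    BddOn.of_continuousOn hK (ha.continuousOn.mono hKr) inter_subset_left
  have hpd : ∀ {a : ST m n → ℝ} (v : ST m n), ContDiffOn ℝ ∞ a (regular ε p) →
      ContDiffOn ℝ ∞ (pd v a) (regular ε p) := fun v ha => contDiffOn_pd hRo ha v
  obtain ⟨Cz, hCz⟩ := exists_bound_of_contDiffOn hΩo hz1 hK hKs
  have hzb : BddOn z (K ∩ U) := ⟨Cz, fun q hq => (hCz q ⟨hq.1, hq.2.1⟩).1⟩
  have hzb' : ∀ v, BddOn (pd v z) (K ∩ U) := fun v => ⟨Cz * ‖v‖, fun q hq =>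
    ((fderiv ℝ z q).le_opNorm v).trans
      (mul_le_mul_of_nonneg_right (hCz q ⟨hq.1, hq.2.1⟩).2 (norm_nonneg _))⟩
  have hΘ2 : ∀ q ∈ U, ContDiffAt ℝ 2 Θ q := fun q hq =>
    (hΘ.contDiffAt (hRo.mem_nhds (hUr hq))).of_le (by norm_cast)
  have hz2' : ∀ q ∈ U, ContDiffAt ℝ 2 z q := fun q hq => hzU.contDiffAt (hUo.mem_nhds hq)
  have hwb : BddOn w (K ∩ U) := (hsm hΘ).mul hzb
  have hwb' : ∀ i, BddOn (pd (bv i) w) (K ∩ U) := fun i =>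
    (((hsm (hpd _ hΘ)).mul hzb).add ((hsm hΘ).mul (hzb' (bv i)))).congr fun q hq =>
      pd_mul ((hΘ2 q hq.2).differentiableAt two_ne_zero)
        ((hz2' q hq.2).differentiableAt two_ne_zero)
  have hwb'' : BddOn (waveOp bv sg w) (K ∩ U) :=
    ((((bddOn_waveOp fun i j => hsm (hpd _ (hpd _ hΘ))).mul hzb).add
      ((bddOn_gpair (fun i => hsm (hpd _ hΘ)) fun i => hzb' _).const_mul 2)).add
      ((hsm hΘ).mul hzw)).congr fun q hq => waveOp_mul (hΘ2 q hq.2) (hz2' q hq.2)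
  have hJb : ∀ i, BddOn (current bv sg ψ κ lam w i) (K ∩ U) := fun i =>
    bddOn_current (fun i => hsm (hpd _ hψc)) (hsm hκ) (fun i => hsm (hpd _ hκ)) hwb hwb' lam i
  have hdb : BddOn (divg bv (current bv sg ψ κ lam w)) (K ∩ U) :=
    bddOn_divg_current (fun i => hsm (hpd _ hψc)) (fun i j => hsm (hpd _ (hpd _ hψc))) (hsm hκ)
      (fun i j => hsm (hpd _ (hpd _ hκ))) hwb hwb' hwb''
      (fun q hq => (hψc.contDiffAt (hRo.mem_nhds (hKr hq.1))).of_le (by norm_cast))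
      (fun q hq => (hκ.contDiffAt (hRo.mem_nhds (hKr hq.1))).of_le (by norm_cast))
      (fun q hq => hwU.contDiffAt (hUo.mem_nhds hq.2)) lam
  choose CJ hCJ using hJb
  obtain ⟨Cd, hCd⟩ := hdb
  set C := |Cd| + ∑ i, |CJ i| with hCdef
  have hC0 : 0 ≤ C := by positivity
  have hCJ' : ∀ i, ∀ q ∈ U, |current bv sg ψ κ lam w i q| ≤ C := by
    intro i q hq
    by_cases hqK : q ∈ K
    · refine (hCJ i q ⟨hqK, hq⟩).trans ((le_abs_self _).trans ?_)
      have := Finset.single_le_sum (f := fun i => |CJ i|) (fun j _ => abs_nonneg _)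
        (Finset.mem_univ i)
      have h2 := abs_nonneg Cd
      linarith
    · rw [hJK i q hq hqK, abs_zero]
      exact hC0
  have hCd' : ∀ q ∈ U, |divg bv (current bv sg ψ κ lam w) q| ≤ C := by
    intro q hq
    by_cases hqK : q ∈ K
    · refine (hCd q ⟨hqK, hq⟩).trans ((le_abs_self _).trans ?_)
      have : 0 ≤ ∑ i, |CJ i| := Finset.sum_nonneg fun i _ => abs_nonneg _
      linarith
    · rw [hdK q hq hqK, abs_zero]
      exact hC0
  refine ⟨⟨C, hCd'⟩, hJ, setIntegral_divg_nonpos hUo hK bv hJ hCJ' hCd' hJK fun q hq => ?_⟩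
  -- On K one has f > 0, the time in the open cube and the space point in the closure of Ω, so a
  -- point of K outside U must lie on the lateral boundary.
  by_cases hqΩ : q.2 ∈ Ω
  · exact Or.inl ⟨⟨(hKs hq).1, hqΩ⟩, hKf q hq⟩
  right
  have hfr : q.2 ∈ frontier Ω := by
    rw [hΩo.frontier_eq]
    exact ⟨(hKs hq).2, hqΩ⟩
  obtain ⟨φ, ⟨N, hN, hcd, hiff⟩, hne⟩ := hΩs q.2 hfr
  obtain ⟨N₁, hN₁N, hN₁o, hqN₁⟩ := mem_nhds_iff.1 hN
  have hcd₁ : ContDiffOn ℝ ∞ φ N₁ := hcd.mono hN₁N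
  have hgrad : ContinuousOn (∇ φ) N₁ := by
    have h1 : ContinuousOn (fderiv ℝ φ) N₁ :=
      hcd₁.continuousOn_fderiv_of_isOpen hN₁o (by simp)
    exact (InnerProductSpace.toDual ℝ (E n)).symm.continuous.comp_continuousOn h1
  -- Shrinking the neighbourhood keeps the gradient of φ nonzero, so a single φ is a defining
  -- function at every nearby boundary point.
  have hN₂o : IsOpen (N₁ ∩ ∇ φ ⁻¹' {0}ᶜ) :=
    hgrad.isOpen_inter_preimage hN₁o isOpen_compl_singleton
  set N₂ := N₁ ∩ ∇ φ ⁻¹' {0}ᶜ with hN₂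
  have hdef : ∀ y ∈ N₂, IsDefiningAt Ω y φ := fun y hy =>
    ⟨⟨N₁, hN₁o.mem_nhds hy.1, hcd₁, fun x hx => hiff x (hN₁N hx)⟩, hy.2⟩
  refine ⟨fun q => φ q.2, (cube m T ×ˢ N₂) ∩ Dp p, ?_, ?_, ?_, ?_, ?_⟩
  · exact (((isOpen_cube m T).prod hN₂o).inter (isOpen_Dp p)).mem_nhds
      ⟨⟨(hKs hq).1, hqN₁, hne⟩, hKf q hq⟩
  · exact (hcd₁.of_le (by norm_cast)).comp contDiffOn_snd fun y hy => hy.1.2.1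
  · intro y hy
    rw [← hiff y.2 (hN₁N hy.1.2.1)]
    exact ⟨fun h => h.1.2, fun h => ⟨⟨hy.1.1, h⟩, hy.2⟩⟩
  · intro h0
    apply hne
    have hφd : DifferentiableAt ℝ φ q.2 := (hcd.contDiffAt hN).differentiableAt (by simp)
    have h1 : HasFDerivAt (fun q : ST m n => q.2) (ContinuousLinearMap.snd ℝ (E m) (E n)) q :=
      hasFDerivAt_snd
    have h2 : fderiv ℝ φ q.2 = 0 := by
      ext v
      have h3 := pd_comp_affine h1 hφd (0, v)
      rw [pd, h0] at h3
      simpa [pd] using h3.symm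
    simp [gradient, h2]
  · intro y hy hyK hφy η hη
    have hyfr : y.2 ∈ frontier Ω := by
      rw [hΩo.frontier_eq]
      refine ⟨(hKs hyK).2, fun h => ?_⟩
      have := (hiff y.2 (hN₁N hy.1.2.1)).1 h
      simp only at hφy
      linarith
    exact eventually_flux_le_of_lateral hΩo hτ hψ hκ hΘ hσ hz2 hz1 hz0 hW (hKr hyK)
      ⟨hy.1.1, hyfr⟩ (hKf y hyK) (hdef y.2 hy.1.2) hη

end Uniqueness

/-! ### Absorption, large parameter limit and the theorem -/

section Uniqueness

variable {m n : ℕ} {T : ℝ} {Ω : Set (E n)} {p : ST m n} {ε : ℝ}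

/-- A lower-order perturbation of the wave operator is controlled by the first-order jet. -/
theorem exists_waveOp_sq_le {z V : ST m n → ℝ} {X : ST m n → ST m n}
    (hΩb : Bornology.IsBounded Ω) (hX : ContinuousOn X (closure (cyl m T Ω)))
    (hV : ContinuousOn V (closure (cyl m T Ω)))
    (heq : ∀ q ∈ cyl m T Ω, waveOp bv sg z q + fderiv ℝ z q (X q) + V q * z q = 0) :
    ∃ C, 0 ≤ C ∧ ∀ q ∈ cyl m T Ω,
      waveOp bv sg z q ^ 2 ≤ C * (∑ i, pd (bv i) z q ^ 2 + z q ^ 2) := by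
  have hcpt : IsCompact (closure (cyl m T Ω)) := (isBounded_cyl m T hΩb).isCompact_closure
  obtain ⟨C₁, hC₁, h₁⟩ := exists_abs_le_of_isCompact hcpt (f := fun q => ∑ i, coord i (X q) ^ 2)
    (continuousOn_finsetSum _ fun i _ => ((coord i).continuous.comp_continuousOn hX).pow 2)
  obtain ⟨C₂, hC₂, h₂⟩ := exists_abs_le_of_isCompact hcpt (f := fun q => V q ^ 2) (hV.pow 2)
  refine ⟨2 * C₁ + 2 * C₂, by positivity, fun q hq => ?_⟩
  have hX1 : ∑ i, coord i (X q) ^ 2 ≤ C₁ := le_of_abs_le (h₁ q (subset_closure hq))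
  have hV1 : V q ^ 2 ≤ C₂ := le_of_abs_le (h₂ q (subset_closure hq))
  have hD := pd_eq_sum (X q) z q
  have hcs : pd (X q) z q ^ 2 ≤ C₁ * ∑ i, pd (bv i) z q ^ 2 := by
    rw [hD]
    refine (Finset.sum_mul_sq_le_sq_mul_sq _ _ _).trans ?_
    exact mul_le_mul_of_nonneg_right hX1 (Finset.sum_nonneg fun i _ => sq_nonneg _)
  have hvz : (V q * z q) ^ 2 ≤ C₂ * z q ^ 2 := by
    rw [mul_pow]
    exact mul_le_mul_of_nonneg_right hV1 (sq_nonneg _)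
  have hw : waveOp bv sg z q = -(pd (X q) z q + V q * z q) := by
    have := heq q hq
    rw [pd]
    linarith
  have hS : 0 ≤ ∑ i, pd (bv i) z q ^ 2 := Finset.sum_nonneg fun i _ => sq_nonneg _
  rw [hw]
  nlinarith [sq_nonneg (pd (X q) z q - V q * z q), mul_nonneg hC₁ (sq_nonneg (z q)),
    mul_nonneg hC₂ hS]

/-- A solution of the homogeneous problem which vanishes on the observation region vanishes on
`𝔘 ∩ 𝔇_p`. -/
theorem eq_zero_of_observation {z V : ST m n → ℝ} {X : ST m n → ST m n} {σ : ℝ} (hΩo : IsOpen Ω)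
    (hΩb : Bornology.IsBounded Ω) (hΩs : HasSmoothBoundary Ω)
    (hG : closure (cyl m T Ω ∩ Dp p) ⊆ cube m T ×ˢ univ) (hε : 0 < ε)
    (hεR : ε * Rplus T Ω p < 1) (hσ : 0 < σ) (hX : ContinuousOn X (closure (cyl m T Ω)))
    (hV : ContinuousOn V (closure (cyl m T Ω)))
    (hz2 : ContDiffOn ℝ 2 z (cyl m T Ω)) (hz1 : ContDiffOn ℝ 1 z (cube m T ×ˢ closure Ω))
    (heq : ∀ q ∈ cyl m T Ω, waveOp bv sg z q + fderiv ℝ z q (X q) + V q * z q = 0)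
    (hz0 : ∀ q ∈ lateral m T Ω, z q = 0) (hW : ∀ q ∈ Wp T Ω p ε σ, z q = 0)
    {q₁ : ST m n} (hq₁ : q₁ ∈ cyl m T Ω ∩ Dp p) : z q₁ = 0 := by
  by_contra hne
  have hRo := isOpen_regular ε p
  have hkc := contDiffOn_kp ε p
  set U := cyl m T Ω ∩ Dp p with hUdef
  have hUo : IsOpen U := (isOpen_cyl m T hΩo).inter (isOpen_Dp p)
  have hUr : U ⊆ regular ε p := fun q hq =>
    mem_regular_of_mem_closure hΩb hε hεR (subset_closure hq) hq.2
  have hapos : ∀ q ∈ regular ε p, 0 < 1 - ε * rp p q := fun q hq => by linarith [hq.2]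
  have hk1 : 0 < kp ε p q₁ := div_pos hq₁.2 (hapos _ (hUr hq₁))
  -- A third places q₁ strictly inside {k > 2c}, where the cutoff is 1 and the weight exceeds its
  -- values on the transition region.
  set c := kp ε p q₁ / 3 with hcdef
  have hc : 0 < c := by positivity
  set K := superlevel T Ω p ε c with hKdef
  have hK : IsCompact K := isCompact_superlevel hΩb c
  have hKf : ∀ q ∈ K, 0 < fp p q := fun q hq => fp_pos_of_mem_superlevel hΩb hε hεR hc hq
  have hKr : K ⊆ regular ε p := fun q hq =>
    mem_regular_of_mem_closure hΩb hε hεR hq.1 (hKf q hq)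
  have hKs : K ⊆ cube m T ×ˢ closure Ω := by
    intro q hq
    refine ⟨(hG hq.1).1, ?_⟩
    have h1 : q ∈ closure (cyl m T Ω) := closure_mono inter_subset_left hq.1
    rw [cyl, closure_prod_eq] at h1
    exact h1.2
  obtain ⟨τ, hτ, μ, hμ, hZ, hQ⟩ := exists_weight hε hK hKr hKf
  set ψ : ST m n → ℝ := fun x => Real.exp (τ * kp ε p x) with hψ
  have hψc : ContDiffOn ℝ ∞ ψ (regular ε p) := (contDiffOn_const.mul hkc).exp
  set κ : ST m n → ℝ := fun x => waveOp bv sg ψ x / 2 - μ x with hκdef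
  have hκ : ContDiffOn ℝ ∞ κ (regular ε p) := ((contDiffOn_waveOp hRo hψc).div_const 2).sub hμ
  obtain ⟨c₁, hc₁, lam₀, hlam₀, hcarl⟩ := carleman_pointwise hRo hK hKr hψc hμ hZ hQ
  obtain ⟨C₂, hC₂, hwz⟩ := exists_waveOp_sq_le hΩb hX hV heq
  obtain ⟨Cz, hCz⟩ := exists_bound_of_contDiffOn hΩo hz1 hK hKs
  have hzb : BddOn z (K ∩ U) := ⟨Cz, fun q hq => (hCz q ⟨hq.1, hq.2.1⟩).1⟩
  have hzb' : ∀ v, BddOn (pd v z) (K ∩ U) := fun v => ⟨Cz * ‖v‖, fun q hq =>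
    ((fderiv ℝ z q).le_opNorm v).trans
      (mul_le_mul_of_nonneg_right (hCz q ⟨hq.1, hq.2.1⟩).2 (norm_nonneg _))⟩
  -- The equation bounds □z by first-order quantities, which are bounded up to the boundary even
  -- though second derivatives of z need not be.
  have hzw : BddOn (waveOp bv sg z) (K ∩ U) := by
    obtain ⟨B, hB⟩ := ((BddOn.sum Finset.univ fun i => (hzb' (bv i)).sq).add hzb.sq).const_mul C₂
    refine ⟨Real.sqrt B, fun q hq => Real.abs_le_sqrt ?_⟩
    exact (hwz q hq.2.1).trans ((le_abs_self _).trans (hB q hq))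
  set u : ST m n → ℝ := fun x => cutoff ε p c x * z x with hu
  have hζ := contDiffOn_cutoff ε p c
  have hzU : ContDiffOn ℝ 2 z U := hz2.mono inter_subset_left
  have hz2' : ∀ q ∈ U, ContDiffAt ℝ 2 z q := fun q hq => hzU.contDiffAt (hUo.mem_nhds hq)
  have hζ2 : ∀ q ∈ U, ContDiffAt ℝ 2 (cutoff ε p c) q := fun q hq =>
    (hζ.contDiffAt (hRo.mem_nhds (hUr hq))).of_le (by norm_cast)
  have hu2 : ∀ q ∈ U, ContDiffAt ℝ 2 u q := fun q hq => (hζ2 q hq).mul (hz2' q hq)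
  have hsm : ∀ {a : ST m n → ℝ}, ContDiffOn ℝ ∞ a (regular ε p) → BddOn a (K ∩ U) := fun ha =>
    BddOn.of_continuousOn hK (ha.continuousOn.mono hKr) inter_subset_left
  have huw : BddOn (waveOp bv sg u) (K ∩ U) :=
    ((((bddOn_waveOp fun i j => hsm (contDiffOn_pd hRo (contDiffOn_pd hRo hζ _) _)).mul hzb).add
      ((bddOn_gpair (fun i => hsm (contDiffOn_pd hRo hζ _)) fun i => hzb' _).const_mul 2)).add
      ((hsm hζ).mul hzw)).congr fun q hq => waveOp_mul (hζ2 q hq.2) (hz2' q hq.2)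
  obtain ⟨C₃, hC₃⟩ := huw.sq
  have hC₃' : ∀ q ∈ K ∩ U, waveOp bv sg u q ^ 2 ≤ |C₃| := fun q hq =>
    (le_abs_self _).trans ((hC₃ q hq).trans (le_abs_self _))
  -- the set on which the solution does not vanish
  set a := z q₁ ^ 2 / 2 with ha
  have hz1sq : 0 < z q₁ ^ 2 := by positivity
  have ha0 : 0 < a := by positivity
  have hkU : ContinuousOn (kp ε p) U := hkc.continuousOn.mono hUr
  set B := U ∩ {q | 2 * c < kp ε p q ∧ a < z q ^ 2} with hB
  have hBo : IsOpen B := by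
    have h1 := (hkU.prodMk (hzU.continuousOn.pow 2)).isOpen_inter_preimage hUo
      ((isOpen_Ioi (a := 2 * c)).prod (isOpen_Ioi (a := a)))
    exact h1
  have hBne : B.Nonempty := ⟨q₁, hq₁, by constructor <;> linarith⟩
  have hBU : B ⊆ U := inter_subset_left
  have hUb : Bornology.IsBounded U := (isBounded_cyl m T hΩb).subset inter_subset_left
  have hUfin : volume U < ⊤ := hUb.measure_lt_top
  have hBpos : 0 < volume.real B := by
    rw [measureReal_def, ENNReal.toReal_pos_iff]
    exact ⟨hBo.measure_pos volume hBne, (measure_mono hBU).trans_lt hUfin⟩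
  -- the inequality for large parameters
  have hmain : ∀ lam, lam₀ ≤ lam → 2 * C₂ / c₁ ≤ lam →
      c₁ / 2 * lam ^ 2 * a * volume.real B ≤ |C₃| * volume.real U := by
    intro lam hlam hlamC
    have hlam1 : 1 ≤ lam := hlam₀.trans hlam
    have hl0 : 0 < lam := by linarith
    obtain ⟨⟨C, hC⟩, hJc, hint⟩ := setIntegral_divg_current_nonpos (lam := lam) hΩo hΩb hΩs hG hε
      hεR hc hτ hψ hκ hσ hz2 hz1 hzw hz0 hW
    set J := current bv sg ψ κ lam (fun x => Real.exp (lam * ψ x) * (cutoff ε p c x * z x)) with hJ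
    -- The squared weight at k = 2c separates the two regimes: it bounds the weight from above where
    -- the cutoff varies and from below on `B`, and cancels at the end.
    set E₂ := Real.exp (lam * Real.exp (τ * (2 * c))) ^ 2 with hE₂
    have hE₂0 : 0 < E₂ := by positivity
    have hlow : ∀ q ∈ U, -(E₂ * |C₃|) + B.indicator (fun _ => E₂ * (c₁ / 2 * lam ^ 2 * a)) q
        ≤ divg bv J q := by
      intro q hq
      have hCn : 0 ≤ E₂ * |C₃| := by positivity
      by_cases hk2 : 2 * c < kp ε p q
      · have hqK : q ∈ K := by
          by_contra hqK
          have := kp_lt_of_notMem_superlevel (hUr hq) hq hqK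
          linarith
        have hcr := hcarl lam hlam q hqK u (hu2 q hq)
        have huz : u =ᶠ[𝓝 q] z := by
          filter_upwards [cutoff_eventuallyEq_one hc (hUr hq) hk2] with x hx
          simp [hu, hx]
        have h1 : waveOp bv sg u q ^ 2 ≤ C₂ * (∑ i, pd (bv i) u q ^ 2 + u q ^ 2) := by
          rw [waveOp_congr huz, huz.eq_of_nhds]
          simp only [pd_congr huz]
          exact hwz q hq.1
        have hS : 0 ≤ ∑ i, pd (bv i) u q ^ 2 := Finset.sum_nonneg fun i _ => sq_nonneg _
        -- Absorption: where the cutoff is 1, lower-order terms of the equation cost at most half of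
        -- the coercive part once λ ≥ 2 C₂ / c₁.
        have h2 : waveOp bv sg u q ^ 2 / lam
            ≤ c₁ / 2 * (∑ i, pd (bv i) u q ^ 2 + lam ^ 2 * u q ^ 2) := by
          rw [div_le_iff₀ hl0]
          have h3 : C₂ ≤ c₁ / 2 * lam := by
            rw [div_le_iff₀ hc₁] at hlamC
            linarith
          have h4 : ∑ i, pd (bv i) u q ^ 2 + u q ^ 2
              ≤ ∑ i, pd (bv i) u q ^ 2 + lam ^ 2 * u q ^ 2 := by
            have : u q ^ 2 ≤ lam ^ 2 * u q ^ 2 :=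
              le_mul_of_one_le_left (sq_nonneg _) (one_le_pow₀ hlam1)
            linarith
          calc _ ≤ C₂ * (∑ i, pd (bv i) u q ^ 2 + u q ^ 2) := h1
            _ ≤ (c₁ / 2 * lam) * (∑ i, pd (bv i) u q ^ 2 + lam ^ 2 * u q ^ 2) :=
              mul_le_mul h3 h4 (by positivity) (by positivity)
            _ = _ := by ring
        have h5 : Real.exp (lam * ψ q) ^ 2 * (c₁ / 2 * lam ^ 2 * z q ^ 2) ≤ divg bv J q := by
          refine le_trans (mul_le_mul_of_nonneg_left ?_ (sq_nonneg _)) hcr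
          have h6 : 0 ≤ c₁ / 2 * ∑ i, pd (bv i) u q ^ 2 := by positivity
          have h7 : u q = z q := huz.eq_of_nhds
          rw [← h7]
          linarith
        by_cases hqB : q ∈ B
        · rw [indicator_of_mem hqB]
          have h6 : E₂ ≤ Real.exp (lam * ψ q) ^ 2 := by
            refine pow_le_pow_left₀ (Real.exp_pos _).le (Real.exp_le_exp.2 ?_) 2
            refine mul_le_mul_of_nonneg_left (Real.exp_le_exp.2 ?_) hl0.le
            exact mul_le_mul_of_nonneg_left hk2.le hτ.le
          have h7 : E₂ * (c₁ / 2 * lam ^ 2 * a)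
              ≤ Real.exp (lam * ψ q) ^ 2 * (c₁ / 2 * lam ^ 2 * z q ^ 2) :=
            mul_le_mul h6 (mul_le_mul_of_nonneg_left hqB.2.2.le (by positivity)) (by positivity)
              (sq_nonneg _)
          linarith
        · rw [indicator_of_notMem hqB]
          have : 0 ≤ Real.exp (lam * ψ q) ^ 2 * (c₁ / 2 * lam ^ 2 * z q ^ 2) := by positivity
          linarith
      · have hqB : q ∉ B := fun h => hk2 h.2.1
        rw [indicator_of_notMem hqB, add_zero]
        by_cases hqK : q ∈ K
        -- Transition region c ≤ k ≤ 2c: □u contains derivatives of the cutoff and cannot be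
        -- absorbed, but the weight is at most `E₂` and |□u|² is bounded independently of λ.
        · have hcr := hcarl lam hlam q hqK u (hu2 q hq)
          refine le_trans ?_ hcr
          have hS : 0 ≤ ∑ i, pd (bv i) u q ^ 2 := Finset.sum_nonneg fun i _ => sq_nonneg _
          have h1 : 0 ≤ c₁ * (∑ i, pd (bv i) u q ^ 2 + lam ^ 2 * u q ^ 2) := by positivity
          have h2 : waveOp bv sg u q ^ 2 / lam ≤ |C₃| :=
            (div_le_self (sq_nonneg _) hlam1).trans (hC₃' q ⟨hqK, hq⟩)
          have h6 : Real.exp (lam * ψ q) ^ 2 ≤ E₂ := by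
            refine pow_le_pow_left₀ (Real.exp_pos _).le (Real.exp_le_exp.2 ?_) 2
            refine mul_le_mul_of_nonneg_left (Real.exp_le_exp.2 ?_) hl0.le
            exact mul_le_mul_of_nonneg_left (not_lt.1 hk2) hτ.le
          have h7 : Real.exp (lam * ψ q) ^ 2 * |C₃| ≤ E₂ * |C₃| :=
            mul_le_mul_of_nonneg_right h6 (abs_nonneg _)
          have h8 : Real.exp (lam * ψ q) ^ 2 * (-|C₃|) ≤ Real.exp (lam * ψ q) ^ 2 *
              (c₁ * (∑ i, pd (bv i) u q ^ 2 + lam ^ 2 * u q ^ 2)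
                - waveOp bv sg u q ^ 2 / lam) :=
            mul_le_mul_of_nonneg_left (by linarith) (sq_nonneg _)
          linarith
        · have h0 : divg bv J q = 0 := by
            refine Finset.sum_eq_zero fun i _ => ?_
            have h : J i =ᶠ[𝓝 q] fun _ => 0 := by
              have h1 := cutoff_eventuallyEq_zero hc (hUr hq)
                (kp_lt_of_notMem_superlevel (hUr hq) hq hqK)
              filter_upwards [h1.eventuallyEq_nhds] with x hx
              refine current_eq_zero ?_ lam i
              filter_upwards [hx] with x' hx'
              simp [hx']
            rw [h.fderiv_eq]
            simp
          rw [h0]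
          linarith
    have hdi : IntegrableOn (divg bv J) U := by
      refine IntegrableOn.of_bound hUfin
        ((continuousOn_divg hUo bv hJc).aestronglyMeasurable hUo.measurableSet) C ?_
      filter_upwards [ae_restrict_mem hUo.measurableSet] with q hq using hC q hq
    have hi1 : IntegrableOn (fun _ : ST m n => -(E₂ * |C₃|)) U := integrableOn_const hUfin.ne
    have hi2 : IntegrableOn (B.indicator fun _ => E₂ * (c₁ / 2 * lam ^ 2 * a)) U :=
      (integrableOn_const hUfin.ne).indicator hBo.measurableSet
    have hle := (setIntegral_mono_on (hi1.add hi2) hdi hUo.measurableSet hlow).trans hint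
    simp only [Pi.add_apply] at hle
    rw [integral_add hi1 hi2, setIntegral_const, setIntegral_indicator hBo.measurableSet,
      inter_eq_self_of_subset_right hBU, setIntegral_const, smul_eq_mul, smul_eq_mul] at hle
    have h9 : E₂ * (c₁ / 2 * lam ^ 2 * a * volume.real B) ≤ E₂ * (|C₃| * volume.real U) := by
      linarith
    exact le_of_mul_le_mul_left h9 hE₂0
  set D := c₁ / 2 * a * volume.real B with hD
  have hD0 : 0 < D := by positivity
  have hR0 : 0 ≤ |C₃| * volume.real U := by positivity
  -- The last entry makes λ D exceed the right-hand side, and λ ≥ 1 gives λ² D ≥ λ D, contradicting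
  -- `hmain`.
  set lam := max lam₀ (max (2 * C₂ / c₁) (|C₃| * volume.real U / D + 1)) with hlamdef
  have h1 := hmain lam (le_max_left _ _) ((le_max_left _ _).trans (le_max_right _ _))
  have h2 : |C₃| * volume.real U / D + 1 ≤ lam := (le_max_right _ _).trans (le_max_right _ _)
  have h3 : |C₃| * volume.real U < lam * D := by
    rw [← div_lt_iff₀ hD0]
    linarith
  have h4 : 1 ≤ lam := hlam₀.trans (le_max_left _ _)
  have h5 : lam * D ≤ lam ^ 2 * D :=
    mul_le_mul_of_nonneg_right (by nlinarith) hD0.le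
  have h6 : c₁ / 2 * lam ^ 2 * a * volume.real B = lam ^ 2 * D := by rw [hD]; ring
  linarith

/-- Two solutions which agree on the observation region agree on `𝔘 ∩ 𝔇_p`. -/
theorem IsSolution.eq_of_observation {X : ST m n → ST m n} {V F H z₁ z₂ : ST m n → ℝ} {σ : ℝ}
    (hΩo : IsOpen Ω) (hΩb : Bornology.IsBounded Ω) (hΩs : HasSmoothBoundary Ω)
    (hG : closure (cyl m T Ω ∩ Dp p) ⊆ cube m T ×ˢ univ) (hε : 0 < ε)
    (hεR : ε * Rplus T Ω p < 1) (hσ : 0 < σ) (hX : ContinuousOn X (closure (cyl m T Ω)))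
    (hV : ContinuousOn V (closure (cyl m T Ω)))
    (hz₁ : IsSolution T Ω X V F H z₁) (hz₂ : IsSolution T Ω X V F H z₂)
    (hW : ∀ q ∈ Wp T Ω p ε σ, z₁ q = z₂ q) {q : ST m n} (hq : q ∈ cyl m T Ω ∩ Dp p) :
    z₁ q = z₂ q := by
  have hUo := isOpen_cyl m T hΩo
  rw [← sub_eq_zero]
  refine eq_zero_of_observation (z := fun q => z₁ q - z₂ q) hΩo hΩb hΩs hG hε hεR hσ hX hV
    (hz₁.contDiffOn_two.sub hz₂.contDiffOn_two) (hz₁.contDiffOn_one.sub hz₂.contDiffOn_one) ?_ ?_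
    (fun q hq => sub_eq_zero.2 (hW q hq)) hq
  · intro x hx
    have c₁ : ContDiffAt ℝ 2 z₁ x := hz₁.contDiffOn_two.contDiffAt (hUo.mem_nhds hx)
    have c₂ : ContDiffAt ℝ 2 z₂ x := hz₂.contDiffOn_two.contDiffAt (hUo.mem_nhds hx)
    have e₁ := hz₁.equation x hx
    have e₂ := hz₂.equation x hx
    rw [box_eq_waveOp c₁] at e₁
    rw [box_eq_waveOp c₂] at e₂
    have d₁ := c₁.differentiableAt two_ne_zero
    have d₂ := c₂.differentiableAt two_ne_zero
    have hwave : waveOp bv sg (fun q => z₁ q - z₂ q) x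
        = waveOp bv sg z₁ x - waveOp bv sg z₂ x := by
      simp only [waveOp, ← Finset.sum_sub_distrib]
      refine Finset.sum_congr rfl fun i _ => ?_
      have h : pd (bv i) (fun q => z₁ q - z₂ q) =ᶠ[𝓝 x]
          fun q => pd (bv i) z₁ q - pd (bv i) z₂ q := by
        filter_upwards [c₁.eventually (by simp), c₂.eventually (by simp)] with y h1 h2
        exact pd_sub (h1.differentiableAt two_ne_zero) (h2.differentiableAt two_ne_zero)
      rw [pd_congr h, pd_sub (differentiableAt_pd c₁) (differentiableAt_pd c₂)]
      ring
    rw [hwave, fderiv_fun_sub d₁ d₂, _root_.sub_apply]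
    linarith
  · intro x hx
    rw [hz₁.dirichlet x hx, hz₂.dirichlet x hx, sub_self]

end Uniqueness

end Ultrahyperbolic

theorem theorem4p2 (m n : ℕ) (hm : 0 < m) (hn : 0 < n)
    (T : ℝ) (Ω : Set (Ultrahyperbolic.E n))
    (hΩne : Ω.Nonempty) (hΩo : IsOpen Ω) (hΩb : Bornology.IsBounded Ω)
    (hΩs : Ultrahyperbolic.HasSmoothBoundary Ω)
    (p : Ultrahyperbolic.ST m n)
    (hT : Ultrahyperbolic.Rplus T Ω p < T)
    (hG : closure (Ultrahyperbolic.cyl m T Ω ∩ Ultrahyperbolic.Dp p) ⊆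
      Ultrahyperbolic.cube m T ×ˢ (univ : Set (Ultrahyperbolic.E n)))
    (X : Ultrahyperbolic.ST m n → Ultrahyperbolic.ST m n)
    (V F H : Ultrahyperbolic.ST m n → ℝ)
    (hX : ContDiffOn ℝ ∞ X (closure (Ultrahyperbolic.cyl m T Ω)))
    (hX0 : ∀ q ∈ Ultrahyperbolic.cyl m T Ω ∩ frontier (Ultrahyperbolic.Dp p), X q = 0)
    (hV : ContDiffOn ℝ ∞ V (closure (Ultrahyperbolic.cyl m T Ω)))
    (hF : ContDiffOn ℝ ∞ F (closure (Ultrahyperbolic.cyl m T Ω)))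
    (ε σ : ℝ) (hε : 0 < ε) (hεR : ε * Ultrahyperbolic.Rplus T Ω p < 1) (hσ : 0 < σ)
    (z₁ z₂ : Ultrahyperbolic.ST m n → ℝ)
    (hz₁ : Ultrahyperbolic.IsSolution T Ω X V F H z₁)
    (hz₂ : Ultrahyperbolic.IsSolution T Ω X V F H z₂) :
    ((∀ q ∈ Ultrahyperbolic.Wp T Ω p ε σ,
        z₁ q = z₂ q ∧ Ultrahyperbolic.gradT z₁ q = Ultrahyperbolic.gradT z₂ q) →
      ∀ q ∈ Ultrahyperbolic.cyl m T Ω ∩ Ultrahyperbolic.Dp p, z₁ q = z₂ q) ∧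
    ((∀ q ∈ Ultrahyperbolic.Wp T Ω p ε σ,
        z₁ q = z₂ q ∧ Ultrahyperbolic.gradX z₁ q = Ultrahyperbolic.gradX z₂ q) →
      ∀ q ∈ Ultrahyperbolic.cyl m T Ω ∩ Ultrahyperbolic.Dp p, z₁ q = z₂ q) := by

  -- Agreement of the values on the observation region already determines the difference, so the two
  -- kinds of observed data are treated at once.
  have key : (∀ q ∈ Ultrahyperbolic.Wp T Ω p ε σ, z₁ q = z₂ q) →
      ∀ q ∈ Ultrahyperbolic.cyl m T Ω ∩ Ultrahyperbolic.Dp p, z₁ q = z₂ q := fun hW q hq =>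
    Ultrahyperbolic.IsSolution.eq_of_observation hΩo hΩb hΩs hG hε hεR hσ hX.continuousOn
      hV.continuousOn hz₁ hz₂ hW hq
  exact ⟨fun h => key fun q hq => (h q hq).1, fun h => key fun q hq => (h q hq).1⟩
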